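/- **Setting.** Let $d\ge 1$, $\Omega_0=(-d,d)$, $|\Omega_0|=2d$, $\bar\nu>0$ and $\nu_1,\dots,\nu_5\in\mathbb R$. For $\nu\in\mathbb R$ let $$\mathbb l_\nu=\begin{bmatrix}\nu\Delta+\nu_1&\nu_2\\ \nu_3&\Delta-\nu_2\end{bmatrix},\qquad \mathscr l(\xi)=\begin{bmatrix}-\bar\nu|2\pi\xi|^2+\nu_1&\nu_2\\ \nu_3&-|2\pi\xi|^2-\nu_2\end{bmatrix},$$ and assume that $|\det\mathscr l(\xi)|\ge\sigma_0>0$ for all $\xi\in\mathbb R$. Let $L^2_e(\mathbb R)$ be the space of real-valued even functions in $L^2(\mathbb R)$, let $L^2_e=L^2_e(\mathbb R)^2$ with norm $\|\cdot\|_2$, and let $\mathcal H_e=\{\mathbf u\in L^2_e:\ \mathscr l\hat{\mathbf u}\in L^2\times L^2\}$ with $\|\mathbf u\|_{\mathcal H}=\|\mathbb l_{\bar\nu}\mathbf u\|_2$; these are the pairs of even $H^2$ functions. Let $H_1=\mathbb R\times\mathcal H_e^2$ and $H_2=\mathbb R\times(L^2_e)^2$ with the Hilbert norms $(|\nu|^2+\|\mathbf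 u\|^2+\|\mathbf w\|^2)^{1/2}$. Put $p(\mathbf u)=u_1^2u_2+\nu_4u_1^2+\nu_5u_1u_2$, $\mathbb f(\nu,\mathbf u)=\mathbb l_\nu\mathbf u+(p(\mathbf u),-p(\mathbf u))$ and, for fixed $\boldsymbol\xi\in\mathcal H_e$ and $\alpha\in\mathbb R$, define the saddle-node map $$\mathbb F:H_1\to H_2,\qquad \mathbb F(\nu,\mathbf u,\mathbf w)=\big((\mathbb l_{\bar\nu}\boldsymbol\xi,\mathbf w)_2-\alpha,\ \mathbb f(\nu,\mathbf u),\ D_{\mathbf u}\mathbb f(\nu,\mathbf u)\mathbf w\big).$$ **Sequence spaces.** Let $\alpha_0=1$, $\alpha_n=2$ for $n\ge1$, and let $\|U\|_p=(\sum_{n\ge0}\alpha_n|u_n|^p)^{1/p}$ be the norm of $\ell^p(\mathbb N_0)$ (real sequences). Let $\ell^2_e=\ell^2(\mathbb N_0)^2$ with norm $\|\cdot\|_2$, and $X_2=\mathbb R\times(\ell^2_e)^2$ with $\|(\nu,\mathbf U,\mathbf W)\|_{X_2}=(|\nu|^2+|\Omega_0|\|\mathbf U\|_2^2+|\Omega_0|\|\mathbf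 W\|_2^2)^{1/2}$. For $u\in L^2_e(\mathbb R)$ and $U\in\ell^2(\mathbb N_0)$ let $$(\gamma u)_n=\tfrac1{|\Omega_0|}\int_{\Omega_0}u(x)\cos\big(2\pi\tfrac{n}{2d}x\big)dx,\qquad \gamma^\dagger(U)(x)=\mathbb 1_{\Omega_0}(x)\sum_{n\ge0}\alpha_nu_n\cos\big(2\pi\tfrac n{2d}x\big),\qquad U*V=\gamma(\gamma^\dagger(U)\gamma^\dagger(V)).$$ Let $\bar\gamma=\mathrm{diag}(1,\gamma,\gamma,\gamma,\gamma):H_2\to X_2$ and $\bar\gamma^\dagger=\mathrm{diag}(1,\gamma^\dagger,\gamma^\dagger,\gamma^\dagger,\gamma^\dagger):X_2\to H_2$. Let $\Pi^{\le N}$ (resp. $\Pi^{>N}$) keep the coefficients of index $n\le N$ (resp. $n>N$) and annihilate the others, componentwise on $\ell^2_e$; on $X_2$ let $\bar\Pi^{\le N}=\mathrm{diag}(1,\Pi^{\le N},\Pi^{\le N})$ and $\bar\Pi^{>N}=\mathrm{diag}(0,\Pi^{>N},\Pi^{>N})$. **Data.** Let $N_0,N\in\mathbb N_0$ and $\bar{\mathbf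 x}=(\bar\nu,\bar{\mathbf u},\bar{\mathbf w})\in H_1$ with $\bar{\mathbf u}=\gamma^\dagger(\bar{\mathbf U})$ and $\bar{\mathbf w}=\gamma^\dagger(\bar{\mathbf W})$ componentwise, where $\bar{\mathbf U}=\Pi^{\le N_0}\bar{\mathbf U}$ and $\bar{\mathbf W}=\Pi^{\le N_0}\bar{\mathbf W}$. Let $B^N:X_2\to X_2$ be bounded and linear with $B^N=\bar\Pi^{\le N}B^N\bar\Pi^{\le N}$. Put $B=\bar\Pi^{>N}+B^N$, with blocks $B_{ij}$ ($1\le i,j\le5$) for the components $(\nu,u_1,u_2,w_1,w_2)$, and $$\mathbb B=\mathrm{diag}(0,\mathbb 1_{\mathbb R\setminus\Omega_0},\mathbb 1_{\mathbb R\setminus\Omega_0},\mathbb 1_{\mathbb R\setminus\Omega_0},\mathbb 1_{\mathbb R\setminus\Omega_0})+\bar\gamma^\dagger B\bar\gamma,\qquad \mathbb A=\mathrm{diag}(1,\mathbb l_{\bar\nu},\mathbb l_{\bar\nu})^{-1}\,\mathbb B:H_2\to H_1 .$$ **Constants.** For a function $M$ from $\mathbb R$ to the real $2\times2$ matrices let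 $\|M\|_{\mathcal M_1}=\sup_\xi\sup_{|x|_2=1}|M(\xi)x|_2$ and $\|M\|_{\mathcal M_2}=\max_{i}(\|M_{i1}\|_{L^2}^2+\|M_{i2}\|_{L^2}^2)^{1/2}$; let $\kappa=\|\mathscr l^{-1}\|_{\mathcal M_1}\|\mathscr l^{-1}\|_{\mathcal M_2}$ and $$\varphi(x_1,x_2,x_3,x_4)=\min\Big\{\max\{x_1,x_4\}+\max\{x_2,x_3\},\ \sqrt{x_1^2+x_2^2+x_3^2+x_4^2}\Big\}.$$ Let $q_1=2\bar u_2+2\nu_4\mathbb 1_{\Omega_0}$, $q_2=2\bar u_1+\nu_5\mathbb 1_{\Omega_0}$, $q_3=2\bar w_2$, $q_4=2\bar w_1$, let $Q_i=\gamma(q_i)$, and let $\mathbb Q_i:V\mapsto Q_i*V$ on $\ell^2(\mathbb N_0)$; below, products $Q_iQ_j$ are convolutions $Q_i*Q_j$. Let $B^N_{1\to5,24}:X_2\to X_2$ be $B^N$ with its columns $1,3,5$ replaced by zero. Let $M_1:\ell^2_e\to X_2$ and $M_2:\ell^2_e\to\ell^2_e$ be $$M_1=\begin{bmatrix}B_{12}-B_{13}&B_{14}-B_{15}\\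 \vdots&\vdots\\ B_{52}-B_{53}&B_{54}-B_{55}\end{bmatrix},\qquad M_2=\begin{bmatrix}\mathbb Q_1^2+\mathbb Q_2^2&\mathbb Q_1\mathbb Q_3+\mathbb Q_2\mathbb Q_4\\ \mathbb Q_3\mathbb Q_1+\mathbb Q_4\mathbb Q_2&\mathbb Q_3^2+\mathbb Q_4^2+\mathbb Q_1^2+\mathbb Q_2^2\end{bmatrix},$$ with Hilbert space adjoints $M_1^*:X_2\to\ell^2_e$ and $M_2^*$, and let $\|M_1\|_{2,X_2}$ be the operator norm of $M_1$. Define $$\begin{aligned} \mathcal Z_{2,1}&=\max(1,\|B^N_{1\to5,24}\|_{X_2})\left\|\begin{bmatrix}-|2\pi\xi|^2&0\\0&0\end{bmatrix}\mathscr l^{-1}(\xi)\right\|_{\mathcal M_1},\qquad \mathcal Z_{2,2}(r)=\|M_1\|_{2,X_2}\,2\sqrt{10}\,\kappa\,\|\mathscr l^{-1}\|_{\mathcal M_2}\,r,\\ \mathcal Z_{2,3}&=\|\bar\Pi^{\le N}M_1M_2M_1^*\bar\Pi^{\le N}\|_{X_2},\qquad \mathcal Z_{2,4}=\sqrt{\|\bar\Pi^{\le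 N}M_1M_2\Pi^{>N}M_2^*M_1^*\bar\Pi^{\le N}\|_{X_2}},\\ \mathcal Z_{2,5}&=\varphi\big(\|Q_1^2+Q_2^2\|_1,\ \|Q_1Q_3+Q_2Q_4\|_1,\ \|Q_3Q_1+Q_4Q_2\|_1,\ \|Q_3^2+Q_4^2+Q_1^2+Q_2^2\|_1\big),\\ \mathcal Z_2(r)&=(1+\sqrt3)\,\mathcal Z_{2,1}+\mathcal Z_{2,2}(r)+5\kappa\sqrt{\varphi(\mathcal Z_{2,3},\mathcal Z_{2,4},\mathcal Z_{2,4},\mathcal Z_{2,5})}. \end{aligned}$$ **Lemma.** The maps $\mathbb f(\nu,\cdot):\mathcal H_e\to L^2_e$ ($\nu\in\mathbb R$) and $\mathbb F:H_1\to H_2$ are Fréchet differentiable, and for every $r\ge0$ and every $\mathbf h\in H_1$ with $\|\mathbf h\|_{H_1}\le r$, $$\big\|\mathbb A\big(D\mathbb F(\bar{\mathbf x}+\mathbf h)-D\mathbb F(\bar{\mathbf x})\big)\big\|_{H_1}\le\mathcal Z_2(r)\,r .$$ -/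

import Mathlib

open MeasureTheory FourierTransform
open scoped ENNReal

noncomputable section

namespace SaddleNode

/-! ### Even real functions in `L²(ℝ)` -/

/-- The scalar space `L²(ℝ)` of real-valued functions. -/
abbrev L2 : Type := Lp ℝ 2 (volume : Measure ℝ)

/-- Its closed subspace of even functions. -/
def L2e : Submodule ℝ L2 where
  carrier := {u | ∀ᵐ x : ℝ, u (-x) = u x}
  zero_mem' := by
    have h := Lp.coeFn_zero ℝ 2 (volume : Measure ℝ)
    have h' := (Measure.measurePreserving_neg (volume : Measure ℝ)).quasiMeasurePreserving.ae h
    filter_upwards [h, h'] with x h1 h2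
    rw [h1, h2]; rfl
  add_mem' := by
    intro u v hu hv
    have h := Lp.coeFn_add u v
    have h' := (Measure.measurePreserving_neg (volume : Measure ℝ)).quasiMeasurePreserving.ae h
    change ∀ᵐ x : ℝ, (u + v : L2) (-x) = (u + v : L2) x
    filter_upwards [h, h', hu, hv] with x h1 h2 h3 h4
    rw [h1, h2, Pi.add_apply, Pi.add_apply, h3, h4]
  smul_mem' := by
    intro c u hu
    have h := Lp.coeFn_smul c u
    have h' := (Measure.measurePreserving_neg (volume : Measure ℝ)).quasiMeasurePreserving.ae h
    change ∀ᵐ x : ℝ, (c • u : L2) (-x) = (c • u : L2) x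
    filter_upwards [h, h', hu] with x h1 h2 h3
    rw [h1, h2, Pi.smul_apply, Pi.smul_apply, h3]

theorem mem_L2e {u : L2} : u ∈ L2e ↔ ∀ᵐ x : ℝ, u (-x) = u x := Iff.rfl

theorem L2e_even (u : L2e) : ∀ᵐ x : ℝ, (u : L2) (-x) = (u : L2) x := u.2

theorem isClosed_L2e : IsClosed (L2e : Set L2) := by
  have h : (L2e : Set L2) = {u : L2 | Lp.compMeasurePreservingₗᵢ ℝ (Neg.neg : ℝ → ℝ)
      (Measure.measurePreserving_neg volume) u = u} := by
    ext u
    have h := Lp.coeFn_compMeasurePreserving u (Measure.measurePreserving_neg (volume : Measure ℝ))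
    constructor
    · intro hu
      apply Lp.ext
      filter_upwards [h, mem_L2e.1 hu] with x h1 h2
      exact h1.trans h2
    · intro hu
      rw [SetLike.mem_coe, mem_L2e]
      have hu' : Lp.compMeasurePreserving (Neg.neg : ℝ → ℝ)
        (Measure.measurePreserving_neg volume) u = u := hu
      rw [hu'] at h
      filter_upwards [h] with x h1
      exact h1.symm
  rw [h]
  exact isClosed_eq (LinearIsometry.continuous _) continuous_id

instance : CompleteSpace L2e := isClosed_L2e.completeSpace_coe

/-- The even element of `L²` given by a function. -/
def mkL2e (f : ℝ → ℝ) (hf : MemLp f 2 volume) (he : ∀ᵐ x, f (-x) = f x) : L2e :=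
  ⟨hf.toLp f, by
    have h := hf.coeFn_toLp
    have h' := (Measure.measurePreserving_neg (volume : Measure ℝ)).quasiMeasurePreserving.ae h
    rw [mem_L2e]
    filter_upwards [h, h', he] with x h1 h2 h3
    rw [h1, h2, h3]⟩

theorem mkL2e_ae (f : ℝ → ℝ) (hf : MemLp f 2 volume) (he : ∀ᵐ x, f (-x) = f x) :
    (mkL2e f hf he : L2) =ᵐ[volume] f := hf.coeFn_toLp

/-- The product `q v` of an essentially bounded even function and an element of `L²`. -/
def mulFun (q : ℝ → ℝ) (hq : MemLp q ∞ volume) (he : ∀ᵐ x, q (-x) = q x) (v : L2e) : L2e :=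
  mkL2e (fun x => q x * (v : L2) x) ((Lp.memLp (v : L2)).mul (p := ∞) (r := 2) hq)
    (by filter_upwards [he, L2e_even v] with x h1 h2; rw [h1, h2])

theorem mulFun_ae (q : ℝ → ℝ) (hq : MemLp q ∞ volume) (he : ∀ᵐ x, q (-x) = q x) (v : L2e) :
    (mulFun q hq he v : L2) =ᵐ[volume] fun x => q x * (v : L2) x :=
  mkL2e_ae _ _ _

/-- Multiplication by an essentially bounded even function, as a bounded operator. -/
def mulBdd (q : ℝ → ℝ) (hq : MemLp q ∞ volume) (he : ∀ᵐ x, q (-x) = q x) : L2e →L[ℝ] L2e :=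
  LinearMap.mkContinuous
    { toFun := mulFun q hq he
      map_add' := by
        intro u v
        apply Subtype.ext
        apply Lp.ext
        refine (mulFun_ae q hq he _).trans ?_
        refine Filter.EventuallyEq.trans ?_ (Lp.coeFn_add _ _).symm
        filter_upwards [Lp.coeFn_add (u : L2) (v : L2), mulFun_ae q hq he u,
          mulFun_ae q hq he v] with x h1 h2 h3
        rw [Submodule.coe_add, h1, Pi.add_apply, Pi.add_apply, h2, h3, mul_add]
      map_smul' := by
        intro c u
        apply Subtype.ext
        apply Lp.ext
        refine (mulFun_ae q hq he _).trans ?_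
        refine Filter.EventuallyEq.trans ?_ (Lp.coeFn_smul _ _).symm
        filter_upwards [Lp.coeFn_smul c (u : L2), mulFun_ae q hq he u] with x h1 h2
        rw [Submodule.coe_smul, h1, Pi.smul_apply, Pi.smul_apply, RingHom.id_apply, h2]
        simp only [smul_eq_mul]; ring }
    (eLpNorm q ∞ volume).toReal (by
      intro v
      have hb : ∀ᵐ x : ℝ, ‖q x‖ ≤ (eLpNorm q ∞ volume).toReal := by
        have := ae_le_eLpNormEssSup (f := q) (μ := (volume : Measure ℝ))
        filter_upwards [this] with x hx
        have h2 : ‖q x‖ₑ ≤ eLpNorm q ∞ volume := by rwa [eLpNorm_exponent_top]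
        have := ENNReal.toReal_mono hq.eLpNorm_ne_top h2
        simpa using this
      apply Lp.norm_le_mul_norm_of_ae_le_mul
      filter_upwards [hb, mulFun_ae q hq he v] with x h1 h2
      change ‖(mulFun q hq he v : L2) x‖ ≤ _ * ‖(v : L2) x‖
      rw [h2, norm_mul]
      gcongr)

theorem mulBdd_ae (q : ℝ → ℝ) (hq : MemLp q ∞ volume) (he : ∀ᵐ x, q (-x) = q x) (v : L2e) :
    (mulBdd q hq he v : L2) =ᵐ[volume] fun x => q x * (v : L2) x :=
  mulFun_ae q hq he v

open Classical in
/-- The multiplication operator `v ↦ q v` attached to a bounded `q`. It is only used for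
essentially bounded `q`; it is set to `0` otherwise. -/
def mulOp (q : L2e) : L2e →L[ℝ] L2e :=
  if h : MemLp (q : L2) ∞ volume then mulBdd (q : L2) h (L2e_even q) else 0

theorem mulOp_ae (q v : L2e) (h : MemLp (q : L2) ∞ volume) :
    (mulOp q v : L2) =ᵐ[volume] fun x => (q : L2) x * (v : L2) x := by
  rw [mulOp, dif_pos h]
  exact mulBdd_ae _ _ _ _

/-! ### The Fourier transform -/

/-- A real `L²` function seen as a complex one. -/
def toC : L2 →L[ℝ] Lp ℂ 2 (volume : Measure ℝ) := Complex.ofRealCLM.compLpL 2 volume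

theorem toC_ae (u : L2) : toC u =ᵐ[volume] fun x => ((u x : ℝ) : ℂ) :=
  Complex.ofRealCLM.coeFn_compLp u

/-- The Fourier transform `û(ξ) = ∫ u(x) exp(-2πi x ξ) dx` of an `L²` function. -/
def fhat (u : L2e) : Lp ℂ 2 (volume : Measure ℝ) := 𝓕 (toC (u : L2))

theorem toC_injective : Function.Injective toC := by
  intro u v h
  apply Lp.ext
  filter_upwards [toC_ae u, toC_ae v] with x h1 h2
  rw [h, h2] at h1
  exact_mod_cast h1.symm

theorem fhat_injective : Function.Injective fhat := by
  intro u v h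
  apply Subtype.ext
  apply toC_injective
  exact (Lp.fourierTransformₗᵢ ℝ ℂ).injective h

theorem fhat_add (u v : L2e) : fhat (u + v) = fhat u + fhat v := by
  simp only [fhat, Submodule.coe_add, map_add, FourierTransform.fourier_add]

theorem fhat_smul (c : ℝ) (u : L2e) : fhat (c • u) = (c : ℂ) • fhat u := by
  simp only [fhat, Submodule.coe_smul, map_smul]
  rw [← FourierTransform.fourier_smul]
  congr 1

theorem norm_fhat (u : L2e) : ‖fhat u‖ = ‖u‖ := by
  rw [fhat, Lp.norm_fourier_eq]
  apply le_antisymm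
  · have : ‖toC (u : L2)‖ ≤ 1 * ‖(u : L2)‖ := by
      apply Lp.norm_le_mul_norm_of_ae_le_mul
      filter_upwards [toC_ae (u : L2)] with x h
      rw [h]; simp
    simpa using this
  · have : ‖(u : L2)‖ ≤ 1 * ‖toC (u : L2)‖ := by
      apply Lp.norm_le_mul_norm_of_ae_le_mul
      filter_upwards [toC_ae (u : L2)] with x h
      rw [h]; simp
    simpa using this

/-- Reflection `x ↦ -x` on complex `L²`. -/
def reflC : Lp ℂ 2 (volume : Measure ℝ) →ₗᵢ[ℂ] Lp ℂ 2 (volume : Measure ℝ) :=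
  Lp.compMeasurePreservingₗᵢ ℂ (Neg.neg : ℝ → ℝ) (Measure.measurePreserving_neg volume)

theorem reflC_ae (f : Lp ℂ 2 (volume : Measure ℝ)) :
    reflC f =ᵐ[volume] fun x => f (-x) :=
  Lp.coeFn_compMeasurePreserving f (Measure.measurePreserving_neg (volume : Measure ℝ))

/-- Complex conjugation on complex `L²`. -/
def conjC : Lp ℂ 2 (volume : Measure ℝ) →L[ℝ] Lp ℂ 2 (volume : Measure ℝ) :=
  (Complex.conjCLE : ℂ →L[ℝ] ℂ).compLpL 2 volume

theorem conjC_ae (f : Lp ℂ 2 (volume : Measure ℝ)) :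
    conjC f =ᵐ[volume] fun x => (starRingEnd ℂ) (f x) :=
  (Complex.conjCLE : ℂ →L[ℝ] ℂ).coeFn_compLp f

theorem fourier_fourier (f : Lp ℂ 2 (volume : Measure ℝ)) : 𝓕 (𝓕 f) = reflC f := by
  refine DenseRange.induction_on (SchwartzMap.denseRange_toLpCLM (E := ℝ) (F := ℂ) (p := 2)
    (μ := volume) ENNReal.ofNat_ne_top) f ?_ ?_
  · exact isClosed_eq ((Lp.fourierTransformₗᵢ ℝ ℂ).continuous.comp
      (Lp.fourierTransformₗᵢ ℝ ℂ).continuous) reflC.continuous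
  · intro g
    rw [SchwartzMap.toLpCLM_apply, SchwartzMap.toLp_fourier_eq, SchwartzMap.toLp_fourier_eq]
    apply Lp.ext
    have h := SchwartzMap.coeFn_toLp g 2 (volume : Measure ℝ)
    have h' := (Measure.measurePreserving_neg (volume : Measure ℝ)).quasiMeasurePreserving.ae h
    filter_upwards [h', SchwartzMap.coeFn_toLp (𝓕 (𝓕 g)) 2 (volume : Measure ℝ),
      reflC_ae (g.toLp 2 volume)] with x h1 h2 h3
    have h4 : (𝓕⁻ (𝓕 g) : SchwartzMap ℝ ℂ) (-x) = g (-x) := by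
      rw [FourierTransform.fourierInv_fourier_eq]
    rw [SchwartzMap.fourierInv_coe, Real.fourierInv_eq_fourier_neg, neg_neg,
      ← SchwartzMap.fourier_coe] at h4
    rw [h2, h3, h1, h4]

theorem fourier_refl (f : Lp ℂ 2 (volume : Measure ℝ)) : 𝓕 (reflC f) = reflC (𝓕 f) := by
  rw [← fourier_fourier, ← fourier_fourier]

theorem fourier_conj (f : Lp ℂ 2 (volume : Measure ℝ)) : 𝓕 (conjC f) = conjC (reflC (𝓕 f)) := by
  refine DenseRange.induction_on (SchwartzMap.denseRange_toLpCLM (E := ℝ) (F := ℂ) (p := 2)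
    (μ := volume) ENNReal.ofNat_ne_top) f ?_ ?_
  · exact isClosed_eq ((Lp.fourierTransformₗᵢ ℝ ℂ).continuous.comp conjC.continuous)
      (conjC.continuous.comp (reflC.continuous.comp (Lp.fourierTransformₗᵢ ℝ ℂ).continuous))
  · intro g
    have hg : conjC (g.toLp 2 volume) =
        (g.postcompCLM (Complex.conjCLE : ℂ →L[ℝ] ℂ)).toLp 2 volume := by
      apply Lp.ext
      filter_upwards [conjC_ae (g.toLp 2 volume), SchwartzMap.coeFn_toLp g 2 (volume : Measure ℝ),
        SchwartzMap.coeFn_toLp (g.postcompCLM (Complex.conjCLE : ℂ →L[ℝ] ℂ)) 2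
          (volume : Measure ℝ)] with x h1 h2 h3
      rw [h1, h2, h3]; rfl
    rw [SchwartzMap.toLpCLM_apply, hg, SchwartzMap.toLp_fourier_eq, SchwartzMap.toLp_fourier_eq]
    apply Lp.ext
    have h := SchwartzMap.coeFn_toLp (𝓕 g) 2 (volume : Measure ℝ)
    have h' := (Measure.measurePreserving_neg (volume : Measure ℝ)).quasiMeasurePreserving.ae h
    filter_upwards [h', SchwartzMap.coeFn_toLp
      (𝓕 (g.postcompCLM (Complex.conjCLE : ℂ →L[ℝ] ℂ))) 2 (volume : Measure ℝ),
      reflC_ae ((𝓕 g).toLp 2 volume), conjC_ae (reflC ((𝓕 g).toLp 2 volume))] with x h1 h2 h3 h4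
    rw [h2, h4, h3, h1, SchwartzMap.fourier_coe, SchwartzMap.fourier_coe, Real.fourier_eq,
      Real.fourier_eq, ← integral_conj]
    congr 1
    ext v
    simp [Circle.smul_def, ← Circle.coe_inv_eq_conj, ← AddChar.map_neg_eq_inv]

theorem fhat_even (u : L2e) : reflC (fhat u) = fhat u := by
  rw [fhat, ← fourier_refl]
  congr 1
  apply Lp.ext
  have h' := (Measure.measurePreserving_neg (volume : Measure ℝ)).quasiMeasurePreserving.ae
    (toC_ae (u : L2))
  filter_upwards [reflC_ae (toC (u : L2)), toC_ae (u : L2), h', L2e_even u] with x h1 h2 h3 h4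
  rw [h1, h2, h3, h4]

theorem fhat_real (u : L2e) : conjC (fhat u) = fhat u := by
  have h : conjC (toC (u : L2)) = toC (u : L2) := by
    apply Lp.ext
    filter_upwards [conjC_ae (toC (u : L2)), toC_ae (u : L2)] with x h1 h2
    rw [h1, h2, Complex.conj_ofReal]
  conv_rhs => rw [fhat, ← h, fourier_conj]
  change _ = conjC (reflC (fhat u))
  rw [fhat_even]

/-- A real even complex-valued `L²` function is the Fourier transform of one of the same kind. -/
theorem exists_fhat_eq (f : Lp ℂ 2 (volume : Measure ℝ)) (h1 : reflC f = f) (h2 : conjC f = f) :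
    ∃ u : L2e, fhat u = f := by
  set g := 𝓕 f with hg
  have hg1 : reflC g = g := by rw [hg, ← fourier_refl, h1]
  have hg2 : conjC g = g := by
    conv_rhs => rw [hg, ← h2, fourier_conj, ← hg, hg1]
  have hgm : MemLp (fun x => (g x).re) 2 volume := (Lp.memLp g).re
  have he : ∀ᵐ x, (g (-x)).re = (g x).re := by
    have := reflC_ae g
    rw [hg1] at this
    filter_upwards [this] with x hx
    rw [hx]
  refine ⟨mkL2e _ hgm he, ?_⟩
  have : toC (mkL2e _ hgm he : L2) = g := by
    apply Lp.ext
    have h3 := conjC_ae g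
    rw [hg2] at h3
    filter_upwards [toC_ae (mkL2e _ hgm he : L2), mkL2e_ae _ hgm he, h3] with x h4 h5 h6
    rw [h4, h5]
    exact Complex.conj_eq_iff_re.1 h6.symm
  rw [fhat, this, hg, fourier_fourier, h1]

/-- Bounded real even Fourier multipliers act on even `L²` functions. -/
theorem exists_multiplier (m : ℝ → ℝ) (hm : Measurable m) (C : ℝ) (hC : ∀ x, |m x| ≤ C)
    (he : ∀ x, m (-x) = m x) (f : L2e) :
    ∃ u : L2e, fhat u =ᵐ[volume] fun x => (m x : ℂ) * fhat f x := by
  have hmem : MemLp (fun x => (m x : ℂ) * fhat f x) 2 volume := by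
    refine MemLp.mul (p := ∞) (q := 2) (r := 2) (Lp.memLp (fhat f)) ?_
    refine memLp_top_of_bound (Complex.measurable_ofReal.comp hm).aestronglyMeasurable C ?_
    filter_upwards with x
    simpa using hC x
  have h0 := hmem.coeFn_toLp
  have h0' := (Measure.measurePreserving_neg (volume : Measure ℝ)).quasiMeasurePreserving.ae h0
  have hev := reflC_ae (fhat f)
  rw [fhat_even] at hev
  have hre := conjC_ae (fhat f)
  rw [fhat_real] at hre
  obtain ⟨u, hu⟩ := exists_fhat_eq hmem.toLp (by
      apply Lp.ext
      filter_upwards [h0, h0', hev, reflC_ae hmem.toLp] with x h1 h2 h3 h4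
      rw [h4, h2, h1, he, h3]) (by
      apply Lp.ext
      filter_upwards [h0, hre, conjC_ae hmem.toLp] with x h1 h2 h3
      rw [h3, h1, map_mul, Complex.conj_ofReal, ← h2])
  exact ⟨u, by rw [hu]; exact h0⟩

/-! ### The even Sobolev space `H²` and the second derivative -/

/-- The even functions of the Sobolev space `H²(ℝ)`: those `u` whose second derivative (the
function with Fourier transform `-(2πξ)² û(ξ)`) is in `L²`. -/
def H2e : Submodule ℝ L2e where
  carrier := {u | ∃ v : L2e, fhat v =ᵐ[volume] fun ξ => ((-(2 * Real.pi * ξ) ^ 2 : ℝ) : ℂ) * fhat u ξ}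
  zero_mem' := by
    refine ⟨0, ?_⟩
    have h : fhat 0 = 0 := by simpa using fhat_smul 0 0
    rw [h]
    filter_upwards [Lp.coeFn_zero ℂ 2 (volume : Measure ℝ)] with x hx
    rw [hx]; simp
  add_mem' := by
    rintro u v ⟨u', hu⟩ ⟨v', hv⟩
    refine ⟨u' + v', ?_⟩
    rw [fhat_add, fhat_add]
    filter_upwards [hu, hv, Lp.coeFn_add (fhat u') (fhat v'), Lp.coeFn_add (fhat u) (fhat v)]
      with x h1 h2 h3 h4
    rw [h3, h4, Pi.add_apply, Pi.add_apply, h1, h2]; ring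
  smul_mem' := by
    rintro c u ⟨u', hu⟩
    refine ⟨c • u', ?_⟩
    rw [fhat_smul, fhat_smul]
    filter_upwards [hu, Lp.coeFn_smul (c : ℂ) (fhat u'), Lp.coeFn_smul (c : ℂ) (fhat u)]
      with x h1 h2 h3
    rw [h2, h3, Pi.smul_apply, Pi.smul_apply, h1]
    simp only [smul_eq_mul]; ring

theorem eq_of_fhat_ae {u v : L2e} (h : fhat u =ᵐ[volume] fhat v) : u = v :=
  fhat_injective (Lp.ext h)

/-- The second derivative of an element of `H²`, as a function. -/
def lapFun (u : H2e) : L2e := u.2.choose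

theorem fhat_lapFun (u : H2e) :
    fhat (lapFun u) =ᵐ[volume] fun ξ => ((-(2 * Real.pi * ξ) ^ 2 : ℝ) : ℂ) * fhat (u : L2e) ξ :=
  u.2.choose_spec

/-- The second derivative `Δ : H² → L²`. -/
def lap : H2e →ₗ[ℝ] L2e where
  toFun := lapFun
  map_add' := by
    intro u v
    apply eq_of_fhat_ae
    rw [fhat_add]
    have hw := fhat_lapFun (u + v)
    rw [Submodule.coe_add, fhat_add] at hw
    filter_upwards [fhat_lapFun u, fhat_lapFun v, hw,
      Lp.coeFn_add (fhat (lapFun u)) (fhat (lapFun v)),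
      Lp.coeFn_add (fhat (u : L2e)) (fhat (v : L2e))] with x h1 h2 h3 h4 h5
    rw [h4, Pi.add_apply, h1, h2, h3, h5, Pi.add_apply]; ring
  map_smul' := by
    intro c u
    apply eq_of_fhat_ae
    rw [fhat_smul]
    have hw := fhat_lapFun (c • u)
    rw [Submodule.coe_smul, fhat_smul] at hw
    filter_upwards [fhat_lapFun u, hw, Lp.coeFn_smul (c : ℂ) (fhat (lapFun u)),
      Lp.coeFn_smul (c : ℂ) (fhat (u : L2e))] with x h1 h2 h3 h4
    rw [h2, h4, Pi.smul_apply]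
    refine Eq.trans ?_ h3.symm
    rw [Pi.smul_apply, h1]; simp only [smul_eq_mul]; ring

theorem fhat_lap (u : H2e) :
    fhat (lap u) =ᵐ[volume] fun ξ => ((-(2 * Real.pi * ξ) ^ 2 : ℝ) : ℂ) * fhat (u : L2e) ξ :=
  fhat_lapFun u

/-- Functions in `H²` have integrable Fourier transform. -/
theorem integrable_fhat (u : H2e) : Integrable (fhat (u : L2e)) volume := by
  have hm : MemLp (fun ξ : ℝ => (((1 + ξ ^ 2)⁻¹ : ℝ) : ℂ)) 2 volume := by
    have h1 : MemLp (fun ξ : ℝ => (1 + ξ ^ 2)⁻¹) 2 volume := by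
      rw [memLp_two_iff_integrable_sq (by fun_prop)]
      refine Integrable.mono' integrable_inv_one_add_sq (by fun_prop) ?_
      filter_upwards with x
      have h2 : (1 + x ^ 2)⁻¹ ≤ 1 := inv_le_one_of_one_le₀ (by nlinarith [sq_nonneg x])
      have h3 : 0 ≤ (1 + x ^ 2)⁻¹ := by positivity
      rw [Real.norm_of_nonneg (by positivity)]
      nlinarith
    exact h1.ofReal
  have hf : MemLp (fhat (u : L2e) - (((2 * Real.pi) ^ 2 : ℝ)⁻¹ : ℂ) • fhat (lap u)
      : Lp ℂ 2 (volume : Measure ℝ)) 2 volume := Lp.memLp _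
  have := MemLp.integrable_mul hm hf
  refine this.congr ?_
  filter_upwards [fhat_lap u, Lp.coeFn_sub (fhat (u : L2e))
    ((((2 * Real.pi) ^ 2 : ℝ)⁻¹ : ℂ) • fhat (lap u)),
    Lp.coeFn_smul (((2 * Real.pi) ^ 2 : ℝ)⁻¹ : ℂ) (fhat (lap u))] with x h1 h2 h3
  rw [Pi.mul_apply, h2, Pi.sub_apply, h3, Pi.smul_apply, h1]
  have h4 : (1 + (x : ℂ) ^ 2) ≠ 0 := by
    have : (1 + x ^ 2 : ℝ) ≠ 0 := by positivity
    exact_mod_cast this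
  have h5 : (Real.pi : ℂ) ≠ 0 := by exact_mod_cast Real.pi_ne_zero
  push_cast
  simp only [smul_eq_mul]
  field_simp
  ring

/-- Functions in `H²(ℝ)` are essentially bounded. -/
theorem memLp_top_of_H2e (u : H2e) : MemLp ((u : L2e) : L2) ∞ volume := by
  set f := fhat (u : L2e) with hf
  have hi : Integrable f volume := integrable_fhat u
  have hinv : toC ((u : L2e) : L2) = 𝓕⁻ f := by
    rw [hf, fhat, FourierTransform.fourierInv_fourier_eq]
  have hcont : Continuous (𝓕⁻ (f : ℝ → ℂ)) := by
    have h := VectorFourier.fourierIntegral_continuous (e := Real.fourierChar) (μ := volume)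
      (L := innerₗ ℝ) Real.continuous_fourierChar (by fun_prop) hi
    have h2 : 𝓕⁻ (f : ℝ → ℂ) = fun x => 𝓕 (f : ℝ → ℂ) (-x) := by
      ext x; rw [Real.fourierInv_eq_fourier_neg]
    rw [h2]
    exact h.comp continuous_neg
  have key : ∀ᵐ x, (toC ((u : L2e) : L2)) x = 𝓕⁻ (f : ℝ → ℂ) x := by
    apply ae_eq_of_integral_contDiff_smul_eq
    · exact (Lp.memLp (toC ((u : L2e) : L2))).locallyIntegrable (by norm_num)
    · exact hcont.locallyIntegrable
    · intro g hg hgc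
      set G : SchwartzMap ℝ ℂ := (hgc.comp_left (g := ((↑) : ℝ → ℂ)) Complex.ofReal_zero).toSchwartzMap
        (Complex.ofRealCLM.contDiff.comp hg) with hG
      have hGx : ∀ x, G x = (g x : ℂ) := fun x => rfl
      have h1 := DFunLike.congr_fun (Lp.fourierInv_toTemperedDistribution_eq f) G
      rw [TemperedDistribution.fourierInv_apply, Lp.toTemperedDistribution_apply,
        Lp.toTemperedDistribution_apply, ← hinv] at h1
      have h2 : ∫ x, g x • (toC ((u : L2e) : L2)) x = ∫ x, G x • (toC ((u : L2e) : L2)) x := by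
        simp [hGx]
      rw [h2, ← h1]
      have h3 : ∫ ξ, 𝓕⁻ (G : ℝ → ℂ) ξ • f ξ = ∫ x, G x • 𝓕⁻ (f : ℝ → ℂ) x := by
        have hL : (-innerₗ ℝ : ℝ →ₗ[ℝ] ℝ →ₗ[ℝ] ℝ).flip = -innerₗ ℝ := by
          ext; simp
        have := VectorFourier.integral_fourierIntegral_smul_eq_flip (L := (-innerₗ ℝ))
          (μ := volume) (ν := volume) (f := (G : ℝ → ℂ)) (g := (f : ℝ → ℂ))
          Real.continuous_fourierChar (by simp only [LinearMap.neg_apply]; fun_prop) G.integrable hi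
        rw [hL] at this
        exact this
      rw [SchwartzMap.fourierInv_coe, h3]
      simp [hGx]
  have hb : ∀ x, ‖𝓕⁻ (f : ℝ → ℂ) x‖ ≤ ∫ x, ‖f x‖ := by
    intro x
    rw [Real.fourierInv_eq_fourier_neg]
    exact VectorFourier.norm_fourierIntegral_le_integral_norm _ _ _ _ _
  refine memLp_top_of_bound (Lp.memLp _).1 (∫ x, ‖f x‖) ?_
  filter_upwards [key, toC_ae ((u : L2e) : L2)] with x h1 h2
  have := hb x
  rw [← h1, h2] at this
  simpa using this

/-! ### Parameters, the operator `𝕝_ν` and the space `𝓗_e` -/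

/-- The symbol `𝓁_ν(ξ)` of the linear part. -/
def symbolMat (ν ν₁ ν₂ ν₃ ξ : ℝ) : Matrix (Fin 2) (Fin 2) ℝ :=
  !![-ν * (2 * Real.pi * ξ) ^ 2 + ν₁, ν₂;
     ν₃, -(2 * Real.pi * ξ) ^ 2 - ν₂]

/-- The parameters of the model: the half-width `d` of the domain `Ω₀ = (-d, d)`, the reference
value `ν̄ > 0` of the bifurcation parameter and the fixed coefficients `ν₁, …, ν₅`, such that the
symbol of the linear part at `ν̄` has a determinant bounded away from zero. -/
structure Params where
  d : ℝ
  nubar : ℝ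
  nu1 : ℝ
  nu2 : ℝ
  nu3 : ℝ
  nu4 : ℝ
  nu5 : ℝ
  one_le_d : 1 ≤ d
  nubar_pos : 0 < nubar
  det_bdd : ∃ σ₀ > 0, ∀ ξ : ℝ, σ₀ ≤ |(symbolMat nubar nu1 nu2 nu3 ξ).det|

/-- Pairs with the Hilbert norm `(‖a‖² + ‖b‖²)^{1/2}`. -/
abbrev Pair (E : Type*) : Type _ := WithLp 2 (E × E)

/-- The pair `(a, b)`. -/
abbrev pair {E : Type*} (a b : E) : Pair E := WithLp.toLp 2 (a, b)

variable (P : Params)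

/-- The symbol `𝓁 = 𝓁_ν̄`. -/
def symb (ξ : ℝ) : Matrix (Fin 2) (Fin 2) ℝ := symbolMat P.nubar P.nu1 P.nu2 P.nu3 ξ

/-- The underlying space of `𝓗_e`: pairs of even `H²` functions. As `det 𝓁` is bounded away from
zero and `ν̄ > 0`, these are the even `u ∈ L² × L²` for which `𝓁 û` is square integrable (see
`mem_He_iff`). The norm is `‖u‖ = ‖𝕝_ν̄ u‖₂`. -/
def He (_P : Params) : Type := H2e × H2e

instance : AddCommGroup (He P) := inferInstanceAs (AddCommGroup (H2e × H2e))
instance : Module ℝ (He P) := inferInstanceAs (Module ℝ (H2e × H2e))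

/-- First component of an element of `𝓗_e`. -/
def He.c1 : He P →ₗ[ℝ] H2e := LinearMap.fst ℝ H2e H2e
/-- Second component of an element of `𝓗_e`. -/
def He.c2 : He P →ₗ[ℝ] H2e := LinearMap.snd ℝ H2e H2e

variable {P} in
@[ext] theorem He.ext {u v : He P} (h1 : He.c1 P u = He.c1 P v) (h2 : He.c2 P u = He.c2 P v) :
    u = v := Prod.ext h1 h2

/-- The inclusion `𝓗_e → L²_e` (components). -/
def He.fun1 (u : He P) : L2e := (He.c1 P u : L2e)
/-- The inclusion `𝓗_e → L²_e` (components). -/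
def He.fun2 (u : He P) : L2e := (He.c2 P u : L2e)

/-- The operator `𝕝_ν = [[ν Δ + ν₁, ν₂], [ν₃, Δ - ν₂]]`. -/
def opl (ν : ℝ) : He P →ₗ[ℝ] Pair L2e where
  toFun u := pair
    (ν • lap (He.c1 P u) + P.nu1 • (He.c1 P u : L2e) + P.nu2 • (He.c2 P u : L2e))
    (P.nu3 • (He.c1 P u : L2e) + lap (He.c2 P u) - P.nu2 • (He.c2 P u : L2e))
  map_add' u v := by
    simp only [map_add, Submodule.coe_add, smul_add, ← WithLp.toLp_add, Prod.mk_add_mk]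
    rw [WithLp.toLp.injEq, Prod.mk.injEq]
    constructor <;> abel
  map_smul' c u := by
    simp only [map_smul, Submodule.coe_smul, RingHom.id_apply, ← WithLp.toLp_smul, Prod.smul_mk,
      smul_add, smul_sub, smul_comm c]

theorem det_symbolMat (ν ν₁ ν₂ ν₃ ξ : ℝ) : (symbolMat ν ν₁ ν₂ ν₃ ξ).det =
    (-ν * (2 * Real.pi * ξ) ^ 2 + ν₁) * (-(2 * Real.pi * ξ) ^ 2 - ν₂) - ν₂ * ν₃ := by
  simp [symbolMat, Matrix.det_fin_two]

theorem det_symb_ne (ξ : ℝ) : (symb P ξ).det ≠ 0 := by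
  obtain ⟨σ, hσ, h⟩ := P.det_bdd
  have := h ξ
  intro h0
  rw [symb] at h0
  rw [h0] at this
  simp at this
  linarith

/-- The determinant of the symbol grows like `(2πξ)⁴`. -/
theorem det_symb_growth : ∃ c > 0, ∀ ξ : ℝ,
    c * (1 + ((2 * Real.pi * ξ) ^ 2) ^ 2) ≤ |(symb P ξ).det| := by
  obtain ⟨σ, hσ, h⟩ := P.det_bdd
  have hν := P.nubar_pos
  set b := |P.nubar * P.nu2 - P.nu1| with hb
  set e := |P.nu2 * (P.nu1 + P.nu3)| with he
  have hb0 : 0 ≤ b := abs_nonneg _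
  have he0 : 0 ≤ e := abs_nonneg _
  set T := 1 + (2 * (b + e) + P.nubar) / P.nubar with hT
  have hT1 : 1 ≤ T := by
    rw [hT]
    have : 0 ≤ (2 * (b + e) + P.nubar) / P.nubar := by positivity
    linarith
  refine ⟨min (P.nubar / 4) (σ / (1 + T ^ 2)), by positivity, ?_⟩
  intro ξ
  have hs0 : 0 ≤ (2 * Real.pi * ξ) ^ 2 := sq_nonneg _
  have hdet : (symb P ξ).det = P.nubar * ((2 * Real.pi * ξ) ^ 2) ^ 2
      + (P.nubar * P.nu2 - P.nu1) * (2 * Real.pi * ξ) ^ 2 - P.nu2 * (P.nu1 + P.nu3) := by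
    rw [symb, det_symbolMat]; ring
  have hlow : σ ≤ |(symb P ξ).det| := h ξ
  rw [hdet] at hlow ⊢
  set s := (2 * Real.pi * ξ) ^ 2 with hs
  rcases le_total s T with hsT | hsT
  · calc min (P.nubar / 4) (σ / (1 + T ^ 2)) * (1 + s ^ 2)
        ≤ σ / (1 + T ^ 2) * (1 + T ^ 2) := by
          gcongr
          exact min_le_right _ _
      _ = σ := by field_simp
      _ ≤ _ := hlow
  · have hs1 : 1 ≤ s := hT1.trans hsT
    have h1 : (2 * (b + e) + P.nubar) / P.nubar ≤ s := by linarith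
    rw [div_le_iff₀ hν] at h1
    have hb1 : -(b * s) ≤ (P.nubar * P.nu2 - P.nu1) * s := by
      have := neg_abs_le (P.nubar * P.nu2 - P.nu1)
      nlinarith
    have he1 : P.nu2 * (P.nu1 + P.nu3) ≤ e * s := by
      have := le_abs_self (P.nu2 * (P.nu1 + P.nu3))
      nlinarith
    calc min (P.nubar / 4) (σ / (1 + T ^ 2)) * (1 + s ^ 2)
        ≤ P.nubar / 4 * (s ^ 2 + s ^ 2) := by
          gcongr
          · exact min_le_left _ _
          · nlinarith
      _ = P.nubar * s ^ 2 / 2 := by ring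
      _ ≤ P.nubar * s ^ 2 + (P.nubar * P.nu2 - P.nu1) * s - P.nu2 * (P.nu1 + P.nu3) := by
          have : 2 * (b + e) * s ≤ s * P.nubar * s := by nlinarith
          nlinarith
      _ ≤ _ := le_abs_self _

theorem exists_rat_multiplier (A B C : ℝ) (f : L2e) :
    ∃ u : L2e, fhat u =ᵐ[volume] fun ξ => (((A + B * (2 * Real.pi * ξ) ^ 2
      + C * ((2 * Real.pi * ξ) ^ 2) ^ 2) / (symb P ξ).det : ℝ) : ℂ) * fhat f ξ := by
  obtain ⟨c, hc, h⟩ := det_symb_growth P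
  refine exists_multiplier _ ?_ ((|A| + |B| + |C|) / c) ?_ ?_ f
  · simp only [symb, det_symbolMat]
    fun_prop
  · intro ξ
    have h1 := h ξ
    have hpos : 0 < |(symb P ξ).det| := abs_pos.2 (det_symb_ne P ξ)
    rw [abs_div, div_le_div_iff₀ hpos hc]
    have hs0 : 0 ≤ (2 * Real.pi * ξ) ^ 2 := sq_nonneg _
    set s := (2 * Real.pi * ξ) ^ 2
    have h2 : |A + B * s + C * s ^ 2| ≤ (|A| + |B| + |C|) * (1 + s ^ 2) := by
      calc |A + B * s + C * s ^ 2| ≤ |A| + |B * s| + |C * s ^ 2| := abs_add_three _ _ _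
        _ = |A| + |B| * s + |C| * s ^ 2 := by
            rw [abs_mul, abs_mul, abs_of_nonneg hs0, abs_of_nonneg (by positivity : 0 ≤ s ^ 2)]
        _ ≤ _ := by
            have := abs_nonneg A; have := abs_nonneg B; have := abs_nonneg C
            have h3 : s ≤ 1 + s ^ 2 := by nlinarith [sq_nonneg (s - 1)]
            nlinarith [mul_le_mul_of_nonneg_left h3 (abs_nonneg B),
              mul_nonneg (abs_nonneg A) (sq_nonneg s)]
    calc _ ≤ (|A| + |B| + |C|) * (1 + s ^ 2) * c := by gcongr
      _ = (|A| + |B| + |C|) * (c * (1 + s ^ 2)) := by ring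
      _ ≤ _ := by gcongr
  · intro ξ
    simp only [symb, det_symbolMat]
    ring_nf

theorem exists_H2e_multiplier (A B : ℝ) (f : L2e) :
    ∃ u : H2e, fhat (u : L2e) =ᵐ[volume] fun ξ => (((A + B * (2 * Real.pi * ξ) ^ 2)
      / (symb P ξ).det : ℝ) : ℂ) * fhat f ξ := by
  obtain ⟨u, hu⟩ := exists_rat_multiplier P A B 0 f
  obtain ⟨v, hv⟩ := exists_rat_multiplier P 0 (-A) (-B) f
  refine ⟨⟨u, v, ?_⟩, ?_⟩
  · filter_upwards [hu, hv] with ξ h1 h2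
    rw [h1, h2]
    push_cast
    ring
  · filter_upwards [hu] with ξ h1
    rw [h1]; simp

theorem fhat_opl (ν : ℝ) (u : He P) : ∀ᵐ ξ : ℝ,
    fhat (opl P ν u).fst ξ = ((-ν * (2 * Real.pi * ξ) ^ 2 + P.nu1 : ℝ) : ℂ) * fhat (He.fun1 P u) ξ
      + (P.nu2 : ℂ) * fhat (He.fun2 P u) ξ ∧
    fhat (opl P ν u).snd ξ = (P.nu3 : ℂ) * fhat (He.fun1 P u) ξ
      + ((-(2 * Real.pi * ξ) ^ 2 - P.nu2 : ℝ) : ℂ) * fhat (He.fun2 P u) ξ := by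
  have e1 : (opl P ν u).fst
    = ν • lap (He.c1 P u) + P.nu1 • He.fun1 P u + P.nu2 • He.fun2 P u := rfl
  have e2 : (opl P ν u).snd
    = P.nu3 • He.fun1 P u + lap (He.c2 P u) + (-P.nu2) • He.fun2 P u := by
    rw [neg_smul, ← sub_eq_add_neg]; rfl
  rw [e1, e2]
  simp only [fhat_add, fhat_smul]
  filter_upwards [fhat_lap (He.c1 P u), fhat_lap (He.c2 P u),
    Lp.coeFn_add ((ν : ℂ) • fhat (lap (He.c1 P u)) + (P.nu1 : ℂ) • fhat (He.fun1 P u))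
      ((P.nu2 : ℂ) • fhat (He.fun2 P u)),
    Lp.coeFn_add ((ν : ℂ) • fhat (lap (He.c1 P u))) ((P.nu1 : ℂ) • fhat (He.fun1 P u)),
    Lp.coeFn_smul (ν : ℂ) (fhat (lap (He.c1 P u))),
    Lp.coeFn_smul (P.nu1 : ℂ) (fhat (He.fun1 P u)),
    Lp.coeFn_smul (P.nu2 : ℂ) (fhat (He.fun2 P u)),
    Lp.coeFn_add ((P.nu3 : ℂ) • fhat (He.fun1 P u) + fhat (lap (He.c2 P u)))
      (((-P.nu2 : ℝ) : ℂ) • fhat (He.fun2 P u)),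
    Lp.coeFn_add ((P.nu3 : ℂ) • fhat (He.fun1 P u)) (fhat (lap (He.c2 P u))),
    Lp.coeFn_smul (P.nu3 : ℂ) (fhat (He.fun1 P u)),
    Lp.coeFn_smul ((-P.nu2 : ℝ) : ℂ) (fhat (He.fun2 P u))]
    with ξ h1 h2 h3 h4 h5 h6 h7 h8 h9 h10 h11
  rw [h3, Pi.add_apply, h4, Pi.add_apply, h5, h6, h7, h8, Pi.add_apply, h9, Pi.add_apply, h10, h11]
  simp only [Pi.smul_apply, smul_eq_mul]
  rw [h1, h2]
  constructor
  · change _ * (_ * fhat (He.fun1 P u) ξ) + _ + _ = _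
    push_cast; ring
  · change _ + _ * fhat (He.fun2 P u) ξ + _ = _
    push_cast; ring

theorem opl_injective : Function.Injective (opl P P.nubar) := by
  rw [← LinearMap.ker_eq_bot, LinearMap.ker_eq_bot']
  intro u hu
  have h := fhat_opl P P.nubar u
  rw [hu] at h
  have hz : fhat 0 = 0 := by simpa using fhat_smul 0 0
  have h' : ∀ᵐ ξ : ℝ, fhat (He.fun1 P u) ξ = 0 ∧ fhat (He.fun2 P u) ξ = 0 := by
    filter_upwards [h, Lp.coeFn_zero ℂ 2 (volume : Measure ℝ)] with ξ h1 h2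
    rw [WithLp.zero_fst, WithLp.zero_snd, hz, h2, Pi.zero_apply] at h1
    have hd := det_symb_ne P ξ
    rw [symb, det_symbolMat] at hd
    have hd' := Complex.ofReal_ne_zero.2 hd
    obtain ⟨ha, hb⟩ := h1
    push_cast at ha hb hd'
    constructor
    · apply (mul_eq_zero.1 _).resolve_left hd'
      linear_combination (-(2 * Real.pi * ξ) ^ 2 - (P.nu2 : ℂ)) * ha.symm - (P.nu2 : ℂ) * hb.symm
    · apply (mul_eq_zero.1 _).resolve_left hd'
      linear_combination (-(P.nubar : ℂ) * (2 * Real.pi * ξ) ^ 2 + (P.nu1 : ℂ)) * hb.symm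
        - (P.nu3 : ℂ) * ha.symm
  have z1 : He.fun1 P u = 0 := by
    apply eq_of_fhat_ae
    rw [hz]
    filter_upwards [h', Lp.coeFn_zero ℂ 2 (volume : Measure ℝ)] with ξ h1 h2
    rw [h1.1, h2, Pi.zero_apply]
  have z2 : He.fun2 P u = 0 := by
    apply eq_of_fhat_ae
    rw [hz]
    filter_upwards [h', Lp.coeFn_zero ℂ 2 (volume : Measure ℝ)] with ξ h1 h2
    rw [h1.2, h2, Pi.zero_apply]
  apply He.ext
  · exact Subtype.ext z1
  · exact Subtype.ext z2

theorem opl_surjective : Function.Surjective (opl P P.nubar) := by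
  intro f
  obtain ⟨a, ha⟩ := exists_H2e_multiplier P (-P.nu2) (-1) f.fst
  obtain ⟨b, hb⟩ := exists_H2e_multiplier P (-P.nu2) 0 f.snd
  obtain ⟨a', ha'⟩ := exists_H2e_multiplier P (-P.nu3) 0 f.fst
  obtain ⟨b', hb'⟩ := exists_H2e_multiplier P P.nu1 (-P.nubar) f.snd
  set u : He P := ((a + b, a' + b') : H2e × H2e) with hu
  have e1 : fhat (He.fun1 P u) = fhat (a : L2e) + fhat (b : L2e) := by
    rw [← fhat_add]; rfl
  have e2 : fhat (He.fun2 P u) = fhat (a' : L2e) + fhat (b' : L2e) := by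
    rw [← fhat_add]; rfl
  refine ⟨u, ?_⟩
  have key : ∀ᵐ ξ : ℝ, fhat (opl P P.nubar u).fst ξ = fhat f.fst ξ ∧
      fhat (opl P P.nubar u).snd ξ = fhat f.snd ξ := by
    have h := fhat_opl P P.nubar u
    rw [e1, e2] at h
    filter_upwards [h, ha, hb, ha', hb', Lp.coeFn_add (fhat (a : L2e)) (fhat (b : L2e)),
      Lp.coeFn_add (fhat (a' : L2e)) (fhat (b' : L2e))] with ξ h1 h2 h3 h4 h5 h6 h7
    rw [h6, h7, Pi.add_apply, Pi.add_apply, h2, h3, h4, h5] at h1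
    rw [h1.1, h1.2]
    have hd := det_symb_ne P ξ
    have hd' := Complex.ofReal_ne_zero.2 hd
    have hdd : (((symb P ξ).det : ℝ) : ℂ) = (-(P.nubar : ℂ) * (2 * Real.pi * ξ) ^ 2 + P.nu1)
      * (-(2 * Real.pi * ξ) ^ 2 - P.nu2) - P.nu2 * P.nu3 := by
      rw [symb, det_symbolMat]; push_cast; ring
    push_cast
    constructor
    · field_simp
      rw [hdd]; ring
    · field_simp
      rw [hdd]; ring
  have k1 : (opl P P.nubar u).fst = f.fst := eq_of_fhat_ae (key.mono fun _ h => h.1)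
  have k2 : (opl P P.nubar u).snd = f.snd := eq_of_fhat_ae (key.mono fun _ h => h.2)
  apply WithLp.ofLp_injective 2
  exact Prod.ext k1 k2

instance : NormedAddCommGroup (He P) :=
  NormedAddCommGroup.induced (He P) (Pair L2e) (opl P P.nubar) (opl_injective P)

instance : NormedSpace ℝ (He P) := NormedSpace.induced ℝ (He P) (Pair L2e) (opl P P.nubar)

theorem norm_He (u : He P) : ‖u‖ = ‖opl P P.nubar u‖ := rfl

/-- The isometric isomorphism `𝕝_ν̄ : 𝓗_e → L²_e`. -/
def oplEquiv : He P ≃ₗᵢ[ℝ] Pair L2e :=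
  LinearIsometryEquiv.ofSurjective
    { toLinearMap := opl P P.nubar, norm_map' := fun u => (norm_He P u).symm } (opl_surjective P)

theorem mem_H2e_of_memLp (u : L2e)
    (h : MemLp (fun ξ : ℝ => ((-(2 * Real.pi * ξ) ^ 2 : ℝ) : ℂ) * fhat u ξ) 2 volume) :
    u ∈ H2e := by
  have h0 := h.coeFn_toLp
  have h0' := (Measure.measurePreserving_neg (volume : Measure ℝ)).quasiMeasurePreserving.ae h0
  have hev := reflC_ae (fhat u)
  rw [fhat_even] at hev
  have hre := conjC_ae (fhat u)
  rw [fhat_real] at hre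
  obtain ⟨v, hv⟩ := exists_fhat_eq h.toLp (by
      apply Lp.ext
      filter_upwards [h0, h0', hev, reflC_ae h.toLp] with x h1 h2 h3 h4
      rw [h4, h2, h1, ← h3]
      congr 2; ring) (by
      apply Lp.ext
      filter_upwards [h0, hre, conjC_ae h.toLp] with x h1 h2 h3
      rw [h3, h1, map_mul, Complex.conj_ofReal, ← h2])
  exact ⟨v, by rw [hv]; exact h0⟩

/-- The space `𝓗_e` consists of all even `u ∈ L² × L²` such that `𝓁 û ∈ L² × L²`. -/
theorem mem_He_iff (u : L2e × L2e) : (u.1 ∈ H2e ∧ u.2 ∈ H2e) ↔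
    MemLp (fun ξ : ℝ => ((-P.nubar * (2 * Real.pi * ξ) ^ 2 + P.nu1 : ℝ) : ℂ) * fhat u.1 ξ
      + (P.nu2 : ℂ) * fhat u.2 ξ) 2 volume ∧
    MemLp (fun ξ : ℝ => (P.nu3 : ℂ) * fhat u.1 ξ
      + ((-(2 * Real.pi * ξ) ^ 2 - P.nu2 : ℝ) : ℂ) * fhat u.2 ξ) 2 volume := by
  constructor
  · rintro ⟨h1, h2⟩
    have h := fhat_opl P P.nubar ((⟨u.1, h1⟩, ⟨u.2, h2⟩) : H2e × H2e)
    exact ⟨(Lp.memLp _).ae_eq (h.mono fun _ h => h.1), (Lp.memLp _).ae_eq (h.mono fun _ h => h.2)⟩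
  · rintro ⟨h1, h2⟩
    have hν : (P.nubar : ℂ) ≠ 0 := Complex.ofReal_ne_zero.2 P.nubar_pos.ne'
    have m1 : MemLp (fhat u.1) 2 volume := Lp.memLp _
    have m2 : MemLp (fhat u.2) 2 volume := Lp.memLp _
    constructor
    · apply mem_H2e_of_memLp
      refine (((h1.sub (m1.const_mul (P.nu1 : ℂ))).sub (m2.const_mul (P.nu2 : ℂ))).const_mul
        (P.nubar : ℂ)⁻¹).ae_eq (Filter.Eventually.of_forall fun ξ => ?_)
      simp only [Pi.sub_apply]
      push_cast
      field_simp
      ring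
    · apply mem_H2e_of_memLp
      refine ((h2.sub (m1.const_mul (P.nu3 : ℂ))).add (m2.const_mul (P.nu2 : ℂ))).ae_eq
        (Filter.Eventually.of_forall fun ξ => ?_)
      simp only [Pi.sub_apply, Pi.add_apply]
      push_cast
      ring


/-! ### Sequence spaces -/

/-- The positive real numbers, used as weights. -/
abbrev PosReal : Type := {c : ℝ // 0 < c}

/-- The real line with the norm `√c |x|`. -/
def Scaled (_c : PosReal) : Type := ℝ

instance (c : PosReal) : AddCommGroup (Scaled c) := inferInstanceAs (AddCommGroup ℝ)
instance (c : PosReal) : Module ℝ (Scaled c) := inferInstanceAs (Module ℝ ℝ)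

/-- The number underlying an element of `Scaled c`. -/
def Scaled.val (c : PosReal) : Scaled c ≃ₗ[ℝ] ℝ := LinearEquiv.refl ℝ ℝ

/-- The isometry `x ↦ √c x` from `Scaled c` to the real line. -/
def Scaled.toReal (c : PosReal) : Scaled c →ₗ[ℝ] ℝ := Real.sqrt c • (Scaled.val c).toLinearMap

theorem Scaled.toReal_apply (c : PosReal) (x : Scaled c) :
    Scaled.toReal c x = Real.sqrt c * Scaled.val c x := rfl

theorem Scaled.toReal_injective (c : PosReal) : Function.Injective (Scaled.toReal c) := by
  intro x y h
  rw [Scaled.toReal_apply, Scaled.toReal_apply] at h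
  exact (Scaled.val c).injective (mul_left_cancel₀ (Real.sqrt_pos.2 c.2).ne' h)

instance (c : PosReal) : NormedAddCommGroup (Scaled c) :=
  NormedAddCommGroup.induced (Scaled c) ℝ (Scaled.toReal c) (Scaled.toReal_injective c)

instance (c : PosReal) : NormedSpace ℝ (Scaled c) :=
  NormedSpace.induced ℝ (Scaled c) ℝ (Scaled.toReal c)

theorem Scaled.norm_eq (c : PosReal) (x : Scaled c) : ‖x‖ = Real.sqrt c * |Scaled.val c x| := by
  change ‖Scaled.toReal c x‖ = _
  rw [Scaled.toReal_apply, norm_mul, Real.norm_of_nonneg (Real.sqrt_nonneg _), Real.norm_eq_abs]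

instance (c : PosReal) : InnerProductSpace ℝ (Scaled c) where
  inner x y := c * Scaled.val c x * Scaled.val c y
  norm_sq_eq_re_inner x := by
    rw [Scaled.norm_eq, mul_pow, Real.sq_sqrt c.2.le, sq_abs]
    simp only [RCLike.re_to_real]; ring
  conj_inner_symm x y := by simp only [conj_trivial]; ring
  add_left x y z := by simp only [map_add]; ring
  smul_left x y r := by simp only [map_smul, smul_eq_mul, conj_trivial]; ring

theorem Scaled.inner_eq (c : PosReal) (x y : Scaled c) :
    inner ℝ x y = c * Scaled.val c x * Scaled.val c y := rfl

instance (c : PosReal) : FiniteDimensional ℝ (Scaled c) := inferInstanceAs (FiniteDimensional ℝ ℝ)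
instance (c : PosReal) : CompleteSpace (Scaled c) := FiniteDimensional.complete ℝ _

/-- The weights `α₀ = 1` and `α_n = 2` for `n > 0`. -/
def wt (n : ℕ) : PosReal := if n = 0 then ⟨1, one_pos⟩ else ⟨2, two_pos⟩

/-- The Hilbert space of real sequences with the norm `(c ∑ α_n |u_n|²)^{1/2}`. -/
abbrev Ell (c : PosReal) : Type := lp (fun n : ℕ => Scaled (c * wt n)) 2

/-- The `n`-th coefficient of a sequence. -/
def coef {c : PosReal} (U : Ell c) (n : ℕ) : ℝ := Scaled.val (c * wt n) (U n)

theorem Ell.norm_sq {c : PosReal} (U : Ell c) :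
    HasSum (fun n => (c : ℝ) * wt n * coef U n ^ 2) (‖U‖ ^ 2) := by
  have h := lp.hasSum_norm (p := 2) (by norm_num) U
  simp only [ENNReal.toReal_ofNat, Real.rpow_ofNat] at h
  convert h using 2 with n
  rw [Scaled.norm_eq, mul_pow, Real.sq_sqrt (c * wt n).2.le, sq_abs]
  rfl

theorem Ell.inner_eq {c : PosReal} (U V : Ell c) :
    inner ℝ U V = ∑' n, (c : ℝ) * wt n * coef U n * coef V n := by
  rw [lp.inner_eq_tsum]; rfl

@[ext] theorem Ell.ext' {c : PosReal} {U V : Ell c} (h : ∀ n, coef U n = coef V n) : U = V :=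
  lp.ext (funext fun n => (Scaled.val (c * wt n)).injective (h n))

theorem Ell.memℓp_iff {c : PosReal} (u : ℕ → ℝ) :
    Memℓp (fun n => (Scaled.val (c * wt n)).symm (u n)) 2 ↔
      Summable (fun n => (wt n : ℝ) * u n ^ 2) := by
  rw [memℓp_gen_iff (by norm_num),
    ← summable_mul_left_iff (f := fun n => (wt n : ℝ) * u n ^ 2) c.2.ne']
  apply summable_congr
  intro n
  rw [Scaled.norm_eq, LinearEquiv.apply_symm_apply]
  simp only [ENNReal.toReal_ofNat, Real.rpow_ofNat]
  rw [mul_pow, Real.sq_sqrt (c * wt n).2.le, sq_abs]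
  exact (mul_assoc (c : ℝ) (wt n) (u n ^ 2))

/-- The sequence with given square summable coefficients. -/
def Ell.mk (c : PosReal) (u : ℕ → ℝ) (h : Summable (fun n => (wt n : ℝ) * u n ^ 2)) : Ell c :=
  ⟨fun n => (Scaled.val (c * wt n)).symm (u n), (Ell.memℓp_iff u).2 h⟩

theorem Ell.coef_mk (c : PosReal) (u : ℕ → ℝ) (h : Summable (fun n => (wt n : ℝ) * u n ^ 2))
    (n : ℕ) : coef (Ell.mk c u h) n = u n := (Scaled.val (c * wt n)).apply_symm_apply (u n)

theorem coef_add {c : PosReal} (U V : Ell c) (n : ℕ) : coef (U + V) n = coef U n + coef V n := by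
  simp [coef]

theorem coef_smul {c : PosReal} (r : ℝ) (U : Ell c) (n : ℕ) : coef (r • U) n = r * coef U n := by
  simp [coef]

theorem Ell.summable {c : PosReal} (U : Ell c) : Summable (fun n => (wt n : ℝ) * coef U n ^ 2) := by
  rw [← summable_mul_left_iff c.2.ne']
  simpa only [mul_assoc] using (Ell.norm_sq U).summable

theorem Ell.tsum_eq {c : PosReal} (U : Ell c) :
    ∑' n, (wt n : ℝ) * coef U n ^ 2 = (c : ℝ)⁻¹ * ‖U‖ ^ 2 := by
  rw [← (Ell.norm_sq U).tsum_eq, ← tsum_mul_left]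
  congr 1; funext n
  have := c.2.ne'
  field_simp

theorem summable_indicator {c : PosReal} (S : Set ℕ) (U : Ell c) :
    Summable (fun n => (wt n : ℝ) * S.indicator (coef U) n ^ 2) := by
  refine Summable.of_nonneg_of_le (fun n => mul_nonneg (wt n).2.le (sq_nonneg _)) ?_ U.summable
  intro n
  by_cases h : n ∈ S
  · rw [Set.indicator_of_mem h]
  · rw [Set.indicator_of_notMem h]
    simpa using mul_nonneg (wt n).2.le (sq_nonneg (coef U n))

/-- The underlying linear map of `cut`. -/
def cutLin (c c' : PosReal) (S : Set ℕ) : Ell c →ₗ[ℝ] Ell c' where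
  toFun U := Ell.mk c' (S.indicator (coef U)) (summable_indicator S U)
  map_add' U V := by
    ext n
    rw [coef_add, Ell.coef_mk, Ell.coef_mk, Ell.coef_mk]
    by_cases h : n ∈ S <;> simp [h, coef_add]
  map_smul' r U := by
    ext n
    rw [RingHom.id_apply, coef_smul, Ell.coef_mk, Ell.coef_mk]
    by_cases h : n ∈ S <;> simp [h, coef_smul]

theorem coef_cutLin (c c' : PosReal) (S : Set ℕ) (U : Ell c) (n : ℕ) :
    coef (cutLin c c' S U) n = S.indicator (coef U) n :=
  Ell.coef_mk _ _ (summable_indicator S U) _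

theorem norm_cutLin_le (c c' : PosReal) (S : Set ℕ) (U : Ell c) :
    ‖cutLin c c' S U‖ ≤ Real.sqrt (c' / c) * ‖U‖ := by
  have hc := c.2
  have hc' := c'.2
  refine (pow_le_pow_iff_left₀ (norm_nonneg _) (by positivity) two_ne_zero).1 ?_
  rw [mul_pow, Real.sq_sqrt (by positivity)]
  have h1 : ∑' n, (wt n : ℝ) * coef (cutLin c c' S U) n ^ 2 ≤
      ∑' n, (wt n : ℝ) * coef U n ^ 2 := by
    refine Summable.tsum_le_tsum ?_ (Ell.summable _) U.summable
    intro n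
    rw [coef_cutLin]
    by_cases h : n ∈ S
    · rw [Set.indicator_of_mem h]
    · rw [Set.indicator_of_notMem h]
      simpa using mul_nonneg (wt n).2.le (sq_nonneg (coef U n))
  rw [U.tsum_eq, Ell.tsum_eq, inv_mul_le_iff₀ hc'] at h1
  calc _ ≤ _ := h1
    _ = _ := by field_simp

/-- The operator on sequences that keeps the coefficients with index in `S` and replaces the others
by zero; the weight of the norm may change. -/
def cut (c c' : PosReal) (S : Set ℕ) : Ell c →L[ℝ] Ell c' :=
  (cutLin c c' S).mkContinuous (Real.sqrt (c' / c)) (norm_cutLin_le c c' S)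

theorem coef_cut (c c' : PosReal) (S : Set ℕ) (U : Ell c) (n : ℕ) :
    coef (cut c c' S U) n = S.indicator (coef U) n := coef_cutLin c c' S U n

/-- The change of weight, which does not change the coefficients. -/
def reweight (c c' : PosReal) : Ell c →L[ℝ] Ell c' := cut c c' Set.univ

/-- The truncation `Π^{≤ N}`. -/
def projLe (c : PosReal) (N : ℕ) : Ell c →L[ℝ] Ell c := cut c c {n | n ≤ N}

/-- The complementary truncation `Π^{> N}`. -/
def projGt (c : PosReal) (N : ℕ) : Ell c →L[ℝ] Ell c := cut c c {n | N < n}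

/-- The norm `∑ α_n |u_n|` of `ℓ¹(ℕ₀)`. -/
def l1norm {c : PosReal} (U : Ell c) : ℝ := ∑' n, (wt n : ℝ) * |coef U n|

/-! ### The maps `γ` and `γ†` -/

/-- The length `|Ω₀| = 2d`. -/
def vol : PosReal := ⟨2 * P.d, by have := P.one_le_d; linarith⟩

/-- The domain `Ω₀ = (-d, d)`. -/
def Omega0 : Set ℝ := Set.Ioo (-P.d) P.d

theorem neg_mem_Omega0 (x : ℝ) : -x ∈ Omega0 P ↔ x ∈ Omega0 P := by
  simp only [Omega0, Set.mem_Ioo]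
  constructor <;> rintro ⟨h1, h2⟩ <;> constructor <;> linarith

theorem measurableSet_Omega0 : MeasurableSet (Omega0 P) := measurableSet_Ioo

/-- The function `1_{Ω₀}(x) cos(2π ñ x)` with `ñ = n / (2d)`. -/
def cosFun (n : ℕ) : ℝ → ℝ :=
  (Omega0 P).indicator fun x => Real.cos (2 * Real.pi * (n / (2 * P.d)) * x)

theorem cosFun_even (n : ℕ) (x : ℝ) : cosFun P n (-x) = cosFun P n x := by
  by_cases h : x ∈ Omega0 P
  · rw [cosFun, Set.indicator_of_mem h, Set.indicator_of_mem ((neg_mem_Omega0 P x).2 h), mul_neg,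
      Real.cos_neg]
  · rw [cosFun, Set.indicator_of_notMem h,
      Set.indicator_of_notMem (fun h' => h ((neg_mem_Omega0 P x).1 h'))]

theorem memLp_cosFun (n : ℕ) (p : ℝ≥0∞) : MemLp (cosFun P n) p volume := by
  rw [cosFun, memLp_indicator_iff_restrict (measurableSet_Omega0 P)]
  have : IsFiniteMeasure (volume.restrict (Omega0 P)) := by
    rw [Omega0]; infer_instance
  refine MemLp.of_bound (by fun_prop) 1 (Filter.Eventually.of_forall fun x => ?_)
  rw [Real.norm_eq_abs]
  exact Real.abs_cos_le_one _

/-- The element `1_{Ω₀} cos(2π ñ ·)` of `L²_e`. -/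
def cosE (n : ℕ) : L2e :=
  mkL2e (cosFun P n) (memLp_cosFun P n 2) (Filter.Eventually.of_forall (cosFun_even P n))

theorem cosE_ae (n : ℕ) : (cosE P n : L2) =ᵐ[volume] cosFun P n := mkL2e_ae _ _ _

theorem inner_L2e (u v : L2e) : inner ℝ u v = ∫ x, (u : L2) x * (v : L2) x := by
  rw [Submodule.coe_inner, L2.inner_def]
  congr 1; funext x
  simp [mul_comm]

theorem inner_smul_L2e (r : ℝ) (u v : L2e) : inner ℝ (r • u) v = r * inner ℝ u v :=
  real_inner_smul_left u v r

theorem inner_cosE (u : L2e) (n : ℕ) : inner ℝ (cosE P n) u =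
    ∫ x in Omega0 P, (u : L2) x * Real.cos (2 * Real.pi * (n / (2 * P.d)) * x) := by
  rw [inner_L2e, ← integral_indicator (measurableSet_Omega0 P)]
  apply integral_congr_ae
  filter_upwards [cosE_ae P n] with x h
  rw [h, cosFun]
  by_cases hx : x ∈ Omega0 P
  · rw [Set.indicator_of_mem hx, Set.indicator_of_mem hx, mul_comm]
  · rw [Set.indicator_of_notMem hx, Set.indicator_of_notMem hx, zero_mul]

theorem integral_cos_int (k : ℤ) : ∫ x in (-P.d)..P.d, Real.cos (2 * Real.pi * (k / (2 * P.d)) * x)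
    = if k = 0 then 2 * P.d else 0 := by
  have hd : P.d ≠ 0 := by have := P.one_le_d; positivity
  split_ifs with h
  · simp [h]; ring
  · have hk : (k : ℝ) ≠ 0 := by exact_mod_cast h
    have hc : 2 * Real.pi * (k / (2 * P.d)) ≠ 0 := by
      have := Real.pi_ne_zero
      positivity
    rw [intervalIntegral.integral_comp_mul_left (fun x => Real.cos x) hc, integral_cos]
    have e1 : 2 * Real.pi * (k / (2 * P.d)) * P.d = k * Real.pi := by field_simp
    rw [mul_neg, Real.sin_neg, e1, Real.sin_int_mul_pi]
    simp

theorem integral_cos_cos (n m : ℕ) : ∫ x in (-P.d)..P.d,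
    Real.cos (2 * Real.pi * (m / (2 * P.d)) * x) * Real.cos (2 * Real.pi * (n / (2 * P.d)) * x)
    = if n = m then 2 * P.d * (wt n : ℝ)⁻¹ else 0 := by
  have e : ∀ x : ℝ, Real.cos (2 * Real.pi * (m / (2 * P.d)) * x)
      * Real.cos (2 * Real.pi * (n / (2 * P.d)) * x)
      = (1 / 2) * Real.cos (2 * Real.pi * (((n - m : ℤ) : ℝ) / (2 * P.d)) * x)
        + (1 / 2) * Real.cos (2 * Real.pi * (((n + m : ℤ) : ℝ) / (2 * P.d)) * x) := by
    intro x
    have h1 := Real.cos_sub (2 * Real.pi * (n / (2 * P.d)) * x) (2 * Real.pi * (m / (2 * P.d)) * x)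
    have h2 := Real.cos_add (2 * Real.pi * (n / (2 * P.d)) * x) (2 * Real.pi * (m / (2 * P.d)) * x)
    rw [← sub_mul, ← mul_sub, ← sub_div] at h1
    rw [← add_mul, ← mul_add, ← add_div] at h2
    push_cast
    rw [h1, h2]; ring
  simp_rw [e]
  rw [intervalIntegral.integral_add, intervalIntegral.integral_const_mul,
    intervalIntegral.integral_const_mul, integral_cos_int, integral_cos_int]
  · by_cases h : n = m
    · subst h
      by_cases h0 : n = 0
      · subst h0; simp [wt]; ring
      · have : (n : ℤ) + n ≠ 0 := by omega
        simp [wt, h0]; ring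
    · have h1 : (n : ℤ) - m ≠ 0 := by omega
      have h2 : (n : ℤ) + m ≠ 0 := by omega
      simp [h, h1, h2]
  · exact (by fun_prop : Continuous _).intervalIntegrable _ _
  · exact (by fun_prop : Continuous _).intervalIntegrable _ _

theorem inner_cosE_cosE (n m : ℕ) : inner ℝ (cosE P n) (cosE P m) =
    if n = m then 2 * P.d * (wt n : ℝ)⁻¹ else 0 := by
  rw [← integral_cos_cos, inner_cosE, intervalIntegral.integral_of_le
    (by have := P.one_le_d; linarith), integral_Ioc_eq_integral_Ioo]
  refine setIntegral_congr_ae (measurableSet_Omega0 P) ?_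
  filter_upwards [cosE_ae P m] with x h hx
  rw [h, cosFun, Set.indicator_of_mem hx]

/-- The isometry `r ↦ α_n r 1_{Ω₀} cos(2π ñ ·)`. -/
def cosIso (n : ℕ) : Scaled (vol P * wt n) →ₗᵢ[ℝ] L2e where
  toLinearMap := ((wt n : ℝ) • (Scaled.val (vol P * wt n)).toLinearMap).smulRight (cosE P n)
  norm_map' r := by
    have hw := (wt n).2
    have hv := (vol P).2
    refine (pow_left_inj₀ (norm_nonneg _) (norm_nonneg _) two_ne_zero).1 ?_
    rw [Scaled.norm_eq, mul_pow, Real.sq_sqrt (vol P * wt n).2.le, sq_abs]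
    change ‖((wt n : ℝ) * Scaled.val (vol P * wt n) r) • cosE P n‖ ^ 2 = _
    rw [norm_smul, mul_pow, ← real_inner_self_eq_norm_sq (cosE P n), inner_cosE_cosE, if_pos rfl,
      Real.norm_eq_abs, sq_abs]
    change _ = ((2 * P.d) * (wt n : ℝ)) * _
    field_simp

theorem cosIso_apply (n : ℕ) (r : Scaled (vol P * wt n)) :
    cosIso P n r = ((wt n : ℝ) * Scaled.val (vol P * wt n) r) • cosE P n := rfl

theorem cosIso_orthogonal :
    OrthogonalFamily ℝ (fun n => Scaled (vol P * wt n)) (cosIso P) := by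
  intro n m h r s
  rw [cosIso_apply, cosIso_apply, inner_smul_L2e, real_inner_comm, inner_smul_L2e, inner_cosE_cosE,
    if_neg (Ne.symm h)]
  simp

/-- The map `γ†(U) = 1_{Ω₀} ∑ α_n u_n cos(2π ñ ·)`, an isometry for the norm with weight
`|Ω₀|`. -/
def gamDagVol : Ell (vol P) →ₗᵢ[ℝ] L2e := (cosIso_orthogonal P).linearIsometry

/-- The map `γ`, `(γ u)_n = |Ω₀|⁻¹ ∫_{Ω₀} u(x) cos(2π ñ x) dx`, as the adjoint of `γ†`. The formula
for the coefficients is proved in `coef_gamVol`. -/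
def gamVol : L2e →L[ℝ] Ell (vol P) := (gamDagVol P).toContinuousLinearMap.adjoint

theorem gamDagVol_hasSum (U : Ell (vol P)) :
    HasSum (fun n => ((wt n : ℝ) * coef U n) • cosE P n) (gamDagVol P U) :=
  (cosIso_orthogonal P).hasSum_linearIsometry U

/-- The series for `γ†` holds pointwise for finitely many coefficients. -/
theorem gamDagVol_ae (U : Ell (vol P)) (K : ℕ) (hU : projLe (vol P) K U = U) :
    (gamDagVol P U : L2) =ᵐ[volume] (Omega0 P).indicator fun x =>
      ∑ n ∈ Finset.range (K + 1), (wt n : ℝ) * coef U n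
        * Real.cos (2 * Real.pi * (n / (2 * P.d)) * x) := by
  have h0 : ∀ n ∉ Finset.range (K + 1), ((wt n : ℝ) * coef U n) • cosE P n = 0 := by
    intro n hn
    have : coef U n = 0 := by
      rw [← hU, projLe, coef_cut, Set.indicator_of_notMem]
      simp only [Finset.mem_range] at hn
      simp only [Set.mem_ofPred_eq]; omega
    rw [this, mul_zero, zero_smul]
  have h := (gamDagVol_hasSum P U).unique (hasSum_sum_of_ne_finset_zero h0)
  have h2 : ∀ s : Finset ℕ,
      ((∑ n ∈ s, ((wt n : ℝ) * coef U n) • cosE P n : L2e) : L2) =ᵐ[volume]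
        (Omega0 P).indicator fun x => ∑ n ∈ s, (wt n : ℝ) * coef U n
        * Real.cos (2 * Real.pi * (n / (2 * P.d)) * x) := by
    intro s
    induction s using Finset.induction_on with
    | empty =>
      simp only [Finset.sum_empty, Set.indicator_zero, Submodule.coe_zero]
      exact Lp.coeFn_zero _ _ _
    | insert a s ha ih =>
      simp only [Finset.sum_insert ha]
      rw [Submodule.coe_add, Submodule.coe_smul]
      filter_upwards [ih, Lp.coeFn_add (((wt a : ℝ) * coef U a) • (cosE P a : L2))
        ((∑ n ∈ s, ((wt n : ℝ) * coef U n) • cosE P n : L2e) : L2),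
        Lp.coeFn_smul ((wt a : ℝ) * coef U a) (cosE P a : L2), cosE_ae P a] with x h1 h2 h3 h4
      rw [h2, Pi.add_apply, h1, h3, Pi.smul_apply, h4, cosFun]
      by_cases hx : x ∈ Omega0 P <;> simp [hx]
  rw [h]
  exact h2 _

theorem coef_gamVol (u : L2e) (n : ℕ) : coef (gamVol P u) n = (2 * P.d)⁻¹ *
    ∫ x in Omega0 P, (u : L2) x * Real.cos (2 * Real.pi * (n / (2 * P.d)) * x) := by
  have hw := (wt n).2
  have hv := (vol P).2
  have hd : 0 < P.d := by have := P.one_le_d; linarith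
  set e : Ell (vol P) := lp.single 2 n ((Scaled.val (vol P * wt n)).symm 1) with he
  have h1 : inner ℝ e (gamVol P u) = (vol P : ℝ) * wt n * coef (gamVol P u) n := by
    rw [he, lp.inner_single_left, Scaled.inner_eq, LinearEquiv.apply_symm_apply, mul_one]
    rfl
  have h2 : gamDagVol P e = (wt n : ℝ) • cosE P n := by
    change (cosIso_orthogonal P).linearIsometry _ = _
    rw [he, OrthogonalFamily.linearIsometry_apply_single, cosIso_apply,
      LinearEquiv.apply_symm_apply, mul_one]
  have h3 : inner ℝ e (gamVol P u) = inner ℝ (gamDagVol P e) u :=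
    ContinuousLinearMap.adjoint_inner_right _ _ _
  rw [h1, h2, inner_smul_L2e, inner_cosE] at h3

  change (2 * P.d) * (wt n : ℝ) * _ = _ at h3
  have hw' := hw.ne'
  rw [eq_inv_mul_iff_mul_eq₀ (by positivity)]
  apply mul_left_cancel₀ hw'
  rw [← h3]; ring

theorem gam_gamDag (U : Ell (vol P)) : gamVol P (gamDagVol P U) = U := by
  have h := (gamDagVol P).adjoint_comp_self
  exact DFunLike.congr_fun h U

/-! ### Product spaces and block operators -/

section Blocks

variable {E F : Type*} [NormedAddCommGroup E] [NormedSpace ℝ E]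
  [NormedAddCommGroup F] [NormedSpace ℝ F]

/-- The block operator `(a, b) ↦ (A a + B b, C a + D b)`. -/
def blk (A B C D : E →L[ℝ] F) : Pair E →L[ℝ] Pair F :=
  (WithLp.prodContinuousLinearEquiv 2 ℝ F F).symm.toContinuousLinearMap ∘L
    ((A ∘L ContinuousLinearMap.fst ℝ E E + B ∘L ContinuousLinearMap.snd ℝ E E).prod
      (C ∘L ContinuousLinearMap.fst ℝ E E + D ∘L ContinuousLinearMap.snd ℝ E E)) ∘L
    (WithLp.prodContinuousLinearEquiv 2 ℝ E E).toContinuousLinearMap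

theorem blk_apply (A B C D : E →L[ℝ] F) (x : Pair E) :
    blk A B C D x = pair (A x.fst + B x.snd) (C x.fst + D x.snd) := rfl

/-- The block operator `diag(A, A)`. -/
def diag2 (A : E →L[ℝ] F) : Pair E →L[ℝ] Pair F := blk A 0 0 A

/-- Triples `(ν, u, w)` with the norm `(|ν|² + ‖u‖² + ‖w‖²)^{1/2}`. -/
abbrev Trip (E : Type*) : Type _ := WithLp 2 (ℝ × Pair E)

/-- The triple `(ν, u, w)`. -/
abbrev trip (ν : ℝ) (u w : E) : Trip E := WithLp.toLp 2 (ν, pair u w)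

/-- The block operator `(ν, u, w) ↦ (c ν, A u, A w)`. -/
def diag3 (c : ℝ) (A : E →L[ℝ] F) : Trip E →L[ℝ] Trip F :=
  (WithLp.prodContinuousLinearEquiv 2 ℝ ℝ (Pair F)).symm.toContinuousLinearMap ∘L
    ((c • ContinuousLinearMap.fst ℝ ℝ (Pair E)).prod
      (diag2 A ∘L ContinuousLinearMap.snd ℝ ℝ (Pair E))) ∘L
    (WithLp.prodContinuousLinearEquiv 2 ℝ ℝ (Pair E)).toContinuousLinearMap

theorem diag3_apply (c : ℝ) (A : E →L[ℝ] F) (x : Trip E) :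
    diag3 c A x = trip (c * x.fst) (A x.snd.fst) (A x.snd.snd) := by
  change WithLp.toLp 2 (c * x.fst, pair (A x.snd.fst + 0) (0 + A x.snd.snd)) = _
  rw [add_zero, zero_add]

/-- The operator `(a, b) ↦ (0, S a, S b)`. -/
def embed (S : E →L[ℝ] F) : Pair E →L[ℝ] Trip F :=
  (WithLp.prodContinuousLinearEquiv 2 ℝ ℝ (Pair F)).symm.toContinuousLinearMap ∘L
    ((0 : Pair E →L[ℝ] ℝ).prod (diag2 S))

theorem embed_apply (S : E →L[ℝ] F) (x : Pair E) : embed S x = trip 0 (S x.fst) (S x.snd) := by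
  change WithLp.toLp 2 ((0 : ℝ), pair (S x.fst + 0) (0 + S x.snd)) = _
  rw [add_zero, zero_add]

/-- The operator `a ↦ (S a, -S a)`. -/
def antidiag (S : E →L[ℝ] F) : E →L[ℝ] Pair F :=
  (WithLp.prodContinuousLinearEquiv 2 ℝ F F).symm.toContinuousLinearMap ∘L (S.prod (-S))

theorem antidiag_apply (S : E →L[ℝ] F) (a : E) : antidiag S a = pair (S a) (-S a) := rfl

end Blocks

/-- The space `H₁ = ℝ × 𝓗_e × 𝓗_e`. -/
abbrev H1 : Type := Trip (He P)

/-- The space `H₂ = ℝ × L²_e × L²_e`. -/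
abbrev H2 : Type := Trip (Pair L2e)

/-- The space `X₂ = ℝ × ℓ²_e × ℓ²_e` with the norm
`(|ν|² + |Ω₀| ‖U‖₂² + |Ω₀| ‖W‖₂²)^{1/2}`. -/
abbrev X2 : Type := Trip (Pair (Ell (vol P)))

/-- The space `ℓ²_e = ℓ²(ℕ₀) × ℓ²(ℕ₀)` with the norm `‖·‖₂`. -/
abbrev Ell2e : Type := Pair (Ell 1)

/-! ### The saddle-node map -/

/-- The polynomial `p(u) = u₁² u₂ + ν₄ u₁² + ν₅ u₁ u₂`. -/
def poly (u : He P) : L2e :=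
  mulOp (He.fun1 P u) (mulOp (He.fun1 P u) (He.fun2 P u))
    + P.nu4 • mulOp (He.fun1 P u) (He.fun1 P u) + P.nu5 • mulOp (He.fun1 P u) (He.fun2 P u)

/-- Elements of `𝓗_e` are bounded, so that the products in `poly` are pointwise products. -/
theorem poly_ae (u : He P) : (poly P u : L2) =ᵐ[volume] fun x =>
    (He.fun1 P u : L2) x ^ 2 * (He.fun2 P u : L2) x + P.nu4 * (He.fun1 P u : L2) x ^ 2
      + P.nu5 * ((He.fun1 P u : L2) x * (He.fun2 P u : L2) x) := by
  have hb : MemLp (He.fun1 P u : L2) ∞ volume := memLp_top_of_H2e (He.c1 P u)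
  set a := He.fun1 P u
  set b := He.fun2 P u
  have e : (poly P u : L2) = ((mulOp a (mulOp a b) : L2e) : L2) + P.nu4 • ((mulOp a a : L2e) : L2)
    + P.nu5 • ((mulOp a b : L2e) : L2) := rfl
  rw [e]
  filter_upwards [mulOp_ae a (mulOp a b) hb, mulOp_ae a a hb, mulOp_ae a b hb,
    Lp.coeFn_add (((mulOp a (mulOp a b) : L2e) : L2) + P.nu4 • ((mulOp a a : L2e) : L2))
      (P.nu5 • ((mulOp a b : L2e) : L2)),
    Lp.coeFn_add ((mulOp a (mulOp a b) : L2e) : L2) (P.nu4 • ((mulOp a a : L2e) : L2)),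
    Lp.coeFn_smul P.nu4 ((mulOp a a : L2e) : L2),
    Lp.coeFn_smul P.nu5 ((mulOp a b : L2e) : L2)] with x h1 h2 h3 h4 h5 h6 h7
  rw [h4, Pi.add_apply, h5, Pi.add_apply, h6, h7, Pi.smul_apply, Pi.smul_apply, h1, h2, h3,
    smul_eq_mul, smul_eq_mul]
  ring

/-- The map `𝕗(ν, u) = 𝕝_ν u + 𝕘(u)` with `𝕘(u) = (p(u), -p(u))`. -/
def fmap (ν : ℝ) (u : He P) : Pair L2e := opl P ν u + pair (poly P u) (-poly P u)

/-- The saddle-node map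
`𝔽(ν, u, w) = ((𝕝_ν̄ ξ, w)₂ - α, 𝕗(ν, u), D_u 𝕗(ν, u) w)`. -/
def Fmap (ξ : He P) (α : ℝ) (x : H1 P) : H2 :=
  WithLp.toLp 2
    (inner ℝ (opl P P.nubar ξ) (pair (He.fun1 P x.snd.snd) (He.fun2 P x.snd.snd)) - α,
      pair (fmap P x.fst x.snd.fst) (fderiv ℝ (fmap P x.fst) x.snd.fst x.snd.snd))

/-! ### The approximate inverse -/

/-- The map `γ : L²_e(ℝ) → ℓ²(ℕ₀)`, `(γ u)_n = |Ω₀|⁻¹ ∫_{Ω₀} u(x) cos(2π ñ x) dx`. -/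
def gam : L2e →L[ℝ] Ell 1 := reweight (vol P) 1 ∘L gamVol P

theorem coef_gam (u : L2e) (n : ℕ) : coef (gam P u) n = (2 * P.d)⁻¹ *
    ∫ x in Omega0 P, (u : L2) x * Real.cos (2 * Real.pi * (n / (2 * P.d)) * x) := by
  rw [← coef_gamVol]
  exact (coef_cut (vol P) 1 Set.univ (gamVol P u) n).trans (by rw [Set.indicator_univ])

/-- The map `γ† : ℓ²(ℕ₀) → L²_e(ℝ)`, `γ†(U) = 1_{Ω₀} ∑ α_n u_n cos(2π ñ ·)`. -/
def gamDag : Ell 1 →L[ℝ] L2e := (gamDagVol P).toContinuousLinearMap ∘L reweight 1 (vol P)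

theorem gamDag_hasSum (U : Ell 1) :
    HasSum (fun n => ((wt n : ℝ) * coef U n) • cosE P n) (gamDag P U) := by
  have h := gamDagVol_hasSum P (reweight 1 (vol P) U)
  simp only [reweight, coef_cut, Set.indicator_univ] at h
  exact h

/-- Multiplication by the indicator function `1_{ℝ ∖ Ω₀}`. -/
def mulOut : L2e →L[ℝ] L2e :=
  mulBdd ((Omega0 P)ᶜ.indicator fun _ => 1)
    ((memLp_top_const (1 : ℝ)).indicator (measurableSet_Omega0 P).compl)
    (Filter.Eventually.of_forall fun x => by
      by_cases h : x ∈ Omega0 P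
      · rw [Set.indicator_of_notMem (Set.notMem_compl_iff.2 ((neg_mem_Omega0 P x).2 h)),
          Set.indicator_of_notMem (Set.notMem_compl_iff.2 h)]
      · rw [Set.indicator_of_mem (show x ∈ (Omega0 P)ᶜ from h),
          Set.indicator_of_mem (show -x ∈ (Omega0 P)ᶜ from
            fun h' => h ((neg_mem_Omega0 P x).1 h'))])

/-- The map `γ̄ = diag(1, γ, γ) : H₂ → X₂`. -/
def gamBar : H2 →L[ℝ] X2 P := diag3 1 (diag2 (gamVol P))

/-- The map `γ̄† = diag(1, γ†, γ†) : X₂ → H₂`. -/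
def gamBarDag : X2 P →L[ℝ] H2 := diag3 1 (diag2 (gamDagVol P).toContinuousLinearMap)

/-- The projection `Π̄^{≤ N} = diag(1, Π^{≤ N}, Π^{≤ N})` on `X₂`. -/
def projBarLe (N : ℕ) : X2 P →L[ℝ] X2 P := diag3 1 (diag2 (projLe (vol P) N))

/-- The projection `Π̄^{> N} = diag(0, Π^{> N}, Π^{> N})` on `X₂`. -/
def projBarGt (N : ℕ) : X2 P →L[ℝ] X2 P := diag3 0 (diag2 (projGt (vol P) N))

/-- The operator `B = Π̄^{> N} + B^N` on `X₂`. -/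
def Bop (N : ℕ) (BN : X2 P →L[ℝ] X2 P) : X2 P →L[ℝ] X2 P := projBarGt P N + BN

/-- The operator `𝔹 = diag(0, 1_{ℝ ∖ Ω₀}, 1_{ℝ ∖ Ω₀}) + γ̄† (Π̄^{> N} + B^N) γ̄` on `H₂`. -/
def BBop (N : ℕ) (BN : X2 P →L[ℝ] X2 P) : H2 →L[ℝ] H2 :=
  diag3 0 (diag2 (mulOut P)) + gamBarDag P ∘L Bop P N BN ∘L gamBar P

/-- The operator `𝔸 = 𝕃_ν̄⁻¹ 𝔹 : H₂ → H₁` with `𝕃_ν̄ = diag(1, 𝕝_ν̄, 𝕝_ν̄)`. -/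
def AAop (N : ℕ) (BN : X2 P →L[ℝ] X2 P) : H2 →L[ℝ] H1 P :=
  diag3 1 (oplEquiv P).symm.toLinearIsometry.toContinuousLinearMap ∘L BBop P N BN

/-! ### The bound -/

/-- The norm `sup_ξ sup_{|x|₂ = 1} |M(ξ) x|₂`. -/
def normM1 (M : ℝ → Matrix (Fin 2) (Fin 2) ℝ) : ℝ :=
  ⨆ ξ : ℝ, ‖Matrix.toEuclideanCLM (n := Fin 2) (𝕜 := ℝ) (M ξ)‖

/-- The norm `max_i (‖M_{i1}‖²_{L²} + ‖M_{i2}‖²_{L²})^{1/2}`. -/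
def normM2 (M : ℝ → Matrix (Fin 2) (Fin 2) ℝ) : ℝ :=
  max (Real.sqrt ((∫ ξ, M ξ 0 0 ^ 2) + ∫ ξ, M ξ 0 1 ^ 2))
    (Real.sqrt ((∫ ξ, M ξ 1 0 ^ 2) + ∫ ξ, M ξ 1 1 ^ 2))

/-- The function `ξ ↦ 𝓁(ξ)⁻¹`. -/
def symbInv (ξ : ℝ) : Matrix (Fin 2) (Fin 2) ℝ := (symb P ξ)⁻¹

/-- The constant `κ = ‖𝓁⁻¹‖_{𝓜₁} ‖𝓁⁻¹‖_{𝓜₂}`. -/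
def kappa : ℝ := normM1 (symbInv P) * normM2 (symbInv P)

/-- The function `φ`, a bound for the norm of a `2 × 2` block operator in terms of the norms of the
blocks. -/
def phi (x₁ x₂ x₃ x₄ : ℝ) : ℝ :=
  min (max x₁ x₄ + max x₂ x₃) (Real.sqrt (x₁ ^ 2 + x₂ ^ 2 + x₃ ^ 2 + x₄ ^ 2))

/-- The indicator function `1_{Ω₀}` as an element of `L²_e`. -/
def indOmega : L2e :=
  mkL2e ((Omega0 P).indicator fun _ => 1)
    ((memLp_indicator_const 2 (measurableSet_Omega0 P) (1 : ℝ) (Or.inr (by simp [Omega0]))))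
    (Filter.Eventually.of_forall fun x => by
      by_cases h : x ∈ Omega0 P
      · rw [Set.indicator_of_mem h, Set.indicator_of_mem ((neg_mem_Omega0 P x).2 h)]
      · rw [Set.indicator_of_notMem h,
          Set.indicator_of_notMem (fun h' => h ((neg_mem_Omega0 P x).1 h'))])

/-- `q₁ = 2 ū₂ + 2 ν₄ 1_{Ω₀}`. -/
def q1 (x : H1 P) : L2e := (2 : ℝ) • He.fun2 P x.snd.fst + (2 * P.nu4) • indOmega P

/-- `q₂ = 2 ū₁ + ν₅ 1_{Ω₀}`. -/
def q2 (x : H1 P) : L2e := (2 : ℝ) • He.fun1 P x.snd.fst + P.nu5 • indOmega P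

/-- `q₃ = 2 w̄₂`. -/
def q3 (x : H1 P) : L2e := (2 : ℝ) • He.fun2 P x.snd.snd

/-- `q₄ = 2 w̄₁`. -/
def q4 (x : H1 P) : L2e := (2 : ℝ) • He.fun1 P x.snd.snd

/-- The convolution operator `V ↦ Q * V = γ(γ†(Q) γ†(V))` on `ℓ²(ℕ₀)`, for sequences `Q` whose
function `γ†(Q)` is bounded. -/
def conv (Q : Ell 1) : Ell 1 →L[ℝ] Ell 1 := gam P ∘L mulOp (gamDag P Q) ∘L gamDag P

/-- The block operator `B^N_{1→5,24}`: the second and the fourth column of `B^N`, the other columns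
being zero. -/
def BN24 (BN : X2 P →L[ℝ] X2 P) : X2 P →L[ℝ] X2 P :=
  BN ∘L diag3 0 (blk (ContinuousLinearMap.id ℝ (Ell (vol P))) 0 0 0)

/-- The block operator `M₁ : ℓ²_e → X₂` with the columns `B_{·2} - B_{·3}` and `B_{·4} - B_{·5}`,
that is `M₁ (V₁, V₂) = B (0, V₁, -V₁, V₂, -V₂)`. -/
def Mone (N : ℕ) (BN : X2 P →L[ℝ] X2 P) : Ell2e →L[ℝ] X2 P :=
  Bop P N BN ∘L embed (antidiag (reweight 1 (vol P)))

/-- The block operator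
`M₂ = [[ℚ₁² + ℚ₂², ℚ₁ℚ₃ + ℚ₂ℚ₄], [ℚ₃ℚ₁ + ℚ₄ℚ₂, ℚ₃² + ℚ₄² + ℚ₁² + ℚ₂²]]` on `ℓ²_e`, where
`ℚ_i` is the convolution with `Q_i`. -/
def Mtwo (Q₁ Q₂ Q₃ Q₄ : Ell 1) : Ell2e →L[ℝ] Ell2e :=
  blk (conv P Q₁ ∘L conv P Q₁ + conv P Q₂ ∘L conv P Q₂)
    (conv P Q₁ ∘L conv P Q₃ + conv P Q₂ ∘L conv P Q₄)
    (conv P Q₃ ∘L conv P Q₁ + conv P Q₄ ∘L conv P Q₂)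
    (conv P Q₃ ∘L conv P Q₃ + conv P Q₄ ∘L conv P Q₄ + conv P Q₁ ∘L conv P Q₁
      + conv P Q₂ ∘L conv P Q₂)

/-- The operator `M₂` for `Q_i = γ(q_i)`. -/
def MtwoAt (x : H1 P) : Ell2e →L[ℝ] Ell2e :=
  Mtwo P (gam P (q1 P x)) (gam P (q2 P x)) (gam P (q3 P x)) (gam P (q4 P x))

/-- `𝓩_{2,1} = max(1, ‖B^N_{1→5,24}‖_{X₂}) ‖[[-|2πξ|², 0], [0, 0]] 𝓁⁻¹(ξ)‖_{𝓜₁}`. -/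
def Z21 (BN : X2 P →L[ℝ] X2 P) : ℝ :=
  max 1 ‖BN24 P BN‖ * normM1 (fun ξ => !![-(2 * Real.pi * ξ) ^ 2, 0; 0, 0] * symbInv P ξ)

/-- `𝓩_{2,2}(r) = ‖M₁‖_{2,X₂} 2 √10 κ ‖𝓁⁻¹‖_{𝓜₂} r`. -/
def Z22 (N : ℕ) (BN : X2 P →L[ℝ] X2 P) (r : ℝ) : ℝ :=
  ‖Mone P N BN‖ * (2 * Real.sqrt 10) * kappa P * normM2 (symbInv P) * r

/-- `𝓩_{2,3} = ‖Π̄^{≤ N} M₁ M₂ M₁^* Π̄^{≤ N}‖_{X₂}`. -/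
def Z23 (N : ℕ) (BN : X2 P →L[ℝ] X2 P) (x : H1 P) : ℝ :=
  ‖projBarLe P N ∘L Mone P N BN ∘L MtwoAt P x ∘L (Mone P N BN).adjoint ∘L projBarLe P N‖

/-- `𝓩_{2,4} = ‖Π̄^{≤ N} M₁ M₂ Π^{> N} M₂^* M₁^* Π̄^{≤ N}‖_{X₂}^{1/2}`. -/
def Z24 (N : ℕ) (BN : X2 P →L[ℝ] X2 P) (x : H1 P) : ℝ :=
  Real.sqrt ‖projBarLe P N ∘L Mone P N BN ∘L MtwoAt P x ∘L diag2 (projGt 1 N) ∘L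
    (MtwoAt P x).adjoint ∘L (Mone P N BN).adjoint ∘L projBarLe P N‖

/-- `𝓩_{2,5} = φ(‖Q₁² + Q₂²‖₁, ‖Q₁Q₃ + Q₂Q₄‖₁, ‖Q₃Q₁ + Q₄Q₂‖₁, ‖Q₃² + Q₄² + Q₁² + Q₂²‖₁)`, the
products being convolutions. -/
def Z25 (x : H1 P) : ℝ :=
  let Q₁ := gam P (q1 P x)
  let Q₂ := gam P (q2 P x)
  let Q₃ := gam P (q3 P x)
  let Q₄ := gam P (q4 P x)
  phi (l1norm (conv P Q₁ Q₁ + conv P Q₂ Q₂)) (l1norm (conv P Q₁ Q₃ + conv P Q₂ Q₄))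
    (l1norm (conv P Q₃ Q₁ + conv P Q₄ Q₂))
    (l1norm (conv P Q₃ Q₃ + conv P Q₄ Q₄ + conv P Q₁ Q₁ + conv P Q₂ Q₂))

/-- `𝓩₂(r) = (1 + √3) 𝓩_{2,1} + 𝓩_{2,2}(r) + 5 κ φ(𝓩_{2,3}, 𝓩_{2,4}, 𝓩_{2,4}, 𝓩_{2,5})^{1/2}`. -/
def Z2 (N : ℕ) (BN : X2 P →L[ℝ] X2 P) (x : H1 P) (r : ℝ) : ℝ :=
  (1 + Real.sqrt 3) * Z21 P BN + Z22 P N BN r + 5 * kappa P *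
    Real.sqrt (phi (Z23 P N BN x) (Z24 P N BN x) (Z24 P N BN x) (Z25 P x))

end SaddleNode

end

open MeasureTheory FourierTransform
open scoped ENNReal

noncomputable section

namespace SaddleNode

section

/-! ### Bounds for Fourier multipliers -/

/-! Since `𝕝_ν̄` is an isometry onto `L²_e`, applying `𝔸` costs exactly the norm of `𝔹`
(`norm_AAop`). In the function components `𝔹` respects an orthogonal splitting: it is the identity
on functions living outside `Ω₀`, and on the Fourier coefficients over `Ω₀` it acts as `B`
(`norm_sq_BBop`).

The transform of `u` is `𝓁⁻¹` times that of `𝕝_ν̄ u`. Hence `‖𝓁⁻¹‖_{𝓜₁}` controls the `L²` norm by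
Plancherel, and `‖𝓁⁻¹‖_{𝓜₂}` controls the `L¹` norm of the transform, hence the sup norm.
Multiplication by a component of `u` is therefore bounded on `L²`, the polynomial `p` is built from
bounded bilinear maps, and differentiability follows from the product rule (`hasFDerivAt_Fmap`). One
`L²` factor and one sup factor together cost `κ`.

As everything is polynomial, the difference of the derivatives at `x̄ + h` and `x̄`, applied to `y`,
is an exact sum of three parts (`fderiv_Fmap_sub`).

The part with `Δ` lives in components 2 and 4, so only these columns of `B^N` matter; this gives
`𝓩_{2,1}` (`norm_lapPart_le`).

The part quadratic in `h` has the shape `(0, a, -a, b, -b)`, on which `𝔹` is bounded by `‖M₁‖`; sup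
bounds for two of the three factors give half of `𝓩_{2,2}` (`norm_cubPart_le`).

The part linear in `h` is the heart (`norm_linPart_le`). On `Ω₀` it multiplies the products `h₁ v₁`
and `h₁ v₂ + h₂ v₁` by the `q_i`, which for coefficients is the operator `K` with rows `(ℚ₁, ℚ₂, 0,
0)` and `(ℚ₃, ℚ₄, ℚ₁, ℚ₂)`. Because `M₂ = K K^*` (`Mtwo_eq_factor`), bounding `M₁ K` amounts to
bounding the quadratic form of `M₁ M₂ M₁^*`. Cutting this into low and high modes produces `𝓩_{2,3}`
for the low block, `𝓩_{2,4}` for the mixed ones and `𝓩_{2,5}` for the tail, and `φ` bounds the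
resulting form in two variables (`inner_conj_le`). The tail bound rests on the sup norm of a
trigonometric polynomial being at most the `ℓ¹` norm of its coefficients (`inner_Mtwo_le`). Outside
`Ω₀` the multipliers are the constants `2 ν₄` and `ν₅`. They are dominated as well: `ū` is
continuous and vanishes at the boundary, so these constants are boundary values of `q₁` and `q₂`
(`nu_sq_le`). -/

theorem norm_sq_Lp_complex (f : Lp ℂ 2 (volume : Measure ℝ)) : ‖f‖ ^ 2 = ∫ ξ, ‖f ξ‖ ^ 2 := by
  have h := congrArg Complex.re (L2.inner_def (𝕜 := ℂ) f f)
  have h2 : ‖f‖ ^ 2 = RCLike.re (inner ℂ f f) := norm_sq_eq_re_inner (𝕜 := ℂ) f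
  rw [h2]
  refine h.trans ?_
  have h3 : ∀ x, inner ℂ (f x) (f x) = ((‖f x‖ ^ 2 : ℝ) : ℂ) := by
    intro x; rw [inner_self_eq_norm_sq_to_K]; norm_cast
  simp_rw [h3]
  rw [integral_complex_ofReal, Complex.ofReal_re]

theorem integrable_norm_sq_Lp_complex (f : Lp ℂ 2 (volume : Measure ℝ)) :
    Integrable (fun ξ => ‖f ξ‖ ^ 2) volume :=
  (Lp.memLp f).integrable_norm_pow two_ne_zero

theorem norm_sq_fhat (u : L2e) : ‖u‖ ^ 2 = ∫ ξ, ‖fhat u ξ‖ ^ 2 := by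
  rw [← norm_fhat, norm_sq_Lp_complex]

/-- The supremum in `normM1` is a real one, equal to 0 for an unbounded family, so it gives
estimates only once boundedness is known. Expanding in matrix units reduces this to the entries. -/
theorem bddAbove_norm_toEuclideanCLM (M : ℝ → Matrix (Fin 2) (Fin 2) ℝ) (C : ℝ)
    (h : ∀ ξ i j, |M ξ i j| ≤ C) :
    BddAbove (Set.range fun ξ => ‖Matrix.toEuclideanCLM (n := Fin 2) (𝕜 := ℝ) (M ξ)‖) := by
  refine ⟨∑ i, ∑ j, C * ‖Matrix.toEuclideanCLM (n := Fin 2) (𝕜 := ℝ) (Matrix.single i j 1)‖, ?_⟩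
  rintro _ ⟨ξ, rfl⟩
  dsimp only
  conv_lhs => rw [Matrix.matrix_eq_sum_single (M ξ)]
  simp only [map_sum]
  refine (norm_sum_le _ _).trans (Finset.sum_le_sum fun i _ => ?_)
  refine (norm_sum_le _ _).trans (Finset.sum_le_sum fun j _ => ?_)
  have : Matrix.single i j (M ξ i j) = M ξ i j • Matrix.single i j (1 : ℝ) := by
    rw [Matrix.smul_single, smul_eq_mul, mul_one]
  rw [this, map_smul, norm_smul, Real.norm_eq_abs]
  gcongr
  exact h ξ i j

theorem normM1_nonneg (M : ℝ → Matrix (Fin 2) (Fin 2) ℝ) : 0 ≤ normM1 M :=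
  Real.iSup_nonneg fun _ => norm_nonneg _

theorem normM2_nonneg (M : ℝ → Matrix (Fin 2) (Fin 2) ℝ) : 0 ≤ normM2 M :=
  le_max_of_le_left (Real.sqrt_nonneg _)

theorem sq_mulVec_le_normM1 (M : ℝ → Matrix (Fin 2) (Fin 2) ℝ)
    (hM : BddAbove (Set.range fun ξ => ‖Matrix.toEuclideanCLM (n := Fin 2) (𝕜 := ℝ) (M ξ)‖))
    (ξ a b : ℝ) :
    (M ξ 0 0 * a + M ξ 0 1 * b) ^ 2 + (M ξ 1 0 * a + M ξ 1 1 * b) ^ 2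
      ≤ normM1 M ^ 2 * (a ^ 2 + b ^ 2) := by
  have h := (Matrix.toEuclideanCLM (n := Fin 2) (𝕜 := ℝ) (M ξ)).le_of_opNorm_le
    (le_ciSup hM ξ) (WithLp.toLp 2 ![a, b])
  have h2 := pow_le_pow_left₀ (norm_nonneg _) h 2
  rw [mul_pow, EuclideanSpace.norm_sq_eq, EuclideanSpace.norm_sq_eq] at h2
  simpa [Matrix.mulVec, dotProduct, Fin.sum_univ_two, normM1] using h2

/-- A real matrix acts separately on real and imaginary parts, so the complex estimate has the same
constant. -/
theorem normSq_mulVec_le_normM1 (M : ℝ → Matrix (Fin 2) (Fin 2) ℝ)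
    (hM : BddAbove (Set.range fun ξ => ‖Matrix.toEuclideanCLM (n := Fin 2) (𝕜 := ℝ) (M ξ)‖))
    (ξ : ℝ) (a b : ℂ) :
    ‖(M ξ 0 0 : ℂ) * a + M ξ 0 1 * b‖ ^ 2 + ‖(M ξ 1 0 : ℂ) * a + M ξ 1 1 * b‖ ^ 2
      ≤ normM1 M ^ 2 * (‖a‖ ^ 2 + ‖b‖ ^ 2) := by
  have h1 := sq_mulVec_le_normM1 M hM ξ a.re b.re
  have h2 := sq_mulVec_le_normM1 M hM ξ a.im b.im
  simp only [← Complex.normSq_eq_norm_sq, Complex.normSq_apply, Complex.add_re, Complex.add_im,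
    Complex.re_ofReal_mul, Complex.im_ofReal_mul]
  linarith

/-- The norm `‖·‖_{𝓜₁}` bounds the `L²` norm of a matrix Fourier multiplier. -/
theorem multiplier_bound (M : ℝ → Matrix (Fin 2) (Fin 2) ℝ)
    (hM : BddAbove (Set.range fun ξ => ‖Matrix.toEuclideanCLM (n := Fin 2) (𝕜 := ℝ) (M ξ)‖))
    (u₁ u₂ g₁ g₂ : L2e)
    (h1 : fhat u₁ =ᵐ[volume] fun ξ => (M ξ 0 0 : ℂ) * fhat g₁ ξ + M ξ 0 1 * fhat g₂ ξ)
    (h2 : fhat u₂ =ᵐ[volume] fun ξ => (M ξ 1 0 : ℂ) * fhat g₁ ξ + M ξ 1 1 * fhat g₂ ξ) :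
    ‖u₁‖ ^ 2 + ‖u₂‖ ^ 2 ≤ normM1 M ^ 2 * (‖g₁‖ ^ 2 + ‖g₂‖ ^ 2) := by
  simp only [norm_sq_fhat]
  rw [← integral_add (integrable_norm_sq_Lp_complex _) (integrable_norm_sq_Lp_complex _),
    ← integral_add (integrable_norm_sq_Lp_complex _) (integrable_norm_sq_Lp_complex _),
    ← integral_const_mul]
  refine integral_mono_ae
    ((integrable_norm_sq_Lp_complex _).add (integrable_norm_sq_Lp_complex _))
    (((integrable_norm_sq_Lp_complex _).add (integrable_norm_sq_Lp_complex _)).const_mul _) ?_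
  filter_upwards [h1, h2] with ξ e1 e2
  rw [e1, e2]
  exact normSq_mulVec_le_normM1 M hM ξ _ _

/-- Cauchy-Schwarz for `L²` functions, for the integral of the product of the absolute values. -/
theorem integral_abs_mul_norm_le (m : ℝ → ℝ) (hm : MemLp m 2 volume)
    (f : Lp ℂ 2 (volume : Measure ℝ)) :
    ∫ ξ, |m ξ| * ‖f ξ‖ ≤ Real.sqrt (∫ ξ, m ξ ^ 2) * ‖f‖ := by
  have h := integral_mul_norm_le_Lp_mul_Lq (μ := (volume : Measure ℝ)) (f := m)
    (g := fun ξ => ‖f ξ‖) Real.HolderConjugate.two_two (by simpa using hm)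
    (by simpa using (Lp.memLp f).norm)
  have e : Real.sqrt (∫ ξ, ‖f ξ‖ ^ 2) = ‖f‖ := by
    rw [← norm_sq_Lp_complex, Real.sqrt_sq (norm_nonneg _)]
  rw [← e, Real.sqrt_eq_rpow, Real.sqrt_eq_rpow]
  simpa using h

/-- Cauchy–Schwarz is used twice: in `ξ` for each product, then in `ℝ²` for the sum of the two. This
is how a row of `normM2` turns `L²` control into `L¹` control of a transform. -/
theorem integral_norm_multiplier_le (m₁ m₂ : ℝ → ℝ) (h₁ : MemLp m₁ 2 volume)
    (h₂ : MemLp m₂ 2 volume) (f f₁ f₂ : Lp ℂ 2 (volume : Measure ℝ))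
    (hf : f =ᵐ[volume] fun ξ => (m₁ ξ : ℂ) * f₁ ξ + m₂ ξ * f₂ ξ) :
    ∫ ξ, ‖f ξ‖ ≤ Real.sqrt ((∫ ξ, m₁ ξ ^ 2) + ∫ ξ, m₂ ξ ^ 2)
      * Real.sqrt (‖f₁‖ ^ 2 + ‖f₂‖ ^ 2) := by
  have i1 : Integrable (fun ξ => |m₁ ξ| * ‖f₁ ξ‖) volume :=
    MemLp.integrable_mul (p := 2) (q := 2) h₁.abs (Lp.memLp f₁).norm
  have i2 : Integrable (fun ξ => |m₂ ξ| * ‖f₂ ξ‖) volume :=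
    MemLp.integrable_mul (p := 2) (q := 2) h₂.abs (Lp.memLp f₂).norm
  have hle : ∀ᵐ ξ, ‖f ξ‖ ≤ |m₁ ξ| * ‖f₁ ξ‖ + |m₂ ξ| * ‖f₂ ξ‖ := by
    filter_upwards [hf] with ξ e
    rw [e]
    refine (norm_add_le _ _).trans_eq ?_
    rw [norm_mul, norm_mul, Complex.norm_real, Complex.norm_real, Real.norm_eq_abs,
      Real.norm_eq_abs]
  have hi : ∫ ξ, ‖f ξ‖ ≤ ∫ ξ, (|m₁ ξ| * ‖f₁ ξ‖ + |m₂ ξ| * ‖f₂ ξ‖) :=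
    integral_mono_of_nonneg (Filter.Eventually.of_forall fun _ => norm_nonneg _) (i1.add i2) hle
  rw [integral_add i1 i2] at hi
  have k1 := integral_abs_mul_norm_le m₁ h₁ f₁
  have k2 := integral_abs_mul_norm_le m₂ h₂ f₂
  have a0 : 0 ≤ ∫ ξ, m₁ ξ ^ 2 := integral_nonneg fun _ => sq_nonneg _
  have b0 : 0 ≤ ∫ ξ, m₂ ξ ^ 2 := integral_nonneg fun _ => sq_nonneg _
  set a := Real.sqrt (∫ ξ, m₁ ξ ^ 2) with ha
  set b := Real.sqrt (∫ ξ, m₂ ξ ^ 2) with hb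
  have ea : (∫ ξ, m₁ ξ ^ 2) = a ^ 2 := (Real.sq_sqrt a0).symm
  have eb : (∫ ξ, m₂ ξ ^ 2) = b ^ 2 := (Real.sq_sqrt b0).symm
  rw [ea, eb, ← Real.sqrt_mul (by positivity)]
  refine (hi.trans (add_le_add k1 k2)).trans (Real.le_sqrt_of_sq_le ?_)
  nlinarith [sq_nonneg (a * ‖f₂‖ - b * ‖f₁‖)]

/-- Elements of `H²(ℝ)` have a continuous representative, bounded by the `L¹` norm of the Fourier
transform. -/
theorem exists_continuous_rep (u : H2e) : ∃ g : ℝ → ℝ, Continuous g ∧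
    ((u : L2e) : L2) =ᵐ[volume] g ∧ ∀ x, |g x| ≤ ∫ ξ, ‖fhat (u : L2e) ξ‖ := by
  set f := fhat (u : L2e) with hf
  have hi : Integrable f volume := integrable_fhat u
  have hinv : toC ((u : L2e) : L2) = 𝓕⁻ f := by
    rw [hf, fhat, FourierTransform.fourierInv_fourier_eq]
  have hcont : Continuous (𝓕⁻ (f : ℝ → ℂ)) := by
    have h := VectorFourier.fourierIntegral_continuous (e := Real.fourierChar) (μ := volume)
      (L := innerₗ ℝ) Real.continuous_fourierChar (by fun_prop) hi
    have h2 : 𝓕⁻ (f : ℝ → ℂ) = fun x => 𝓕 (f : ℝ → ℂ) (-x) := by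
      ext x; rw [Real.fourierInv_eq_fourier_neg]
    rw [h2]
    exact h.comp continuous_neg
  -- The inverse transform in `L²` and the integral formula for an integrable function agree because
  -- they have the same integrals against test functions, onto which the transform can be moved.
  have key : ∀ᵐ x, (toC ((u : L2e) : L2)) x = 𝓕⁻ (f : ℝ → ℂ) x := by
    apply ae_eq_of_integral_contDiff_smul_eq
    · exact (Lp.memLp (toC ((u : L2e) : L2))).locallyIntegrable (by norm_num)
    · exact hcont.locallyIntegrable
    · intro g hg hgc
      set G : SchwartzMap ℝ ℂ := (hgc.comp_left (g := ((↑) : ℝ → ℂ)) Complex.ofReal_zero).toSchwartzMap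
        (Complex.ofRealCLM.contDiff.comp hg) with hG
      have hGx : ∀ x, G x = (g x : ℂ) := fun x => rfl
      have h1 := DFunLike.congr_fun (Lp.fourierInv_toTemperedDistribution_eq f) G
      rw [TemperedDistribution.fourierInv_apply, Lp.toTemperedDistribution_apply,
        Lp.toTemperedDistribution_apply, ← hinv] at h1
      have h2 : ∫ x, g x • (toC ((u : L2e) : L2)) x = ∫ x, G x • (toC ((u : L2e) : L2)) x := by
        simp [hGx]
      rw [h2, ← h1]
      have h3 : ∫ ξ, 𝓕⁻ (G : ℝ → ℂ) ξ • f ξ = ∫ x, G x • 𝓕⁻ (f : ℝ → ℂ) x := by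
        have hL : (-innerₗ ℝ : ℝ →ₗ[ℝ] ℝ →ₗ[ℝ] ℝ).flip = -innerₗ ℝ := by
          ext; simp
        have := VectorFourier.integral_fourierIntegral_smul_eq_flip (L := (-innerₗ ℝ))
          (μ := volume) (ν := volume) (f := (G : ℝ → ℂ)) (g := (f : ℝ → ℂ))
          Real.continuous_fourierChar (by simp only [LinearMap.neg_apply]; fun_prop) G.integrable hi
        rw [hL] at this
        exact this
      rw [SchwartzMap.fourierInv_coe, h3]
      simp [hGx]
  refine ⟨fun x => (𝓕⁻ (f : ℝ → ℂ) x).re, Complex.continuous_re.comp hcont, ?_, fun x => ?_⟩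
  · filter_upwards [key, toC_ae ((u : L2e) : L2)] with x h1 h2
    rw [← h1, h2, Complex.ofReal_re]
  · refine (Complex.abs_re_le_norm _).trans ?_
    rw [Real.fourierInv_eq_fourier_neg]
    exact VectorFourier.norm_fourierIntegral_le_integral_norm _ _ _ _ _

/-! ### Decay of the inverse symbol and the embeddings of `𝓗_e` -/

variable (P : Params)

theorem symbInv_eq (ξ : ℝ) : symbInv P ξ =
    !![(-P.nu2 - (2 * Real.pi * ξ) ^ 2) / (symb P ξ).det, -P.nu2 / (symb P ξ).det;
      -P.nu3 / (symb P ξ).det, (P.nu1 - P.nubar * (2 * Real.pi * ξ) ^ 2) / (symb P ξ).det] := by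
  rw [symbInv, Matrix.inv_def, Ring.inverse_eq_inv', symb, symbolMat, Matrix.adjugate_fin_two]
  ext i j
  fin_cases i <;> fin_cases j <;> simp <;> ring

/-- Rational functions of the type of the entries of the inverse symbol decay like
`(1 + ξ²)⁻¹`. -/
theorem exists_bound_div_det (A B : ℝ) : ∃ C, ∀ ξ : ℝ,
    |(A + B * (2 * Real.pi * ξ) ^ 2) / (symb P ξ).det| * (1 + (2 * Real.pi * ξ) ^ 2) ≤ C := by
  obtain ⟨c, hc, h⟩ := det_symb_growth P
  refine ⟨2 * (|A| + |B|) / c, fun ξ => ?_⟩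
  have h1 := h ξ
  have hpos : 0 < |(symb P ξ).det| := abs_pos.2 (det_symb_ne P ξ)
  rw [abs_div, div_mul_eq_mul_div, div_le_div_iff₀ hpos hc]
  have hs0 : 0 ≤ (2 * Real.pi * ξ) ^ 2 := sq_nonneg _
  set s := (2 * Real.pi * ξ) ^ 2
  have h2 : |A + B * s| ≤ (|A| + |B|) * (1 + s) := by
    calc |A + B * s| ≤ |A| + |B * s| := abs_add_le _ _
      _ = |A| + |B| * s := by rw [abs_mul, abs_of_nonneg hs0]
      _ ≤ _ := by nlinarith [abs_nonneg A, abs_nonneg B, mul_nonneg (abs_nonneg A) hs0]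
  calc _ ≤ (|A| + |B|) * (1 + s) * (1 + s) * c := by gcongr
    _ = (|A| + |B|) * c * (1 + s) ^ 2 := by ring
    _ ≤ (|A| + |B|) * c * (2 * (1 + s ^ 2)) := by
        gcongr
        nlinarith [sq_nonneg (s - 1)]
    _ = 2 * (|A| + |B|) * (c * (1 + s ^ 2)) := by ring
    _ ≤ _ := by gcongr

/-- The determinant grows like `ξ⁴` and the cofactors at most like `ξ²`. This one rate makes `𝓁⁻¹`
and `|2πξ|² 𝓁⁻¹` bounded and the entries of `𝓁⁻¹` square integrable. -/
theorem exists_bound_symbInv : ∃ C, 0 ≤ C ∧ ∀ ξ i j,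
    |symbInv P ξ i j| * (1 + (2 * Real.pi * ξ) ^ 2) ≤ C := by
  obtain ⟨C1, h1⟩ := exists_bound_div_det P (-P.nu2) (-1)
  obtain ⟨C2, h2⟩ := exists_bound_div_det P (-P.nu2) 0
  obtain ⟨C3, h3⟩ := exists_bound_div_det P (-P.nu3) 0
  obtain ⟨C4, h4⟩ := exists_bound_div_det P P.nu1 (-P.nubar)
  refine ⟨|C1| + |C2| + |C3| + |C4|, by positivity, fun ξ i j => ?_⟩
  have := abs_nonneg C1
  have := abs_nonneg C2
  have := abs_nonneg C3
  have := abs_nonneg C4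
  have := le_abs_self C1
  have := le_abs_self C2
  have := le_abs_self C3
  have := le_abs_self C4
  have h1 := h1 ξ
  have h2 := h2 ξ
  have h3 := h3 ξ
  have h4 := h4 ξ
  simp only [zero_mul, add_zero, neg_mul, one_mul, ← sub_eq_add_neg] at h1 h2 h3 h4
  rw [symbInv_eq]
  fin_cases i <;> fin_cases j <;> simp <;> linarith

theorem bddAbove_symbInv : BddAbove (Set.range fun ξ =>
    ‖Matrix.toEuclideanCLM (n := Fin 2) (𝕜 := ℝ) (symbInv P ξ)‖) := by
  obtain ⟨C, _, h⟩ := exists_bound_symbInv P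
  refine bddAbove_norm_toEuclideanCLM _ C fun ξ i j => le_trans ?_ (h ξ i j)
  nlinarith [abs_nonneg (symbInv P ξ i j), sq_nonneg (2 * Real.pi * ξ),
    mul_nonneg (abs_nonneg (symbInv P ξ i j)) (sq_nonneg (2 * Real.pi * ξ))]

/-- The symbol of the map `u ↦ (Δ u₁, 0)` relative to `𝕝_ν̄`. -/
def lapSymb (ξ : ℝ) : Matrix (Fin 2) (Fin 2) ℝ :=
  !![-(2 * Real.pi * ξ) ^ 2, 0; 0, 0] * symbInv P ξ

theorem lapSymb_zero (ξ : ℝ) (j : Fin 2) :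
    lapSymb P ξ 0 j = -(2 * Real.pi * ξ) ^ 2 * symbInv P ξ 0 j := by
  simp [lapSymb, Matrix.mul_apply, Fin.sum_univ_two]

theorem lapSymb_one (ξ : ℝ) (j : Fin 2) : lapSymb P ξ 1 j = 0 := by
  simp [lapSymb, Matrix.mul_apply, Fin.sum_univ_two]

theorem bddAbove_lapSymb : BddAbove (Set.range fun ξ =>
    ‖Matrix.toEuclideanCLM (n := Fin 2) (𝕜 := ℝ) (lapSymb P ξ)‖) := by
  obtain ⟨C, hC, h⟩ := exists_bound_symbInv P
  refine bddAbove_norm_toEuclideanCLM _ C fun ξ i j => ?_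
  fin_cases i
  · change |lapSymb P ξ 0 j| ≤ C
    rw [lapSymb_zero, abs_mul, abs_neg, abs_of_nonneg (sq_nonneg _)]
    refine le_trans ?_ (h ξ 0 j)
    nlinarith [abs_nonneg (symbInv P ξ 0 j)]
  · change |lapSymb P ξ 1 j| ≤ C
    rw [lapSymb_one]; simpa using hC

theorem memLp_symbInv (i j : Fin 2) : MemLp (fun ξ => symbInv P ξ i j) 2 volume := by
  obtain ⟨C, hC, h⟩ := exists_bound_symbInv P
  have hmeas : Measurable fun ξ => symbInv P ξ i j := by
    simp only [symbInv_eq, symb, det_symbolMat]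
    fin_cases i <;> fin_cases j <;> simp <;> fun_prop
  rw [memLp_two_iff_integrable_sq hmeas.aestronglyMeasurable]
  refine Integrable.mono' (integrable_inv_one_add_sq.const_mul (C ^ 2)) (by fun_prop) ?_
  filter_upwards with x
  -- Dropping the factor `4π² ≥ 1` allows a comparison with the integrable function `(1 + x²)⁻¹`.
  have hx : 1 + x ^ 2 ≤ 1 + (2 * Real.pi * x) ^ 2 := by
    nlinarith [Real.pi_gt_three, sq_nonneg x, mul_nonneg (sq_nonneg x)
      (by nlinarith [Real.pi_gt_three] : (0 : ℝ) ≤ 4 * Real.pi ^ 2 - 1)]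
  have h1 : |symbInv P x i j| * (1 + x ^ 2) ≤ C :=
    (mul_le_mul_of_nonneg_left hx (abs_nonneg _)).trans (h x i j)
  have h0 : 0 < 1 + x ^ 2 := by positivity
  rw [Real.norm_of_nonneg (sq_nonneg _), ← div_eq_mul_inv, le_div_iff₀ h0, ← sq_abs]
  have h2 := pow_le_pow_left₀ (by positivity) h1 2
  nlinarith [mul_nonneg (sq_nonneg |symbInv P x i j|) (sq_nonneg x), sq_nonneg x,
    mul_nonneg (sq_nonneg |symbInv P x i j|) (sq_nonneg (x ^ 2))]

theorem symbInv_mul_symb (ξ : ℝ) : symbInv P ξ * symb P ξ = 1 :=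
  Matrix.nonsing_inv_mul _ (isUnit_iff_ne_zero.2 (det_symb_ne P ξ))

/-- The components of `û` in terms of the Fourier transform of `𝕝_ν̄ u`. -/
theorem fhat_fun_eq (u : He P) : ∀ᵐ ξ : ℝ,
    fhat (He.fun1 P u) ξ = (symbInv P ξ 0 0 : ℂ) * fhat (opl P P.nubar u).fst ξ
      + symbInv P ξ 0 1 * fhat (opl P P.nubar u).snd ξ ∧
    fhat (He.fun2 P u) ξ = (symbInv P ξ 1 0 : ℂ) * fhat (opl P P.nubar u).fst ξ
      + symbInv P ξ 1 1 * fhat (opl P P.nubar u).snd ξ := by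
  filter_upwards [fhat_opl P P.nubar u] with ξ ⟨h1, h2⟩
  have hm := symbInv_mul_symb P ξ
  have e00 := congrFun (congrFun hm 0) 0
  have e01 := congrFun (congrFun hm 0) 1
  have e10 := congrFun (congrFun hm 1) 0
  have e11 := congrFun (congrFun hm 1) 1
  simp only [Matrix.mul_apply, Fin.sum_univ_two, symb, symbolMat, Matrix.of_apply,
    Matrix.cons_val', Matrix.cons_val_zero, Matrix.cons_val_one, Matrix.one_apply_eq,
    Matrix.one_apply_ne, ne_eq, zero_ne_one, one_ne_zero, not_false_eq_true] at e00 e01 e10 e11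
  replace e00 := congrArg (Complex.ofReal) e00
  replace e01 := congrArg (Complex.ofReal) e01
  replace e10 := congrArg (Complex.ofReal) e10
  replace e11 := congrArg (Complex.ofReal) e11
  rw [h1, h2]
  push_cast at e00 e01 e10 e11 ⊢
  constructor
  · linear_combination -(fhat (He.fun1 P u) ξ) * e00 - (fhat (He.fun2 P u) ξ) * e01
  · linear_combination -(fhat (He.fun1 P u) ξ) * e10 - (fhat (He.fun2 P u) ξ) * e11

theorem norm_sq_pair {E : Type*} [NormedAddCommGroup E] (x : Pair E) :
    ‖x‖ ^ 2 = ‖x.fst‖ ^ 2 + ‖x.snd‖ ^ 2 := WithLp.prod_norm_sq_eq_of_L2 x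

theorem norm_sq_fun_le (u : He P) :
    ‖He.fun1 P u‖ ^ 2 + ‖He.fun2 P u‖ ^ 2 ≤ normM1 (symbInv P) ^ 2 * ‖u‖ ^ 2 := by
  rw [norm_He, norm_sq_pair]
  exact multiplier_bound _ (bddAbove_symbInv P) _ _ _ _
    ((fhat_fun_eq P u).mono fun _ h => h.1) ((fhat_fun_eq P u).mono fun _ h => h.2)

/-- The second row of `lapSymb` is zero, so the multiplier bound applies to the pair `(Δu₁, 0)`. -/
theorem norm_lap_le (u : He P) : ‖lap (He.c1 P u)‖ ≤ normM1 (lapSymb P) * ‖u‖ := by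
  have h := multiplier_bound _ (bddAbove_lapSymb P) (lap (He.c1 P u)) 0
    (opl P P.nubar u).fst (opl P P.nubar u).snd ?_ ?_
  · rw [← norm_sq_pair, ← norm_He, norm_zero] at h
    refine abs_le_of_sq_le_sq' (b := normM1 (lapSymb P) * ‖u‖) ?_
      (mul_nonneg (normM1_nonneg _) (norm_nonneg _)) |>.2
    rw [mul_pow]; linarith
  · filter_upwards [fhat_lap (He.c1 P u), fhat_fun_eq P u] with ξ h1 h2
    rw [h1]
    change _ * fhat (He.fun1 P u) ξ = _
    rw [h2.1, lapSymb_zero, lapSymb_zero]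
    push_cast; ring
  · have hz : fhat 0 = 0 := by simpa using fhat_smul 0 0
    rw [hz]
    filter_upwards [Lp.coeFn_zero ℂ 2 (volume : Measure ℝ)] with ξ h1
    rw [h1, lapSymb_one, lapSymb_one]; simp

theorem integral_norm_fhat_le (u : He P) :
    (∫ ξ, ‖fhat (He.fun1 P u) ξ‖ ≤ normM2 (symbInv P) * ‖u‖) ∧
    ∫ ξ, ‖fhat (He.fun2 P u) ξ‖ ≤ normM2 (symbInv P) * ‖u‖ := by
  have e : Real.sqrt (‖fhat (opl P P.nubar u).fst‖ ^ 2 + ‖fhat (opl P P.nubar u).snd‖ ^ 2)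
      = ‖u‖ := by
    rw [norm_fhat, norm_fhat, ← norm_sq_pair, ← norm_He, Real.sqrt_sq (norm_nonneg _)]
  constructor
  · have h := integral_norm_multiplier_le _ _ (memLp_symbInv P 0 0) (memLp_symbInv P 0 1) _ _ _
      ((fhat_fun_eq P u).mono fun _ h => h.1)
    rw [e] at h
    exact h.trans (mul_le_mul_of_nonneg_right (le_max_left _ _) (norm_nonneg _))
  · have h := integral_norm_multiplier_le _ _ (memLp_symbInv P 1 0) (memLp_symbInv P 1 1) _ _ _
      ((fhat_fun_eq P u).mono fun _ h => h.2)
    rw [e] at h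
    exact h.trans (mul_le_mul_of_nonneg_right (le_max_right _ _) (norm_nonneg _))

/-- The sup norm is at most the `L¹` norm of the transform. This is what makes the multiplications
`mul1` and `mul2` bounded. -/
theorem ae_abs_fun1_le (u : He P) :
    ∀ᵐ x, |(He.fun1 P u : L2) x| ≤ normM2 (symbInv P) * ‖u‖ := by
  obtain ⟨g, _, hg, hb⟩ := exists_continuous_rep (He.c1 P u)
  filter_upwards [hg] with x hx
  exact (congrArg abs hx).trans_le ((hb x).trans (integral_norm_fhat_le P u).1)

theorem ae_abs_fun2_le (u : He P) :
    ∀ᵐ x, |(He.fun2 P u : L2) x| ≤ normM2 (symbInv P) * ‖u‖ := by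
  obtain ⟨g, _, hg, hb⟩ := exists_continuous_rep (He.c2 P u)
  filter_upwards [hg] with x hx
  exact (congrArg abs hx).trans_le ((hb x).trans (integral_norm_fhat_le P u).2)

end

section

/-! ### Pointwise products -/

/-- The germ of an even `L²` function modulo equality almost everywhere; germs form a ring. -/
def germ (u : L2e) : Filter.Germ (ae (volume : Measure ℝ)) ℝ := ((u : L2) : ℝ → ℝ)

/-- Identities between products of `L²` functions can thus be checked in the commutative ring of
germs, where `ring` settles them. -/
theorem germ_injective : Function.Injective germ := fun _ _ h =>
  Subtype.ext (Lp.ext (Filter.Germ.coe_eq.1 h))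

theorem germ_add (u v : L2e) : germ (u + v) = germ u + germ v :=
  Filter.Germ.coe_eq.2 (Lp.coeFn_add (u : L2) (v : L2))

theorem germ_sub (u v : L2e) : germ (u - v) = germ u - germ v :=
  Filter.Germ.coe_eq.2 (Lp.coeFn_sub (u : L2) (v : L2))

theorem germ_zero : germ 0 = 0 :=
  Filter.Germ.coe_eq.2 (Lp.coeFn_zero ℝ 2 (volume : Measure ℝ))

theorem germ_smul (c : ℝ) (u : L2e) :
    germ (c • u) = ((c : ℝ) : Filter.Germ (ae (volume : Measure ℝ)) ℝ) * germ u :=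
  Filter.Germ.coe_eq.2 (Lp.coeFn_smul c (u : L2))

theorem germ_mulOp {q : L2e} (hq : MemLp (q : L2) ∞ volume) (v : L2e) :
    germ (mulOp q v) = germ q * germ v :=
  Filter.Germ.coe_eq.2 (mulOp_ae q v hq)

theorem germ_mulBdd (q : ℝ → ℝ) (hq : MemLp q ∞ volume) (he : ∀ᵐ x, q (-x) = q x) (v : L2e) :
    germ (mulBdd q hq he v) = (q : Filter.Germ (ae (volume : Measure ℝ)) ℝ) * germ v :=
  Filter.Germ.coe_eq.2 (mulBdd_ae q hq he v)

theorem norm_mulOp_le {q : L2e} (hq : MemLp (q : L2) ∞ volume) {C : ℝ}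
    (hC : ∀ᵐ x, |(q : L2) x| ≤ C) (v : L2e) : ‖mulOp q v‖ ≤ C * ‖v‖ := by
  apply Lp.norm_le_mul_norm_of_ae_le_mul
  filter_upwards [hC, mulOp_ae q v hq] with x h1 h2
  change ‖(mulOp q v : L2) x‖ ≤ C * ‖(v : L2) x‖
  rw [h2, norm_mul, Real.norm_eq_abs]
  gcongr

variable (P : Params)

theorem memLp_top_fun1 (u : He P) : MemLp (He.fun1 P u : L2) ∞ volume :=
  memLp_top_of_H2e (He.c1 P u)

theorem memLp_top_fun2 (u : He P) : MemLp (He.fun2 P u : L2) ∞ volume :=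
  memLp_top_of_H2e (He.c2 P u)

theorem norm_fun1_le (u : He P) : ‖He.fun1 P u‖ ≤ normM1 (symbInv P) * ‖u‖ := by
  refine le_of_sq_le_sq ?_ (mul_nonneg (normM1_nonneg _) (norm_nonneg _))
  rw [mul_pow]
  nlinarith [norm_sq_fun_le P u, sq_nonneg ‖He.fun2 P u‖]

theorem norm_fun2_le (u : He P) : ‖He.fun2 P u‖ ≤ normM1 (symbInv P) * ‖u‖ := by
  refine le_of_sq_le_sq ?_ (mul_nonneg (normM1_nonneg _) (norm_nonneg _))
  rw [mul_pow]
  nlinarith [norm_sq_fun_le P u, sq_nonneg ‖He.fun1 P u‖]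

/-- The first component, as a bounded operator `𝓗_e → L²_e`. -/
def comp1 : He P →L[ℝ] L2e :=
  (H2e.subtype ∘ₗ He.c1 P).mkContinuous _ (norm_fun1_le P)

/-- The second component, as a bounded operator `𝓗_e → L²_e`. -/
def comp2 : He P →L[ℝ] L2e :=
  (H2e.subtype ∘ₗ He.c2 P).mkContinuous _ (norm_fun2_le P)

/-- The operator `u ↦ Δ u₁`, as a bounded operator `𝓗_e → L²_e`. -/
def lap1 : He P →L[ℝ] L2e := (lap ∘ₗ He.c1 P).mkContinuous _ (norm_lap_le P)

theorem norm_lap1_le (u : He P) : ‖lap1 P u‖ ≤ normM1 (lapSymb P) * ‖u‖ := norm_lap_le P u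

theorem germ_mulOp_fun1 (u : He P) (f : L2e) :
    germ (mulOp (He.fun1 P u) f) = germ (comp1 P u) * germ f :=
  germ_mulOp (memLp_top_fun1 P u) f

/-- The bilinear operator `(u, f) ↦ u₁ f`. -/
def mul1 : He P →L[ℝ] L2e →L[ℝ] L2e :=
  LinearMap.mkContinuous₂ (LinearMap.mk₂ ℝ (fun u f => mulOp (He.fun1 P u) f)
    (fun u v f => germ_injective (by
      simp only [germ_mulOp_fun1, germ_add, map_add, add_mul]))
    (fun c u f => germ_injective (by
      simp only [germ_mulOp_fun1, germ_smul, map_smul, mul_assoc]))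
    (fun u f g => map_add _ f g) (fun c u f => map_smul _ c f)) (normM2 (symbInv P))
    (fun u f => norm_mulOp_le (memLp_top_fun1 P u) (ae_abs_fun1_le P u) f)

theorem germ_mulOp_fun2 (u : He P) (f : L2e) :
    germ (mulOp (He.fun2 P u) f) = germ (comp2 P u) * germ f :=
  germ_mulOp (memLp_top_fun2 P u) f

/-- The bilinear operator `(u, f) ↦ u₂ f`. -/
def mul2 : He P →L[ℝ] L2e →L[ℝ] L2e :=
  LinearMap.mkContinuous₂ (LinearMap.mk₂ ℝ (fun u f => mulOp (He.fun2 P u) f)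
    (fun u v f => germ_injective (by
      simp only [germ_mulOp_fun2, germ_add, map_add, add_mul]))
    (fun c u f => germ_injective (by
      simp only [germ_mulOp_fun2, germ_smul, map_smul, mul_assoc]))
    (fun u f g => map_add _ f g) (fun c u f => map_smul _ c f)) (normM2 (symbInv P))
    (fun u f => norm_mulOp_le (memLp_top_fun2 P u) (ae_abs_fun2_le P u) f)

theorem germ_mul1 (u : He P) (f : L2e) : germ (mul1 P u f) = germ (comp1 P u) * germ f :=
  germ_mulOp (memLp_top_fun1 P u) f

theorem germ_mul2 (u : He P) (f : L2e) : germ (mul2 P u f) = germ (comp2 P u) * germ f :=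
  germ_mulOp (memLp_top_fun2 P u) f

theorem norm_mul1_le (u : He P) (f : L2e) : ‖mul1 P u f‖ ≤ normM2 (symbInv P) * ‖u‖ * ‖f‖ :=
  norm_mulOp_le (memLp_top_fun1 P u) (ae_abs_fun1_le P u) f

theorem norm_mul2_le (u : He P) (f : L2e) : ‖mul2 P u f‖ ≤ normM2 (symbInv P) * ‖u‖ * ‖f‖ :=
  norm_mulOp_le (memLp_top_fun2 P u) (ae_abs_fun2_le P u) f

/-! ### Derivatives -/

/-- The derivative of the polynomial `p` at `u`. -/
def polyDeriv (u : He P) : He P →L[ℝ] L2e :=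
  (mul1 P u ∘L (mul1 P u ∘L comp2 P)) + (2 : ℝ) • (mul1 P u ∘L (mul2 P u ∘L comp1 P))
    + (2 * P.nu4) • (mul1 P u ∘L comp1 P) + P.nu5 • (mul1 P u ∘L comp2 P)
    + P.nu5 • (mul2 P u ∘L comp1 P)

/-- The second derivative `D²p(u)(v, w)`. -/
def polyHess (u v w : He P) : L2e :=
  (2 : ℝ) • mul1 P u (mul1 P v (comp2 P w)) + (2 : ℝ) • mul1 P u (mul2 P v (comp1 P w))
    + (2 : ℝ) • mul2 P u (mul1 P v (comp1 P w))
    + (2 * P.nu4) • mul1 P v (comp1 P w) + P.nu5 • mul1 P v (comp2 P w)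
    + P.nu5 • mul2 P v (comp1 P w)

theorem germ_two_const (c : ℝ) : (((2 * c : ℝ)) : Filter.Germ (ae (volume : Measure ℝ)) ℝ)
    = (((2 : ℝ)) : Filter.Germ (ae (volume : Measure ℝ)) ℝ) * (c : ℝ) := rfl

theorem germ_two : (((2 : ℝ)) : Filter.Germ (ae (volume : Measure ℝ)) ℝ) = 2 := rfl

/-- `poly` unfolds to iterated bounded bilinear maps, so the product rule applies; commutativity of
the pointwise product then merges its terms into `polyDeriv`. -/
theorem hasFDerivAt_poly (u : He P) : HasFDerivAt (poly P) (polyDeriv P u) u := by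
  have h1 : HasFDerivAt (fun u => mul1 P u) (mul1 P) u := (mul1 P).hasFDerivAt
  have c1 : HasFDerivAt (fun u => comp1 P u) (comp1 P) u := (comp1 P).hasFDerivAt
  have c2 : HasFDerivAt (fun u => comp2 P u) (comp2 P) u := (comp2 P).hasFDerivAt
  have h := ((h1.clm_apply (h1.clm_apply c2)).add ((h1.clm_apply c1).const_smul P.nu4)).add
    ((h1.clm_apply c2).const_smul P.nu5)
  refine h.congr_fderiv ?_
  ext1 v
  apply germ_injective
  simp only [polyDeriv, add_apply, smul_apply,
    ContinuousLinearMap.comp_apply, ContinuousLinearMap.flip_apply, map_add, germ_add, germ_smul,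
    germ_mul1, germ_mul2, germ_two_const, germ_two]
  ring

theorem hasFDerivAt_clm_comp {E F G : Type*} [NormedAddCommGroup E] [NormedSpace ℝ E]
    [NormedAddCommGroup F] [NormedSpace ℝ F] [NormedAddCommGroup G] [NormedSpace ℝ G]
    (A : F →L[ℝ] G) {f : E → F} {f' : E →L[ℝ] F} {x : E} (hf : HasFDerivAt f f' x) :
    HasFDerivAt (fun y => A (f y)) (A ∘L f') x :=
  A.hasFDerivAt.comp x hf

/-- In the last component of the saddle-node map both the base point `u` and the direction `w` vary,
so the rule is stated along two differentiable functions. Only the values of the derivative matter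
later, hence the existential form. -/
theorem hasFDerivAt_polyDeriv {E : Type*} [NormedAddCommGroup E] [NormedSpace ℝ E]
    {f g : E → He P} {f' g' : E →L[ℝ] He P} {x : E} (hf : HasFDerivAt f f' x)
    (hg : HasFDerivAt g g' x) : ∃ L : E →L[ℝ] L2e,
      HasFDerivAt (fun y => polyDeriv P (f y) (g y)) L x ∧
      ∀ y, L y = polyDeriv P (f x) (g' y) + polyHess P (f x) (f' y) (g x) := by
  have h1 : HasFDerivAt (fun y => mul1 P (f y)) (mul1 P ∘L f') x :=
    hasFDerivAt_clm_comp (G := L2e →L[ℝ] L2e) (mul1 P) hf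
  have h2 : HasFDerivAt (fun y => mul2 P (f y)) (mul2 P ∘L f') x :=
    hasFDerivAt_clm_comp (G := L2e →L[ℝ] L2e) (mul2 P) hf
  have c1 := (comp1 P).hasFDerivAt.comp x hg
  have c2 := (comp2 P).hasFDerivAt.comp x hg
  have h := ((((h1.clm_apply (h1.clm_apply c2)).add
    ((h1.clm_apply (h2.clm_apply c1)).const_smul (2 : ℝ))).add
    ((h1.clm_apply c1).const_smul (2 * P.nu4))).add ((h1.clm_apply c2).const_smul P.nu5)).add
    ((h2.clm_apply c1).const_smul P.nu5)
  refine ⟨_, h, fun y => ?_⟩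
  apply germ_injective
  simp only [polyDeriv, polyHess, add_apply, smul_apply,
    ContinuousLinearMap.comp_apply, ContinuousLinearMap.flip_apply, map_add, germ_add, germ_smul,
    germ_mul1, germ_mul2, germ_two_const, germ_two, Function.comp_apply]
  ring

/-! ### The derivative of the saddle-node map -/

instance t2Space_pair {E : Type*} [NormedAddCommGroup E] : T2Space (Pair E) :=
  TopologicalSpace.t2Space_of_metrizableSpace

instance t2Space_trip {E : Type*} [NormedAddCommGroup E] : T2Space (Trip E) :=
  TopologicalSpace.t2Space_of_metrizableSpace

theorem hasFDerivAt_toLp {E F G : Type*} [NormedAddCommGroup E] [NormedSpace ℝ E]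
    [NormedAddCommGroup F] [NormedSpace ℝ F] [NormedAddCommGroup G] [NormedSpace ℝ G]
    {f : E → F} {g : E → G} {f' : E →L[ℝ] F} {g' : E →L[ℝ] G} {x : E}
    (hf : HasFDerivAt f f' x) (hg : HasFDerivAt g g' x) :
    HasFDerivAt (fun y => WithLp.toLp 2 (f y, g y))
      ((WithLp.prodContinuousLinearEquiv 2 ℝ F G).symm.toContinuousLinearMap ∘L f'.prod g') x :=
  (WithLp.prodContinuousLinearEquiv 2 ℝ F G).symm.toContinuousLinearMap.hasFDerivAt.comp x
    (hf.prodMk hg)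

/-- The isometry `𝕝_ν̄`, as a bounded operator. -/
def oplBar : He P →L[ℝ] Pair L2e := (oplEquiv P).toLinearIsometry.toContinuousLinearMap

/-- The operator `u ↦ (Δ u₁, 0)`. -/
def lapPair : He P →L[ℝ] Pair L2e :=
  (WithLp.prodContinuousLinearEquiv 2 ℝ L2e L2e).symm.toContinuousLinearMap ∘L (lap1 P).prod 0

theorem lapPair_apply (u : He P) : lapPair P u = pair (lap1 P u) 0 := rfl

/-- The norm of `𝓗_e` makes `𝕝_ν̄` an isometry, and the dependence on `ν` is affine with the bounded
coefficient `u ↦ (Δu₁, 0)`. This makes `𝕝_ν u` differentiable jointly in `ν` and `u`. -/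
theorem opl_eq (ν : ℝ) (u : He P) :
    opl P ν u = oplBar P u + (ν - P.nubar) • lapPair P u := by
  change pair (ν • lap1 P u + P.nu1 • comp1 P u + P.nu2 • comp2 P u)
      (P.nu3 • comp1 P u + lap (He.c2 P u) - P.nu2 • comp2 P u) =
    pair (P.nubar • lap1 P u + P.nu1 • comp1 P u + P.nu2 • comp2 P u)
      (P.nu3 • comp1 P u + lap (He.c2 P u) - P.nu2 • comp2 P u)
      + (ν - P.nubar) • pair (lap1 P u) 0
  rw [pair, pair, pair, ← WithLp.toLp_smul, ← WithLp.toLp_add, Prod.smul_mk, Prod.mk_add_mk,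
    smul_zero, add_zero]
  congr 2
  module

/-- The embedding `a ↦ (a, -a)`. -/
def anti : L2e →L[ℝ] Pair L2e := antidiag (ContinuousLinearMap.id ℝ L2e)

theorem anti_apply (a : L2e) : anti a = pair a (-a) := rfl

theorem fmap_eq (ν : ℝ) (u : He P) :
    fmap P ν u = oplBar P u + (ν - P.nubar) • lapPair P u + anti (poly P u) := by
  rw [fmap, opl_eq]; rfl

theorem hasFDerivAt_fmap (ν : ℝ) (u : He P) : HasFDerivAt (fmap P ν)
    (oplBar P + (ν - P.nubar) • lapPair P + anti ∘L polyDeriv P u) u := by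
  have h := (((oplBar P).hasFDerivAt (x := u)).add
    (((lapPair P).hasFDerivAt (x := u)).const_smul (ν - P.nubar))).add
    (anti.hasFDerivAt.comp u (hasFDerivAt_poly P u))
  exact h.congr_of_eventuallyEq (Filter.Eventually.of_forall fun v => fmap_eq P ν v)

theorem fderiv_fmap_apply (ν : ℝ) (u w : He P) : fderiv ℝ (fmap P ν) u w =
    oplBar P w + (ν - P.nubar) • lapPair P w + anti (polyDeriv P u w) := by
  rw [(hasFDerivAt_fmap P ν u).fderiv]; rfl

/-- Projection of `H₁` to the component `ν`. -/
def proj1 : H1 P →L[ℝ] ℝ :=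
  ContinuousLinearMap.fst ℝ ℝ _ ∘L (WithLp.prodContinuousLinearEquiv 2 ℝ ℝ _).toContinuousLinearMap
/-- Projection of `H₁` to the pair `(u, w)`. -/
def projSnd : H1 P →L[ℝ] Pair (He P) :=
  ContinuousLinearMap.snd ℝ ℝ _ ∘L (WithLp.prodContinuousLinearEquiv 2 ℝ ℝ _).toContinuousLinearMap
/-- Projection of `H₁` to the component `u`. -/
def proj2 : H1 P →L[ℝ] He P :=
  ContinuousLinearMap.fst ℝ (He P) (He P) ∘L
    (WithLp.prodContinuousLinearEquiv 2 ℝ _ _).toContinuousLinearMap ∘L projSnd P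
/-- Projection of `H₁` to the component `w`. -/
def proj3 : H1 P →L[ℝ] He P :=
  ContinuousLinearMap.snd ℝ (He P) (He P) ∘L
    (WithLp.prodContinuousLinearEquiv 2 ℝ _ _).toContinuousLinearMap ∘L projSnd P

/-- The saddle-node map is differentiable; formula for its derivative. -/
theorem hasFDerivAt_Fmap (ξ : He P) (α : ℝ) (x : H1 P) : ∃ L : H1 P →L[ℝ] H2,
    HasFDerivAt (Fmap P ξ α) L x ∧ ∀ y : H1 P, L y = WithLp.toLp 2
      (inner ℝ (opl P P.nubar ξ) (pair (comp1 P y.snd.snd) (comp2 P y.snd.snd)),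
        pair (oplBar P y.snd.fst + (x.fst - P.nubar) • lapPair P y.snd.fst
            + y.fst • lapPair P x.snd.fst + anti (polyDeriv P x.snd.fst y.snd.fst))
          (oplBar P y.snd.snd + (x.fst - P.nubar) • lapPair P y.snd.snd
            + y.fst • lapPair P x.snd.snd + anti (polyDeriv P x.snd.fst y.snd.snd
              + polyHess P x.snd.fst y.snd.fst x.snd.snd))) := by
  have p1 := (proj1 P).hasFDerivAt (x := x)
  have p2 := (proj2 P).hasFDerivAt (x := x)
  have p3 := (proj3 P).hasFDerivAt (x := x)
  have hA : HasFDerivAt (fun y : H1 P => inner ℝ (opl P P.nubar ξ)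
      (pair (comp1 P (proj3 P y)) (comp2 P (proj3 P y))) - α) _ x :=
    ((innerSL ℝ (opl P P.nubar ξ)).hasFDerivAt.comp x
      (hasFDerivAt_toLp ((comp1 P).hasFDerivAt.comp x p3)
        ((comp2 P).hasFDerivAt.comp x p3))).sub_const α
  have hB := (((oplBar P).hasFDerivAt.comp x p2).add
    ((p1.sub_const P.nubar).smul ((lapPair P).hasFDerivAt.comp x p2))).add
    (anti.hasFDerivAt.comp x ((hasFDerivAt_poly P _).comp x p2))
  obtain ⟨L, hL, hL'⟩ := hasFDerivAt_polyDeriv P p2 p3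
  have hC := (((oplBar P).hasFDerivAt.comp x p3).add
    ((p1.sub_const P.nubar).smul ((lapPair P).hasFDerivAt.comp x p3))).add
    (anti.hasFDerivAt.comp x hL)
  refine ⟨_, (hasFDerivAt_toLp hA (hasFDerivAt_toLp hB hC)).congr_of_eventuallyEq
    (Filter.Eventually.of_forall fun y => ?_), fun y => ?_⟩
  · change WithLp.toLp 2 (inner ℝ (opl P P.nubar ξ)
      (pair (comp1 P (proj3 P y)) (comp2 P (proj3 P y))) - α, _) = _
    -- The saddle-node map itself contains a Fréchet derivative, which must first be replaced by its
    -- closed formula.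
    rw [fmap_eq, fderiv_fmap_apply]
    rfl
  · change WithLp.toLp 2 (inner ℝ (opl P P.nubar ξ)
        (pair (comp1 P (proj3 P y)) (comp2 P (proj3 P y))),
      pair (oplBar P (proj2 P y) + ((proj1 P x - P.nubar) • lapPair P (proj2 P y)
          + proj1 P y • lapPair P (proj2 P x)) + anti (polyDeriv P (proj2 P x) (proj2 P y)))
        (oplBar P (proj3 P y) + ((proj1 P x - P.nubar) • lapPair P (proj3 P y)
          + proj1 P y • lapPair P (proj3 P x)) + anti (L y))) = _
    rw [hL', ← add_assoc, ← add_assoc]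
    rfl

end

/-! ### Exact expansion of the difference of two derivatives -/

section

variable (P : Params)

/-- The trilinear form `D³p(u, v, w)`. -/
def polyThird (u v w : He P) : L2e :=
  (2 : ℝ) • mul1 P u (mul1 P v (comp2 P w)) + (2 : ℝ) • mul1 P u (mul2 P v (comp1 P w))
    + (2 : ℝ) • mul2 P u (mul1 P v (comp1 P w))

/-- The term `D³p(h, h, v) / 2`. -/
def polyCub (h v : He P) : L2e :=
  mul1 P h (mul1 P h (comp2 P v)) + (2 : ℝ) • mul1 P h (mul2 P h (comp1 P v))

/-- Taylor's formula for a cubic polynomial: it stops at the term quadratic in `h`, with no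
remainder. -/
theorem polyDeriv_add_sub (u h v : He P) :
    polyDeriv P (u + h) v - polyDeriv P u v = polyHess P u h v + polyCub P h v := by
  apply germ_injective
  simp only [polyDeriv, polyHess, polyCub, add_apply, smul_apply, ContinuousLinearMap.comp_apply,
    map_add, germ_add, germ_sub, germ_smul, germ_mul1, germ_mul2, germ_two_const, germ_two]
  ring

/-- The third derivative is constant. Its value is split between `w` and `k` because the first is
linear in the increments and is handled through `q₃`, `q₄`, whereas the second is quadratic. -/
theorem polyHess_add_sub (u h v w k : He P) :
    polyHess P (u + h) v (w + k) - polyHess P u v w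
      = polyHess P u k v + polyThird P h v w + polyThird P h v k := by
  apply germ_injective
  simp only [polyHess, polyThird, add_apply, map_add, germ_add, germ_sub, germ_smul, germ_mul1,
    germ_mul2, germ_two_const, germ_two]
  ring

theorem trip_add {E : Type*} [NormedAddCommGroup E] (a b : ℝ) (u v w z : E) :
    trip a u w + trip b v z = trip (a + b) (u + v) (w + z) := rfl

theorem trip_sub {E : Type*} [NormedAddCommGroup E] (a b : ℝ) (u v w z : E) :
    trip a u w - trip b v z = trip (a - b) (u - v) (w - z) := rfl

/-- The difference of two derivatives of the saddle-node map, split into the part with a second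
derivative in space, the part that is linear in the increment and the remainder. -/
theorem fderiv_Fmap_sub (ξ : He P) (α : ℝ) (x h y : H1 P) (hx : x.fst = P.nubar) :
    (fderiv ℝ (Fmap P ξ α) (x + h) - fderiv ℝ (Fmap P ξ α) x) y =
      trip 0 (pair (h.fst • lap1 P y.snd.fst + y.fst • lap1 P h.snd.fst) 0)
        (pair (h.fst • lap1 P y.snd.snd + y.fst • lap1 P h.snd.snd) 0)
      + trip 0 (anti (polyHess P x.snd.fst h.snd.fst y.snd.fst))
        (anti (polyHess P x.snd.fst h.snd.fst y.snd.snd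
          + polyHess P x.snd.fst h.snd.snd y.snd.fst
          + polyThird P h.snd.fst y.snd.fst x.snd.snd))
      + trip 0 (anti (polyCub P h.snd.fst y.snd.fst))
        (anti (polyCub P h.snd.fst y.snd.snd
          + polyThird P h.snd.fst y.snd.fst h.snd.snd)) := by
  obtain ⟨L, hL, hL'⟩ := hasFDerivAt_Fmap P ξ α (x + h)
  obtain ⟨K, hK, hK'⟩ := hasFDerivAt_Fmap P ξ α x
  rw [hL.fderiv, hK.fderiv, sub_apply, hL', hK']
  have e1 := polyDeriv_add_sub P x.snd.fst h.snd.fst y.snd.fst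
  have e2 := polyDeriv_add_sub P x.snd.fst h.snd.fst y.snd.snd
  have e3 := polyHess_add_sub P x.snd.fst h.snd.fst y.snd.fst x.snd.snd h.snd.snd
  have f1 : (x + h).fst = P.nubar + h.fst := by rw [WithLp.add_fst, hx]
  have f2 : (x + h).snd.fst = x.snd.fst + h.snd.fst := rfl
  have f3 : (x + h).snd.snd = x.snd.snd + h.snd.snd := rfl
  -- The factor `ν - ν̄` is 0 at `x` and `h.fst` at `x + h`. The derivative of the first component
  -- does not depend on the base point and cancels.
  rw [f1, f2, f3, hx, eq_add_of_sub_eq e1, eq_add_of_sub_eq e2, eq_add_of_sub_eq e3]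
  rw [trip_sub, trip_add, trip_add, sub_self, add_zero, add_zero]
  have k2 : ∀ u v : He P, ∀ a b : ℝ, pair (a • lap1 P u + b • lap1 P v) 0
      = a • lapPair P u + b • lapPair P v := by
    intro u v a b
    rw [lapPair_apply, lapPair_apply, pair, pair, pair, ← WithLp.toLp_smul, ← WithLp.toLp_smul,
      ← WithLp.toLp_add, Prod.smul_mk, Prod.smul_mk, Prod.mk_add_mk, smul_zero, smul_zero, add_zero]
  rw [k2, k2]
  refine congrArg (WithLp.toLp 2) (Prod.ext rfl (congrArg (WithLp.toLp 2) (Prod.ext ?_ ?_)))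
  · simp only [map_add]
    module
  · simp only [map_add]
    module

/-! ### Norms of block vectors -/

theorem fst_toLp {E F : Type*} (a : E) (b : F) : (WithLp.toLp 2 (a, b)).fst = a := rfl

theorem snd_toLp {E F : Type*} (a : E) (b : F) : (WithLp.toLp 2 (a, b)).snd = b := rfl

theorem norm_sq_trip {E : Type*} [NormedAddCommGroup E] (x : Trip E) :
    ‖x‖ ^ 2 = x.fst ^ 2 + ‖x.snd.fst‖ ^ 2 + ‖x.snd.snd‖ ^ 2 := by
  rw [WithLp.prod_norm_sq_eq_of_L2, norm_sq_pair, Real.norm_eq_abs, sq_abs, add_assoc]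

theorem inner_pair {E : Type*} [NormedAddCommGroup E] [InnerProductSpace ℝ E] (x y : Pair E) :
    inner ℝ x y = inner ℝ x.fst y.fst + inner ℝ x.snd y.snd := WithLp.prod_inner_apply x y

theorem inner_trip {E : Type*} [NormedAddCommGroup E] [InnerProductSpace ℝ E] (x y : Trip E) :
    inner ℝ x y = x.fst * y.fst + inner ℝ x.snd.fst y.snd.fst + inner ℝ x.snd.snd y.snd.snd := by
  have h : inner ℝ x y = inner ℝ x.fst y.fst + inner ℝ x.snd y.snd := WithLp.prod_inner_apply x y
  rw [h, inner_pair, add_assoc, real_inner_eq_re_inner]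
  simp [mul_comm]

theorem diag2_apply {E F : Type*} [NormedAddCommGroup E] [NormedSpace ℝ E]
    [NormedAddCommGroup F] [NormedSpace ℝ F] (A : E →L[ℝ] F) (x : Pair E) :
    diag2 A x = pair (A x.fst) (A x.snd) := by
  change pair (A x.fst + 0) (0 + A x.snd) = _
  rw [add_zero, zero_add]

/-! ### The part of a function outside of `Ω₀` -/

theorem mulOut_ae (f : L2e) :
    (mulOut P f : L2) =ᵐ[volume] (Omega0 P)ᶜ.indicator (f : L2) := by
  refine (mulBdd_ae _ _ _ f).trans (Filter.Eventually.of_forall fun x => ?_)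
  by_cases h : x ∈ (Omega0 P)ᶜ
  · simp only [Set.indicator_of_mem h, one_mul]
  · simp only [Set.indicator_of_notMem h, zero_mul]

theorem inner_mulOut (f g : L2e) : inner ℝ (mulOut P f) g = inner ℝ f (mulOut P g) := by
  rw [inner_L2e, inner_L2e]
  apply integral_congr_ae
  filter_upwards [mulOut_ae P f, mulOut_ae P g] with x h1 h2
  rw [h1, h2]
  by_cases h : x ∈ (Omega0 P)ᶜ
  · simp only [Set.indicator_of_mem h]
  · simp only [Set.indicator_of_notMem h, zero_mul, mul_zero]

theorem mulOut_mulOut (f : L2e) : mulOut P (mulOut P f) = mulOut P f := by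
  apply Subtype.ext
  apply Lp.ext
  filter_upwards [mulOut_ae P f, mulOut_ae P (mulOut P f)] with x h1 h2
  rw [h2]
  by_cases h : x ∈ (Omega0 P)ᶜ
  · rw [Set.indicator_of_mem h]
  · rw [h1, Set.indicator_of_notMem h, Set.indicator_of_notMem h]

theorem gamVol_mulOut (f : L2e) : gamVol P (mulOut P f) = 0 := by
  ext n
  rw [coef_gamVol]
  have h : ∫ x in Omega0 P, (mulOut P f : L2) x * Real.cos (2 * Real.pi * (n / (2 * P.d)) * x)
      = ∫ x in Omega0 P, (0 : ℝ) := by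
    apply setIntegral_congr_ae (measurableSet_Omega0 P)
    filter_upwards [mulOut_ae P f] with x h1 hx
    rw [h1, Set.indicator_of_notMem (Set.notMem_compl_iff.2 hx), zero_mul]
  rw [h]
  simp [coef]

theorem inner_gamDagVol (U : Ell (vol P)) (f : L2e) :
    inner ℝ (gamDagVol P U) f = inner ℝ U (gamVol P f) :=
  (ContinuousLinearMap.adjoint_inner_right (gamDagVol P).toContinuousLinearMap U f).symm

theorem mulOut_gamDagVol (U : Ell (vol P)) : mulOut P (gamDagVol P U) = 0 := by
  apply ext_inner_right ℝ
  intro f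
  rw [inner_mulOut, inner_gamDagVol, gamVol_mulOut, inner_zero_right, inner_zero_left]

theorem norm_gamVol_le (f : L2e) : ‖gamVol P f‖ ≤ ‖f‖ := by
  refine (ContinuousLinearMap.le_of_opNorm_le _ (c := 1) ?_ f).trans_eq (one_mul _)
  rw [gamVol, LinearIsometryEquiv.norm_map]
  exact (gamDagVol P).norm_toContinuousLinearMap_le

/-- Since `γ` ignores the part outside `Ω₀` and is a contraction, being the adjoint of an isometry,
this is Pythagoras. The inequality suffices, so completeness of the cosines is not needed. -/
theorem norm_sq_out_add_in_le (f : L2e) : ‖mulOut P f‖ ^ 2 + ‖gamVol P f‖ ^ 2 ≤ ‖f‖ ^ 2 := by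
  have h1 : gamVol P f = gamVol P (f - mulOut P f) := by rw [map_sub, gamVol_mulOut, sub_zero]
  have h2 := pow_le_pow_left₀ (norm_nonneg _) (norm_gamVol_le P (f - mulOut P f)) 2
  have h3 : inner ℝ f (mulOut P f) = ‖mulOut P f‖ ^ 2 := by
    rw [← real_inner_self_eq_norm_sq, ← mulOut_mulOut, ← inner_mulOut, mulOut_mulOut]
  rw [← h1, norm_sub_sq_real, h3] at h2
  linarith

theorem norm_sq_mulOut_add (f : L2e) (U : Ell (vol P)) :
    ‖mulOut P f + gamDagVol P U‖ ^ 2 = ‖mulOut P f‖ ^ 2 + ‖U‖ ^ 2 := by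
  rw [norm_add_sq_real, real_inner_comm, inner_gamDagVol, gamVol_mulOut, inner_zero_right,
    LinearIsometry.norm_map]
  ring

/-- The range of `γ†` is orthogonal to the functions living outside `Ω₀`, so the two parts add; `γ†`
is isometric for the weight `|Ω₀|`, so the inner part is measured in `X₂`. -/
theorem norm_sq_BBop (N : ℕ) (BN : X2 P →L[ℝ] X2 P) (y : H2) : ‖BBop P N BN y‖ ^ 2 =
    ‖mulOut P y.snd.fst.fst‖ ^ 2 + ‖mulOut P y.snd.fst.snd‖ ^ 2
      + ‖mulOut P y.snd.snd.fst‖ ^ 2 + ‖mulOut P y.snd.snd.snd‖ ^ 2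
      + ‖Bop P N BN (gamBar P y)‖ ^ 2 := by
  set z := Bop P N BN (gamBar P y) with hz
  have e : BBop P N BN y = trip z.fst
      (pair (mulOut P y.snd.fst.fst + gamDagVol P z.snd.fst.fst)
        (mulOut P y.snd.fst.snd + gamDagVol P z.snd.fst.snd))
      (pair (mulOut P y.snd.snd.fst + gamDagVol P z.snd.snd.fst)
        (mulOut P y.snd.snd.snd + gamDagVol P z.snd.snd.snd)) := by
    change diag3 0 (diag2 (mulOut P)) y
      + diag3 1 (diag2 (gamDagVol P).toContinuousLinearMap) z = _
    rw [diag3_apply, diag3_apply, ← WithLp.toLp_add, Prod.mk_add_mk, zero_mul, zero_add, one_mul,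
      diag2_apply, diag2_apply, diag2_apply, diag2_apply]
    rfl
  rw [e, norm_sq_trip z, norm_sq_trip, norm_sq_pair, norm_sq_pair, norm_sq_pair, norm_sq_pair]
  simp only [fst_toLp, snd_toLp, norm_sq_mulOut_add]
  ring

theorem gamBar_apply (y : H2) : gamBar P y = trip y.fst
    (pair (gamVol P y.snd.fst.fst) (gamVol P y.snd.fst.snd))
    (pair (gamVol P y.snd.snd.fst) (gamVol P y.snd.snd.snd)) := by
  rw [gamBar, diag3_apply, one_mul, diag2_apply, diag2_apply]

/-- The inverse of `𝕝_ν̄` is an isometry by the choice of the norm of `𝓗_e`. -/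
theorem norm_AAop (N : ℕ) (BN : X2 P →L[ℝ] X2 P) (y : H2) :
    ‖AAop P N BN y‖ = ‖BBop P N BN y‖ := by
  have e : AAop P N BN y = trip (1 * (BBop P N BN y).fst)
      ((oplEquiv P).symm (BBop P N BN y).snd.fst) ((oplEquiv P).symm (BBop P N BN y).snd.snd) :=
    diag3_apply _ _ _
  have h : ‖AAop P N BN y‖ ^ 2 = ‖BBop P N BN y‖ ^ 2 := by
    rw [e, norm_sq_trip, norm_sq_trip]
    simp only [fst_toLp, snd_toLp, LinearIsometryEquiv.norm_map, one_mul]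
  exact (pow_left_inj₀ (norm_nonneg _) (norm_nonneg _) two_ne_zero).1 h

/-! ### Truncations -/

theorem projLe_add_projGt (c : PosReal) (N : ℕ) (U : Ell c) : projLe c N U + projGt c N U = U := by
  ext n
  rw [coef_add, projLe, projGt, coef_cut, coef_cut]
  by_cases h : n ≤ N
  · rw [Set.indicator_of_mem (show n ∈ {n | n ≤ N} from h),
      Set.indicator_of_notMem (show n ∉ {n | N < n} from not_lt.2 h), add_zero]
  · rw [Set.indicator_of_notMem (show n ∉ {n | n ≤ N} from h),
      Set.indicator_of_mem (show n ∈ {n | N < n} from not_le.1 h), zero_add]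

theorem inner_cut (c : PosReal) (S : Set ℕ) (U V : Ell c) :
    inner ℝ (cut c c S U) V = inner ℝ U (cut c c S V) := by
  rw [Ell.inner_eq, Ell.inner_eq]
  refine tsum_congr fun n => ?_
  rw [coef_cut, coef_cut]
  by_cases h : n ∈ S
  · rw [Set.indicator_of_mem h, Set.indicator_of_mem h]
  · rw [Set.indicator_of_notMem h, Set.indicator_of_notMem h, mul_zero, mul_zero, zero_mul]

theorem cut_cut (a b c : PosReal) (S T : Set ℕ) (U : Ell a) :
    cut b c T (cut a b S U) = cut a c (T ∩ S) U := by
  ext n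
  rw [coef_cut, coef_cut]
  by_cases h1 : n ∈ S <;> by_cases h2 : n ∈ T <;>
    simp [coef_cut, h1, h2]

theorem cut_empty (a b : PosReal) (U : Ell a) : cut a b ∅ U = 0 := by
  ext n
  rw [coef_cut, Set.indicator_empty]
  simp [coef]

theorem projGt_projLe (c : PosReal) (N : ℕ) (U : Ell c) : projGt c N (projLe c N U) = 0 := by
  rw [projGt, projLe, cut_cut]
  convert cut_empty c c U using 2
  congr 1
  ext n
  simp

theorem projLe_projLe (c : PosReal) (N : ℕ) (U : Ell c) :
    projLe c N (projLe c N U) = projLe c N U := by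
  rw [projLe, cut_cut, Set.inter_self]

theorem projGt_projGt (c : PosReal) (N : ℕ) (U : Ell c) :
    projGt c N (projGt c N U) = projGt c N U := by
  rw [projGt, cut_cut, Set.inter_self]

theorem reweight_projGt (a b : PosReal) (N : ℕ) (U : Ell a) :
    reweight a b (projGt a N U) = projGt b N (reweight a b U) := by
  rw [reweight, projGt, projGt, cut_cut, cut_cut, Set.univ_inter, Set.inter_univ]

theorem reweight_reweight (a b c : PosReal) (U : Ell a) :
    reweight b c (reweight a b U) = reweight a c U := by
  rw [reweight, reweight, cut_cut, Set.univ_inter, reweight]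

theorem reweight_self (a : PosReal) (U : Ell a) : reweight a a U = U := by
  ext n
  rw [reweight, coef_cut, Set.indicator_univ]

theorem norm_sq_reweight (a b : PosReal) (U : Ell a) :
    ‖reweight a b U‖ ^ 2 = b * (a : ℝ)⁻¹ * ‖U‖ ^ 2 := by
  rw [mul_assoc, ← Ell.tsum_eq, ← (Ell.norm_sq _).tsum_eq, ← tsum_mul_left]
  refine tsum_congr fun n => ?_
  rw [reweight, coef_cut, Set.indicator_univ, mul_assoc]

theorem projBarLe_apply (N : ℕ) (x : X2 P) : projBarLe P N x = trip x.fst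
    (pair (projLe _ N x.snd.fst.fst) (projLe _ N x.snd.fst.snd))
    (pair (projLe _ N x.snd.snd.fst) (projLe _ N x.snd.snd.snd)) := by
  rw [projBarLe, diag3_apply, one_mul, diag2_apply, diag2_apply]

theorem projBarGt_apply (N : ℕ) (x : X2 P) : projBarGt P N x = trip 0
    (pair (projGt _ N x.snd.fst.fst) (projGt _ N x.snd.fst.snd))
    (pair (projGt _ N x.snd.snd.fst) (projGt _ N x.snd.snd.snd)) := by
  rw [projBarGt, diag3_apply, zero_mul, diag2_apply, diag2_apply]

theorem projBarLe_add_projBarGt (N : ℕ) (x : X2 P) : projBarLe P N x + projBarGt P N x = x := by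
  rw [projBarLe_apply, projBarGt_apply, ← WithLp.toLp_add, Prod.mk_add_mk, ← WithLp.toLp_add,
    Prod.mk_add_mk, ← WithLp.toLp_add, ← WithLp.toLp_add, Prod.mk_add_mk, Prod.mk_add_mk,
    add_zero]
  simp only [projLe_add_projGt]
  rfl

theorem inner_projBarGt (N : ℕ) (x y : X2 P) :
    inner ℝ (projBarGt P N x) y = inner ℝ x (projBarGt P N y) := by
  rw [projBarGt_apply, projBarGt_apply]
  simp only [inner_trip, inner_pair, fst_toLp, snd_toLp, projGt, inner_cut, zero_mul, mul_zero]

theorem projBarGt_projBarLe (N : ℕ) (x : X2 P) : projBarGt P N (projBarLe P N x) = 0 := by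
  rw [projBarLe_apply, projBarGt_apply]
  simp only [fst_toLp, snd_toLp, projGt_projLe]
  rfl

theorem projBarLe_projBarGt (N : ℕ) (x : X2 P) : projBarLe P N (projBarGt P N x) = 0 := by
  have h := projBarLe_add_projBarGt P N (projBarGt P N x)
  have h2 : projBarGt P N (projBarGt P N x) = projBarGt P N x := by
    rw [projBarGt_apply, projBarGt_apply]
    simp only [fst_toLp, snd_toLp, projGt_projGt]
  rwa [h2, add_eq_right] at h

theorem norm_sq_projBar (N : ℕ) (x y : X2 P) :
    ‖projBarLe P N x + projBarGt P N y‖ ^ 2 = ‖projBarLe P N x‖ ^ 2 + ‖projBarGt P N y‖ ^ 2 := by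
  rw [norm_add_sq_real, real_inner_comm, inner_projBarGt, projBarGt_projBarLe, inner_zero_right]
  ring

end

section

variable (P : Params)

theorem projBarLe_projBarLe (N : ℕ) (x : X2 P) :
    projBarLe P N (projBarLe P N x) = projBarLe P N x := by
  rw [projBarLe_apply, projBarLe_apply]
  simp only [fst_toLp, snd_toLp, projLe_projLe]

theorem inner_projBarLe (N : ℕ) (x y : X2 P) :
    inner ℝ (projBarLe P N x) y = inner ℝ x (projBarLe P N y) := by
  rw [projBarLe_apply, projBarLe_apply]
  simp only [inner_trip, inner_pair, fst_toLp, snd_toLp, projLe, inner_cut]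

theorem norm_sq_projBarLe_add (N : ℕ) (x : X2 P) :
    ‖projBarLe P N x‖ ^ 2 + ‖projBarGt P N x‖ ^ 2 = ‖x‖ ^ 2 := by
  rw [← norm_sq_projBar, projBarLe_add_projBarGt]

theorem inner_diag2_projGt (N : ℕ) (u v : Ell2e) :
    inner ℝ (diag2 (projGt 1 N) u) v = inner ℝ u (diag2 (projGt 1 N) v) := by
  rw [diag2_apply, diag2_apply, inner_pair, inner_pair]
  simp only [fst_toLp, snd_toLp, projGt, inner_cut]

theorem diag2_projGt_idem (N : ℕ) (u : Ell2e) :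
    diag2 (projGt 1 N) (diag2 (projGt 1 N) u) = diag2 (projGt 1 N) u := by
  rw [diag2_apply, diag2_apply]
  simp only [fst_toLp, snd_toLp, projGt_projGt]

/-! ### The operators `B` and `M₁` on low and high modes -/

section Bounds

variable {P} {N : ℕ} {BN : X2 P →L[ℝ] X2 P}
  (hBN : BN = projBarLe P N ∘L BN ∘L projBarLe P N)
include hBN

theorem BN_eq_left (x : X2 P) : projBarLe P N (BN x) = BN x := by
  rw [hBN]
  simp only [ContinuousLinearMap.comp_apply, projBarLe_projBarLe]

theorem BN_eq_right (x : X2 P) : BN (projBarLe P N x) = BN x := by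
  rw [hBN]
  simp only [ContinuousLinearMap.comp_apply, projBarLe_projBarLe]

/-- The values of `B^N` lie in the range of `Π̄^{≤ N}`, orthogonal to that of `Π̄^{> N}`. -/
theorem norm_sq_Bop (x : X2 P) :
    ‖Bop P N BN x‖ ^ 2 = ‖BN x‖ ^ 2 + ‖projBarGt P N x‖ ^ 2 := by
  have h := norm_sq_projBar P N (BN x) x
  rw [BN_eq_left hBN] at h
  rw [← h, add_comm (BN x)]
  rfl

/-- Bound for `𝔹` on vectors with zero third and fifth component. -/
theorem norm_sq_BBop_first_le (a b : L2e) : ‖BBop P N BN (trip 0 (pair a 0) (pair b 0))‖ ^ 2 ≤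
    max 1 ‖BN24 P BN‖ ^ 2 * (‖a‖ ^ 2 + ‖b‖ ^ 2) := by
  set C := max 1 ‖BN24 P BN‖
  have hC1 : 1 ≤ C ^ 2 := one_le_pow₀ (le_max_left _ _)
  have hC2 : ‖BN24 P BN‖ ^ 2 ≤ C ^ 2 := pow_le_pow_left₀ (norm_nonneg _) (le_max_right _ _) 2
  rw [norm_sq_BBop, gamBar_apply]
  simp only [fst_toLp, snd_toLp, map_zero, norm_zero]
  set g : X2 P := trip 0 (pair (gamVol P a) 0) (pair (gamVol P b) 0) with hg
  have hg2 : ‖g‖ ^ 2 = ‖gamVol P a‖ ^ 2 + ‖gamVol P b‖ ^ 2 := by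
    rw [hg, norm_sq_trip, norm_sq_pair, norm_sq_pair]
    simp only [fst_toLp, snd_toLp, norm_zero]
    ring
  -- `B^N` sees only low modes, and `g` has no components 3 and 5 and no `ν`. Keeping `Π̄^{≤ N}` in
  -- the argument makes the bounds for low and high modes combine to a maximum rather than a sum.
  have h24 : BN g = BN24 P BN (projBarLe P N g) := by
    rw [← BN_eq_right hBN g]
    change _ = BN (diag3 0 (blk (ContinuousLinearMap.id ℝ (Ell (vol P))) 0 0 0) (projBarLe P N g))
    rw [diag3_apply, hg, projBarLe_apply, blk_apply, blk_apply]
    simp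
  have h1 : ‖BN g‖ ^ 2 ≤ C ^ 2 * ‖projBarLe P N g‖ ^ 2 := by
    rw [h24]
    refine (pow_le_pow_left₀ (norm_nonneg _) ((BN24 P BN).le_opNorm _) 2).trans ?_
    rw [mul_pow]
    gcongr
  have h2 := norm_sq_projBarLe_add P N g
  have h3 := norm_sq_out_add_in_le P a
  have h4 := norm_sq_out_add_in_le P b
  rw [norm_sq_Bop hBN]
  nlinarith [sq_nonneg ‖projBarGt P N g‖, sq_nonneg ‖mulOut P a‖, sq_nonneg ‖mulOut P b‖]

omit hBN

theorem reweight_gam (a : L2e) : reweight 1 (vol P) (gam P a) = gamVol P a := by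
  change reweight 1 (vol P) (reweight (vol P) 1 (gamVol P a)) = _
  rw [reweight_reweight, reweight_self]

theorem coe_vol : ((vol P : PosReal) : ℝ) = 2 * P.d := rfl

theorem norm_sq_gam (a : L2e) : 2 * P.d * ‖gam P a‖ ^ 2 = ‖gamVol P a‖ ^ 2 := by
  have h := norm_sq_reweight 1 (vol P) (gam P a)
  rw [reweight_gam, coe_vol] at h
  simpa using h.symm

/-- The operator `(a, b) ↦ (0, a, -a, b, -b)` on sequences. -/
def antiSeq (P : Params) : Ell2e →L[ℝ] X2 P := embed (antidiag (reweight 1 (vol P)))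

theorem antiSeq_apply (y : Ell2e) : antiSeq P y = trip 0
    (pair (reweight 1 (vol P) y.fst) (-reweight 1 (vol P) y.fst))
    (pair (reweight 1 (vol P) y.snd) (-reweight 1 (vol P) y.snd)) := by
  rw [antiSeq, embed_apply, antidiag_apply, antidiag_apply]

/-- The constant is `2 |Ω₀|`: every entry occurs twice, and the weight changes from 1 to `|Ω₀| =
2d`. -/
theorem norm_sq_antiSeq (y : Ell2e) : ‖antiSeq P y‖ ^ 2 = 4 * P.d * ‖y‖ ^ 2 := by
  rw [antiSeq_apply, norm_sq_trip, norm_sq_pair, norm_sq_pair, norm_sq_pair]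
  simp only [fst_toLp, snd_toLp, norm_neg, norm_sq_reweight, coe_vol]
  simp
  ring

theorem projBarGt_antiSeq (y : Ell2e) :
    projBarGt P N (antiSeq P y) = antiSeq P (diag2 (projGt 1 N) y) := by
  rw [antiSeq_apply, antiSeq_apply, projBarGt_apply, diag2_apply]
  simp only [fst_toLp, snd_toLp, map_neg, reweight_projGt]

theorem Mone_apply (y : Ell2e) :
    Mone P N BN y = projBarGt P N (antiSeq P y) + BN (antiSeq P y) := rfl

/-- Outside `Ω₀` the operator is the identity and each function occurs twice up to sign; inside, `B`
on such vectors is `M₁` by definition. -/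
theorem norm_sq_BBop_anti (a b : L2e) : ‖BBop P N BN (trip 0 (anti a) (anti b))‖ ^ 2 =
    2 * (‖mulOut P a‖ ^ 2 + ‖mulOut P b‖ ^ 2)
      + ‖Mone P N BN (pair (gam P a) (gam P b))‖ ^ 2 := by
  have e : Mone P N BN (pair (gam P a) (gam P b))
      = Bop P N BN (gamBar P (trip 0 (anti a) (anti b))) := by
    change Bop P N BN (antiSeq P (pair (gam P a) (gam P b))) = _
    rw [antiSeq_apply, gamBar_apply]
    simp only [fst_toLp, snd_toLp, reweight_gam, anti_apply, map_neg]
  rw [e, norm_sq_BBop]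
  simp only [anti_apply, fst_toLp, snd_toLp, map_neg, norm_neg]
  ring

include hBN

/-- On the single mode `N + 1`, the first one that `B^N` ignores, `M₁` reduces to `antiSeq`, which
multiplies squared norms by `4d`. -/
theorem four_mul_d_le_norm_sq_Mone : 4 * P.d ≤ ‖Mone P N BN‖ ^ 2 := by
  have hs : Summable fun n => (wt n : ℝ) * (if n = N + 1 then (1 : ℝ) else 0) ^ 2 :=
    summable_of_ne_finset_zero (s := {N + 1}) fun n hn => by
      rw [if_neg (by simpa using hn)]; simp
  set u : Ell 1 := Ell.mk 1 _ hs with hu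
  have hu1 : projGt 1 N u = u := by
    ext n
    rw [projGt, coef_cut]
    by_cases h : n ∈ {n | N < n}
    · rw [Set.indicator_of_mem h]
    · rw [Set.indicator_of_notMem h, hu, Ell.coef_mk, if_neg]
      rintro rfl
      exact h (by simp)
  have hu0 : u ≠ 0 := by
    intro h
    have h1 := Ell.coef_mk 1 _ hs (N + 1)
    rw [← hu, h, if_pos rfl] at h1
    simp [coef] at h1
  set y : Ell2e := pair u 0 with hy
  have hy1 : diag2 (projGt 1 N) y = y := by
    rw [diag2_apply, hy]; simp only [fst_toLp, snd_toLp, hu1, map_zero]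
  have h1 : projBarGt P N (antiSeq P y) = antiSeq P y := by rw [projBarGt_antiSeq, hy1]
  have h2 : BN (antiSeq P y) = 0 := by
    rw [← BN_eq_right hBN, ← h1, projBarLe_projBarGt, map_zero]
  have h3 : Mone P N BN y = antiSeq P y := by rw [Mone_apply, h1, h2, add_zero]
  have h4 := pow_le_pow_left₀ (norm_nonneg _) ((Mone P N BN).le_opNorm y) 2
  rw [h3, norm_sq_antiSeq, mul_pow] at h4
  refine le_of_mul_le_mul_right h4 ?_
  rw [norm_sq_pair, hy]
  have := norm_pos_iff.2 hu0
  simp only [fst_toLp, snd_toLp]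
  positivity

/-- Outside `Ω₀` the factor 2 is absorbed by `‖M₁‖² ≥ 4d`; inside, `d ≥ 1` lets the unweighted norm
of the coefficients be replaced by the weighted one. -/
theorem norm_sq_BBop_anti_le (a b : L2e) : ‖BBop P N BN (trip 0 (anti a) (anti b))‖ ^ 2 ≤
    ‖Mone P N BN‖ ^ 2 * (‖a‖ ^ 2 + ‖b‖ ^ 2) := by
  have hd := P.one_le_d
  have h0 := four_mul_d_le_norm_sq_Mone hBN
  have h1 := pow_le_pow_left₀ (norm_nonneg _)
    ((Mone P N BN).le_opNorm (pair (gam P a) (gam P b))) 2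
  rw [mul_pow, norm_sq_pair] at h1
  simp only [fst_toLp, snd_toLp] at h1
  have ha := norm_sq_out_add_in_le P a
  have hb := norm_sq_out_add_in_le P b
  rw [← norm_sq_gam] at ha hb
  rw [norm_sq_BBop_anti]
  set m := ‖Mone P N BN‖ ^ 2
  have k1 : ‖gam P a‖ ^ 2 ≤ 2 * P.d * ‖gam P a‖ ^ 2 := by nlinarith [sq_nonneg ‖gam P a‖]
  have k2 : ‖gam P b‖ ^ 2 ≤ 2 * P.d * ‖gam P b‖ ^ 2 := by nlinarith [sq_nonneg ‖gam P b‖]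
  have hm : 2 ≤ m := by linarith
  nlinarith [sq_nonneg ‖mulOut P a‖, sq_nonneg ‖mulOut P b‖,
    mul_le_mul_of_nonneg_left (add_le_add (add_le_add_left k1 (‖mulOut P a‖ ^ 2))
      (add_le_add_left k2 (‖mulOut P b‖ ^ 2))) (by linarith : 0 ≤ m)]

/-- On the range of `Π̄^{> N}` the adjoint of `M₁` is the adjoint of `(a, b) ↦ (0, a, -a, b, -b)`. -/
theorem inner_adjoint_Mone_projBarGt (x : X2 P) (y : Ell2e) :
    inner ℝ ((Mone P N BN).adjoint (projBarGt P N x)) y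
      = inner ℝ (projBarGt P N x) (antiSeq P (diag2 (projGt 1 N) y)) := by
  rw [ContinuousLinearMap.adjoint_inner_left, Mone_apply, inner_add_right,
    ← BN_eq_left hBN (antiSeq P y), inner_projBarGt P N x (projBarLe P N _),
    projBarGt_projBarLe, inner_zero_right, add_zero, projBarGt_antiSeq]

/-- Against high modes `B^N` drops out of `M₁`. So with `w` the vector on the left, `‖w‖²` is at
most `‖Π̄^{> N} x‖ ‖antiSeq w‖`, and `antiSeq` scales norms by `√(4d)`; it remains to divide by
`‖w‖`. -/
theorem norm_sq_adjoint_Mone_projBarGt_le (x : X2 P) :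
    ‖(Mone P N BN).adjoint (projBarGt P N x)‖ ^ 2 ≤ 4 * P.d * ‖projBarGt P N x‖ ^ 2 := by
  have hd := P.one_le_d
  set w := (Mone P N BN).adjoint (projBarGt P N x) with hw
  have h1 : ‖w‖ ^ 2 ≤ ‖projBarGt P N x‖ * ‖antiSeq P w‖ := by
    rw [← real_inner_self_eq_norm_sq]
    conv_lhs => arg 2; rw [hw]
    rw [ContinuousLinearMap.adjoint_inner_left, Mone_apply, inner_add_right,
      ← BN_eq_left hBN (antiSeq P w), inner_projBarGt P N x (projBarLe P N _),
      projBarGt_projBarLe, inner_zero_right, add_zero]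
    refine (real_inner_le_norm _ _).trans ?_
    gcongr
    have := norm_sq_projBarLe_add P N (antiSeq P w)
    exact le_of_sq_le_sq (by nlinarith [sq_nonneg ‖projBarLe P N (antiSeq P w)‖]) (norm_nonneg _)
  have h2 := pow_le_pow_left₀ (sq_nonneg _) h1 2
  rw [mul_pow, norm_sq_antiSeq] at h2
  by_cases h0 : ‖w‖ ^ 2 = 0
  · rw [h0]; positivity
  · have h3 : 0 < ‖w‖ ^ 2 := lt_of_le_of_ne (sq_nonneg _) (Ne.symm h0)
    refine le_of_mul_le_mul_right ?_ h3
    nlinarith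

/-- High modes are sent to high modes by `M₁^*`. This is what permits inserting `Π^{> N}` in the
mixed block, as in `𝓩_{2,4}`. -/
theorem diag2_projGt_adjoint_Mone (x : X2 P) :
    diag2 (projGt 1 N) ((Mone P N BN).adjoint (projBarGt P N x))
      = (Mone P N BN).adjoint (projBarGt P N x) := by
  apply ext_inner_right ℝ
  intro y
  rw [inner_diag2_projGt, inner_adjoint_Mone_projBarGt hBN, inner_adjoint_Mone_projBarGt hBN, diag2_apply,
    diag2_apply]
  simp only [fst_toLp, snd_toLp, projGt_projGt]

end Bounds

/-! ### Quadratic forms of block operators -/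

/-- The function `φ` bounds the quadratic form of a block matrix. -/
theorem quadratic_form_le_phi {a b c e : ℝ} (hb : 0 ≤ b) (hc : 0 ≤ c) (p q : ℝ) :
    a * p ^ 2 + (b + c) * (p * q) + e * q ^ 2 ≤ phi a b c e * (p ^ 2 + q ^ 2) := by
  rw [phi, min_mul_of_nonneg _ _ (by positivity)]
  refine le_min ?_ ?_
  -- Here `2pq ≤ p² + q²` bounds the mixed term by `max(b, c)(p² + q²)`.
  · have h3 := mul_le_mul_of_nonneg_right (le_max_left b c) (sq_nonneg (p - q))
    have h4 := mul_le_mul_of_nonneg_right (le_max_left a e) (sq_nonneg p)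
    have h5 := mul_le_mul_of_nonneg_right (le_max_right a e) (sq_nonneg q)
    have h6 := mul_le_mul_of_nonneg_right (le_max_left b c) (by positivity : 0 ≤ p ^ 2 + q ^ 2)
    have h7 := mul_le_mul_of_nonneg_right (le_max_right b c) (by positivity : 0 ≤ p ^ 2 + q ^ 2)
    nlinarith [mul_nonneg (add_nonneg hb hc) (sq_nonneg (p - q))]
  -- Cauchy–Schwarz for `(a, b, c, e)` and `(p², pq, pq, q²)`, whose norm is `p² + q²`; the six
  -- squares are those of Lagrange's identity.
  · rw [← Real.sqrt_sq (by positivity : 0 ≤ p ^ 2 + q ^ 2), ← Real.sqrt_mul (by positivity)]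
    apply Real.le_sqrt_of_sq_le
    nlinarith [sq_nonneg (a * (p * q) - b * p ^ 2), sq_nonneg (a * (p * q) - c * p ^ 2),
      sq_nonneg (a * q ^ 2 - e * p ^ 2), sq_nonneg (b * (p * q) - c * (p * q)),
      sq_nonneg (b * q ^ 2 - e * (p * q)), sq_nonneg (c * q ^ 2 - e * (p * q))]

theorem phi_nonneg {a b c e : ℝ} (hb : 0 ≤ b) (he : 0 ≤ e) : 0 ≤ phi a b c e :=
  le_min (add_nonneg (le_max_of_le_right he) (le_max_of_le_left hb)) (Real.sqrt_nonneg _)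

theorem le_phi {a b c e : ℝ} (hb : 0 ≤ b) : e ≤ phi a b c e := by
  refine le_min ?_ ?_
  · linarith [le_max_right a e, le_max_left b c]
  · exact Real.le_sqrt_of_sq_le (by nlinarith [sq_nonneg a, sq_nonneg b, sq_nonneg c])

/-- Bound for the quadratic form of `M T M^*` in terms of the blocks given by two complementary
projections. -/
theorem inner_conj_le {X Y : Type*} [NormedAddCommGroup X] [InnerProductSpace ℝ X]
    [CompleteSpace X] [NormedAddCommGroup Y] [InnerProductSpace ℝ Y] [CompleteSpace Y]
    (A B : X →L[ℝ] X) (Q : Y →L[ℝ] Y) (M : Y →L[ℝ] X) (T : Y →L[ℝ] Y) {D e : ℝ}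
    (hA : ∀ x y, inner ℝ (A x) y = inner ℝ x (A y)) (hAA : ∀ x, A (A x) = A x)
    (hAB : ∀ x, A x + B x = x) (hABn : ∀ x, ‖A x‖ ^ 2 + ‖B x‖ ^ 2 = ‖x‖ ^ 2)
    (hQ : ∀ x y, inner ℝ (Q x) y = inner ℝ x (Q y)) (hQQ : ∀ x, Q (Q x) = Q x)
    (hD : 1 ≤ D) (hM : ∀ x, ‖M.adjoint (B x)‖ ^ 2 ≤ D * ‖B x‖ ^ 2)
    (hQM : ∀ x, Q (M.adjoint (B x)) = M.adjoint (B x)) (hT : T.adjoint = T)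
    (he : 0 ≤ e) (hTe : ∀ y, inner ℝ (T y) y ≤ e * ‖y‖ ^ 2) (x : X) :
    inner ℝ (T (M.adjoint x)) (M.adjoint x) ≤ D *
      phi ‖A ∘L M ∘L T ∘L M.adjoint ∘L A‖
        (Real.sqrt ‖A ∘L M ∘L T ∘L Q ∘L T.adjoint ∘L M.adjoint ∘L A‖)
        (Real.sqrt ‖A ∘L M ∘L T ∘L Q ∘L T.adjoint ∘L M.adjoint ∘L A‖) e * ‖x‖ ^ 2 := by
  have hsym : ∀ u v, inner ℝ (T u) v = inner ℝ u (T v) := fun u v => by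
    conv_lhs => rw [← hT]
    exact ContinuousLinearMap.adjoint_inner_left _ _ _
  have h1 : inner ℝ (T (M.adjoint (A x))) (M.adjoint (A x))
      ≤ ‖A ∘L M ∘L T ∘L M.adjoint ∘L A‖ * ‖A x‖ ^ 2 := by
    have e1 : inner ℝ (T (M.adjoint (A x))) (M.adjoint (A x))
        = inner ℝ ((A ∘L M ∘L T ∘L M.adjoint ∘L A) (A x)) (A x) := by
      rw [ContinuousLinearMap.adjoint_inner_right]
      simp only [ContinuousLinearMap.comp_apply, hA, hAA]
    rw [e1, pow_two, ← mul_assoc]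
    exact (real_inner_le_norm _ _).trans
      (mul_le_mul_of_nonneg_right (ContinuousLinearMap.le_opNorm _ _) (norm_nonneg _))
  -- As `Q` is a symmetric idempotent and `T` is symmetric, this square is the quadratic form of the
  -- operator on the right.
  have h2 : ‖Q (T (M.adjoint (A x)))‖ ^ 2
      ≤ ‖A ∘L M ∘L T ∘L Q ∘L T.adjoint ∘L M.adjoint ∘L A‖ * ‖A x‖ ^ 2 := by
    have e1 : ‖Q (T (M.adjoint (A x)))‖ ^ 2
        = inner ℝ ((A ∘L M ∘L T ∘L Q ∘L T.adjoint ∘L M.adjoint ∘L A) (A x)) (A x) := by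
      simp only [ContinuousLinearMap.comp_apply, hA, hAA, hT]
      rw [← ContinuousLinearMap.adjoint_inner_right, hsym, hQ,
        ← real_inner_self_eq_norm_sq, hQ, hQQ]
    rw [e1, pow_two, ← mul_assoc]
    exact (real_inner_le_norm _ _).trans
      (mul_le_mul_of_nonneg_right (ContinuousLinearMap.le_opNorm _ _) (norm_nonneg _))
  have h3 := hM x
  -- The second vector lies in the range of `Q`, so `Q` may be placed on the first one for free.
  have hb : inner ℝ (T (M.adjoint (A x))) (M.adjoint (B x))
      = inner ℝ (Q (T (M.adjoint (A x)))) (M.adjoint (B x)) := by rw [hQ, hQM]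
  have h5 := hTe (M.adjoint (B x))
  have h6 : inner ℝ (T (M.adjoint (B x))) (M.adjoint (A x))
      = inner ℝ (T (M.adjoint (A x))) (M.adjoint (B x)) := by rw [hsym, real_inner_comm]
  have hab : M.adjoint x = M.adjoint (A x) + M.adjoint (B x) := by rw [← map_add, hAB]
  rw [hab, map_add, inner_add_left, inner_add_right, inner_add_right, h6, hb, mul_assoc,
    ← hABn]
  have h4 := real_inner_le_norm (Q (T (M.adjoint (A x)))) (M.adjoint (B x))
  set f := ‖A ∘L M ∘L T ∘L M.adjoint ∘L A‖
  have hf : 0 ≤ f := norm_nonneg _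
  have hg : 0 ≤ ‖A ∘L M ∘L T ∘L Q ∘L T.adjoint ∘L M.adjoint ∘L A‖ := norm_nonneg _
  set g := ‖A ∘L M ∘L T ∘L Q ∘L T.adjoint ∘L M.adjoint ∘L A‖
  have h7 := quadratic_form_le_phi (a := f) (e := e) (Real.sqrt_nonneg g) (Real.sqrt_nonneg g) ‖A x‖ ‖B x‖
  refine le_trans ?_ (mul_le_mul_of_nonneg_left h7 (by positivity : 0 ≤ D))
  have k1 : ‖Q (T (M.adjoint (A x)))‖ ≤ Real.sqrt g * ‖A x‖ := by
    refine le_of_sq_le_sq ?_ (by positivity)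
    rw [mul_pow, Real.sq_sqrt hg]; exact h2
  -- `D ≥ 1` weakens `√D` to `D` in the mixed terms and 1 to `D` in the low block, so that one
  -- factor `D` comes out of `φ`.
  have k2 : ‖M.adjoint (B x)‖ ≤ D * ‖B x‖ := by
    refine le_of_sq_le_sq (h3.trans ?_) (by positivity)
    rw [mul_pow]
    gcongr
    nlinarith
  have k3 : ‖Q (T (M.adjoint (A x)))‖ * ‖M.adjoint (B x)‖
      ≤ (Real.sqrt g * ‖A x‖) * (D * ‖B x‖) := by gcongr
  have h9 : f * ‖A x‖ ^ 2 ≤ D * (f * ‖A x‖ ^ 2) := by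
    have : 0 ≤ f * ‖A x‖ ^ 2 := by positivity
    nlinarith
  have h10 : e * ‖M.adjoint (B x)‖ ^ 2 ≤ e * (D * ‖B x‖ ^ 2) :=
    mul_le_mul_of_nonneg_left h3 he
  linarith

/-- Bound for the quadratic form of `M₁ T M₁^*` in terms of the blocks for `Π̄^{≤ N}`, `Π̄^{> N}`. -/
theorem inner_Mone_conj_le {N : ℕ} {BN : X2 P →L[ℝ] X2 P}
    (hBN : BN = projBarLe P N ∘L BN ∘L projBarLe P N) (T : Ell2e →L[ℝ] Ell2e)
    (hT : T.adjoint = T) {e : ℝ} (he : 0 ≤ e)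
    (hTe : ∀ y, inner ℝ (T y) y ≤ e * ‖y‖ ^ 2) (x : X2 P) :
    inner ℝ (T ((Mone P N BN).adjoint x)) ((Mone P N BN).adjoint x) ≤ 4 * P.d *
      phi ‖projBarLe P N ∘L Mone P N BN ∘L T ∘L (Mone P N BN).adjoint ∘L projBarLe P N‖
        (Real.sqrt ‖projBarLe P N ∘L Mone P N BN ∘L T ∘L diag2 (projGt 1 N) ∘L
          T.adjoint ∘L (Mone P N BN).adjoint ∘L projBarLe P N‖)
        (Real.sqrt ‖projBarLe P N ∘L Mone P N BN ∘L T ∘L diag2 (projGt 1 N) ∘L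
          T.adjoint ∘L (Mone P N BN).adjoint ∘L projBarLe P N‖) e * ‖x‖ ^ 2 :=
  inner_conj_le (projBarLe P N) (projBarGt P N) (diag2 (projGt 1 N)) (Mone P N BN) T
    (inner_projBarLe P N) (projBarLe_projBarLe P N) (projBarLe_add_projBarGt P N)
    (norm_sq_projBarLe_add P N) (inner_diag2_projGt N) (diag2_projGt_idem N)
    (by have := P.one_le_d; linarith) (norm_sq_adjoint_Mone_projBarGt_le hBN)
    (diag2_projGt_adjoint_Mone hBN) hT he hTe x

/-- If `T = K K^*` then the bound for the quadratic form of `M T M^*` is a bound for `M K`. -/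
theorem norm_sq_comp_le_of_adjoint {E F G : Type*} [NormedAddCommGroup E] [InnerProductSpace ℝ E]
    [CompleteSpace E] [NormedAddCommGroup F] [InnerProductSpace ℝ F] [CompleteSpace F]
    [NormedAddCommGroup G] [InnerProductSpace ℝ G] [CompleteSpace G]
    (K : E →L[ℝ] F) (M : F →L[ℝ] G) {C : ℝ} (hC : 0 ≤ C)
    (h : ∀ x, inner ℝ ((K ∘L K.adjoint) (M.adjoint x)) (M.adjoint x) ≤ C * ‖x‖ ^ 2) (s : E) :
    ‖M (K s)‖ ^ 2 ≤ C * ‖s‖ ^ 2 := by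
  -- The given quadratic form is `‖(M K)^* x‖²`, and an operator has the norm of its adjoint.
  have h1 : ‖(M ∘L K).adjoint‖ ≤ Real.sqrt C := by
    refine ContinuousLinearMap.opNorm_le_bound _ (Real.sqrt_nonneg _) fun x => ?_
    refine le_of_sq_le_sq ?_ (by positivity)
    rw [mul_pow, Real.sq_sqrt hC, ContinuousLinearMap.adjoint_comp,
      ← real_inner_self_eq_norm_sq, ContinuousLinearMap.comp_apply,
      ContinuousLinearMap.adjoint_inner_right]
    exact h x
  rw [LinearIsometryEquiv.norm_map] at h1
  have h2 := (M ∘L K).le_of_opNorm_le h1 s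
  have h3 := pow_le_pow_left₀ (norm_nonneg _) h2 2
  rwa [mul_pow, Real.sq_sqrt hC] at h3

end

section

variable (P : Params)

/-! ### Trigonometric polynomials -/

/-- The even trigonometric polynomials on `Ω₀`, extended by zero. -/
def trigPoly : Submodule ℝ L2e := Submodule.span ℝ (Set.range (cosE P))

theorem cosE_mem_trigPoly (n : ℕ) : cosE P n ∈ trigPoly P := Submodule.subset_span ⟨n, rfl⟩

variable {P}

theorem memLp_top_of_trigPoly {f : L2e} (hf : f ∈ trigPoly P) : MemLp (f : L2) ∞ volume := by
  induction hf using Submodule.span_induction with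
  | mem f hf =>
    obtain ⟨n, rfl⟩ := hf
    exact (memLp_cosFun P n ∞).ae_eq (cosE_ae P n).symm
  | zero => exact (MemLp.zero' (p := ∞)).ae_eq (Lp.coeFn_zero ℝ 2 (volume : Measure ℝ)).symm
  | add f g _ _ h1 h2 => exact (h1.add h2).ae_eq (Lp.coeFn_add (f : L2) (g : L2)).symm
  | smul c f _ h => exact (h.const_smul c).ae_eq (Lp.coeFn_smul c (f : L2)).symm

/-- The product-to-sum formula; the absolute value of `n - m` is harmless because the cosine is
even. -/
theorem germ_cosE_mul (n m : ℕ) : germ (cosE P n) * germ (cosE P m) =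
    germ ((1 / 2 : ℝ) • cosE P (n + m) + (1 / 2 : ℝ) • cosE P ((n : ℤ) - m).natAbs) := by
  have e : ∀ k, germ (cosE P k) = (cosFun P k : Filter.Germ (ae (volume : Measure ℝ)) ℝ) :=
    fun k => Filter.Germ.coe_eq.2 (cosE_ae P k)
  rw [germ_add, germ_smul, germ_smul]
  simp only [e]
  refine Filter.Germ.coe_eq.2 (Filter.Eventually.of_forall fun x => ?_)
  change cosFun P n x * cosFun P m x = (1 / 2) * cosFun P (n + m) x
    + (1 / 2) * cosFun P ((n : ℤ) - m).natAbs x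
  by_cases hx : x ∈ Omega0 P
  · simp only [cosFun, Set.indicator_of_mem hx]
    have h1 : Real.cos (2 * Real.pi * (((((n : ℤ) - m).natAbs : ℕ) : ℝ) / (2 * P.d)) * x)
        = Real.cos (2 * Real.pi * (n / (2 * P.d)) * x - 2 * Real.pi * (m / (2 * P.d)) * x) := by
      rw [Nat.cast_natAbs, Int.cast_abs, ← Real.cos_abs, ← Real.cos_abs (_ - _)]
      congr 1
      rw [← sub_mul, ← mul_sub, ← sub_div]
      simp only [abs_mul, abs_div, abs_abs, Int.cast_sub, Int.cast_natCast]
    rw [h1, Real.cos_sub]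
    have h2 := Real.cos_add (2 * Real.pi * (n / (2 * P.d)) * x) (2 * Real.pi * (m / (2 * P.d)) * x)
    rw [← add_mul, ← mul_add, ← add_div, ← Nat.cast_add] at h2
    rw [h2]; ring
  · simp only [cosFun, Set.indicator_of_notMem hx]; ring

/-- Bilinearity reduces this to two cosines. In its first argument `mulOp` is additive only between
bounded functions, because of its default value 0, so boundedness is checked at each step. -/
theorem mulOp_mem_trigPoly {f g : L2e} (hf : f ∈ trigPoly P) (hg : g ∈ trigPoly P) :
    mulOp f g ∈ trigPoly P := by
  induction hf using Submodule.span_induction with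
  | mem f hf =>
    obtain ⟨n, rfl⟩ := hf
    induction hg using Submodule.span_induction with
    | mem g hg =>
      obtain ⟨m, rfl⟩ := hg
      have e : mulOp (cosE P n) (cosE P m) = (1 / 2 : ℝ) • cosE P (n + m)
          + (1 / 2 : ℝ) • cosE P ((n : ℤ) - m).natAbs := by
        apply germ_injective
        rw [germ_mulOp (memLp_top_of_trigPoly (cosE_mem_trigPoly P n)), germ_cosE_mul]
      rw [e]
      exact add_mem (Submodule.smul_mem _ _ (cosE_mem_trigPoly P _))
        (Submodule.smul_mem _ _ (cosE_mem_trigPoly P _))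
    | zero => rw [map_zero]; exact zero_mem _
    | add g g' _ _ h1 h2 => rw [map_add]; exact add_mem h1 h2
    | smul c g _ h => rw [map_smul]; exact Submodule.smul_mem _ _ h
  | zero =>
    have e : mulOp 0 g = 0 := by
      apply germ_injective
      rw [germ_mulOp (memLp_top_of_trigPoly (zero_mem (trigPoly P))), germ_zero, zero_mul]
    rw [e]; exact zero_mem _
  | add f f' hf hf' h1 h2 =>
    have e : mulOp (f + f') g = mulOp f g + mulOp f' g := by
      apply germ_injective
      rw [germ_mulOp (memLp_top_of_trigPoly (P := P) (add_mem hf hf')), germ_add, germ_add,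
        germ_mulOp (memLp_top_of_trigPoly hf), germ_mulOp (memLp_top_of_trigPoly hf'), add_mul]
    rw [e]; exact add_mem h1 h2
  | smul c f hf h =>
    have e : mulOp (c • f) g = c • mulOp f g := by
      apply germ_injective
      rw [germ_mulOp (memLp_top_of_trigPoly (P := P) (Submodule.smul_mem _ c hf)), germ_smul,
        germ_smul, germ_mulOp (memLp_top_of_trigPoly hf), mul_assoc]
    rw [e]; exact Submodule.smul_mem _ _ h

theorem gamDag_gam_eq (f : L2e) : gamDag P (gam P f) = gamDagVol P (gamVol P f) := by
  change gamDagVol P (reweight 1 (vol P) (gam P f)) = _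
  rw [reweight_gam]

/-- Since `γ γ† = 1`, the operator `γ† γ` is the identity on the range of `γ†`, which contains the
cosines. -/
theorem gamDagVol_gamVol_of_trigPoly {f : L2e} (hf : f ∈ trigPoly P) :
    gamDagVol P (gamVol P f) = f := by
  induction hf using Submodule.span_induction with
  | mem f hf =>
    obtain ⟨n, rfl⟩ := hf
    -- The coefficient `1/α_n` cancels the weight in `γ†`.
    set U : Ell (vol P) := lp.single 2 n ((Scaled.val (vol P * wt n)).symm (wt n : ℝ)⁻¹) with hU
    have h2 : gamDagVol P U = cosE P n := by
      change (cosIso_orthogonal P).linearIsometry _ = _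
      rw [hU, OrthogonalFamily.linearIsometry_apply_single, cosIso_apply,
        LinearEquiv.apply_symm_apply, mul_inv_cancel₀ (wt n).2.ne', one_smul]
    rw [← h2, gam_gamDag]
  | zero => rw [map_zero, map_zero]
  | add f g _ _ h1 h2 => rw [map_add, map_add, h1, h2]
  | smul c f _ h => rw [map_smul, map_smul, h]

theorem gamDag_gam_of_trigPoly {f : L2e} (hf : f ∈ trigPoly P) : gamDag P (gam P f) = f := by
  rw [gamDag_gam_eq, gamDagVol_gamVol_of_trigPoly hf]

theorem gamDag_mem_trigPoly {K : ℕ} {U : Ell 1} (hU : projLe 1 K U = U) :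
    gamDag P U ∈ trigPoly P := by
  have h0 : ∀ n ∉ Finset.range (K + 1), ((wt n : ℝ) * coef U n) • cosE P n = 0 := by
    intro n hn
    have : coef U n = 0 := by
      rw [← hU, projLe, coef_cut, Set.indicator_of_notMem]
      simp only [Finset.mem_range] at hn
      simp only [Set.mem_ofPred_eq]; omega
    rw [this, mul_zero, zero_smul]
  rw [(gamDag_hasSum P U).unique (hasSum_sum_of_ne_finset_zero h0)]
  exact Submodule.sum_mem _ fun n _ => Submodule.smul_mem _ _ (cosE_mem_trigPoly P n)

theorem indOmega_mem_trigPoly : indOmega P ∈ trigPoly P := by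
  have e : indOmega P = cosE P 0 := by
    apply Subtype.ext
    apply Lp.ext
    refine (mkL2e_ae _ _ _).trans (Filter.EventuallyEq.trans ?_ (cosE_ae P 0).symm)
    refine Filter.Eventually.of_forall fun x => ?_
    simp [cosFun]
  rw [e]; exact cosE_mem_trigPoly P 0

theorem coef_gam_inner (f : L2e) (n : ℕ) :
    coef (gam P f) n = (2 * P.d)⁻¹ * inner ℝ (cosE P n) f := by
  rw [coef_gam, inner_cosE]

theorem exists_coef_gam_eq_zero {f : L2e} (hf : f ∈ trigPoly P) :
    ∃ K : ℕ, ∀ n, K < n → coef (gam P f) n = 0 := by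
  induction hf using Submodule.span_induction with
  | mem f hf =>
    obtain ⟨m, rfl⟩ := hf
    refine ⟨m, fun n hn => ?_⟩
    rw [coef_gam_inner, inner_cosE_cosE, if_neg hn.ne', mul_zero]
  | zero => exact ⟨0, fun n _ => by rw [coef_gam_inner, inner_zero_right, mul_zero]⟩
  | add f g _ _ h1 h2 =>
    obtain ⟨K, hK⟩ := h1
    obtain ⟨L, hL⟩ := h2
    refine ⟨max K L, fun n hn => ?_⟩
    rw [map_add, coef_add, hK n ((le_max_left _ _).trans_lt hn),
      hL n ((le_max_right _ _).trans_lt hn), add_zero]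
  | smul c f _ h =>
    obtain ⟨K, hK⟩ := h
    exact ⟨K, fun n hn => by rw [map_smul, coef_smul, hK n hn, mul_zero]⟩

/-- A trigonometric polynomial is bounded by the `ℓ¹` norm of its coefficients. -/
theorem ae_abs_le_l1norm {f : L2e} (hf : f ∈ trigPoly P) :
    ∀ᵐ x, |(f : L2) x| ≤ l1norm (gam P f) := by
  obtain ⟨K, hK⟩ := exists_coef_gam_eq_zero hf
  have hc : ∀ n, coef (gamVol P f) n = coef (gam P f) n := fun n => by
    rw [← reweight_gam, reweight, coef_cut, Set.indicator_univ]
  have hU : projLe (vol P) K (gamVol P f) = gamVol P f := by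
    ext n
    rw [projLe, coef_cut]
    by_cases h : n ∈ {n | n ≤ K}
    · rw [Set.indicator_of_mem h]
    · rw [Set.indicator_of_notMem h, hc, hK n (not_le.1 h)]
  have h := gamDagVol_ae P (gamVol P f) K hU
  rw [gamDagVol_gamVol_of_trigPoly hf] at h
  -- Only finitely many coefficients are nonzero, so the series in `l1norm` converges and does not
  -- take the default value 0.
  have hs : Summable fun n => (wt n : ℝ) * |coef (gam P f) n| :=
    summable_of_ne_finset_zero (s := Finset.range (K + 1)) fun n hn => by
      rw [hK n (by simpa using hn), abs_zero, mul_zero]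
  have h0 : ∀ n, 0 ≤ (wt n : ℝ) * |coef (gam P f) n| :=
    fun n => mul_nonneg (wt n).2.le (abs_nonneg _)
  filter_upwards [h] with x hx
  rw [hx]
  by_cases hm : x ∈ Omega0 P
  · rw [Set.indicator_of_mem hm]
    refine (Finset.abs_sum_le_sum_abs _ _).trans ?_
    refine le_trans (Finset.sum_le_sum fun n _ => ?_) (hs.sum_le_tsum _ fun n _ => h0 n)
    rw [abs_mul, abs_mul, abs_of_pos (wt n).2, hc]
    exact mul_le_of_le_one_right (h0 n) (Real.abs_cos_le_one _)
  · rw [Set.indicator_of_notMem hm, abs_zero]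
    exact tsum_nonneg h0

theorem l1norm_nonneg {c : PosReal} (U : Ell c) : 0 ≤ l1norm U :=
  tsum_nonneg fun n => mul_nonneg (wt n).2.le (abs_nonneg _)

theorem inner_mulOp {q : L2e} (hq : MemLp (q : L2) ∞ volume) (f g : L2e) :
    inner ℝ (mulOp q f) g = inner ℝ f (mulOp q g) := by
  rw [inner_L2e, inner_L2e]
  apply integral_congr_ae
  filter_upwards [mulOp_ae q f hq, mulOp_ae q g hq] with x h1 h2
  rw [h1, h2]; ring

/-- The map `γ` intertwines multiplication by a trigonometric polynomial and convolution. -/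
theorem gam_mulOp {q : L2e} (hq : q ∈ trigPoly P) (s : L2e) :
    gam P (mulOp q s) = conv P (gam P q) (gam P s) := by
  change _ = gam P (mulOp (gamDag P (gam P q)) (gamDag P (gam P s)))
  rw [gamDag_gam_of_trigPoly hq, gamDag_gam_eq]
  ext n
  have hb := memLp_top_of_trigPoly hq
  -- A coefficient is an inner product with a cosine. Moving `q` onto the cosine gives a
  -- trigonometric polynomial, and against these `s` and `γ† γ s` are indistinguishable. So `s` need
  -- not be supported in `Ω₀`.
  have hf : mulOp q (cosE P n) ∈ trigPoly P := mulOp_mem_trigPoly hq (cosE_mem_trigPoly P n)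
  rw [coef_gam_inner, coef_gam_inner, ← inner_mulOp hb, ← inner_mulOp hb,
    ← gamDagVol_gamVol_of_trigPoly hf, inner_gamDagVol, inner_gamDagVol, gam_gamDag]

theorem conv_gam {q : L2e} (hq : q ∈ trigPoly P) (V : Ell 1) :
    conv P (gam P q) V = gam P (mulOp q (gamDag P V)) := by
  change gam P (mulOp (gamDag P (gam P q)) (gamDag P V)) = _
  rw [gamDag_gam_of_trigPoly hq]

theorem inner_reweight (U V : Ell 1) :
    inner ℝ (reweight 1 (vol P) U) (reweight 1 (vol P) V) = 2 * P.d * inner ℝ U V := by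
  rw [Ell.inner_eq, Ell.inner_eq, ← tsum_mul_left]
  refine tsum_congr fun n => ?_
  rw [reweight, coef_cut, coef_cut, Set.indicator_univ, Set.indicator_univ, coe_vol]
  simp
  ring

/-- `γ` and `γ†` are adjoint for the weight `|Ω₀|`; for the unit weight the factor `2d` remains. -/
theorem inner_gam (f : L2e) (V : Ell 1) :
    2 * P.d * inner ℝ (gam P f) V = inner ℝ f (gamDag P V) := by
  rw [← inner_reweight, reweight_gam, real_inner_comm, ← inner_gamDagVol, real_inner_comm]
  rfl

theorem norm_sq_gamDag (U : Ell 1) : ‖gamDag P U‖ ^ 2 = 2 * P.d * ‖U‖ ^ 2 := by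
  change ‖gamDagVol P (reweight 1 (vol P) U)‖ ^ 2 = _
  rw [LinearIsometry.norm_map, norm_sq_reweight, coe_vol]
  simp

/-- Convolution is `γ`, multiplication, `γ†` in composition; multiplication is symmetric and the
outer maps are adjoint up to the constant `2d`. -/
theorem inner_conv {q : L2e} (hq : q ∈ trigPoly P) (U V : Ell 1) :
    inner ℝ (conv P (gam P q) U) V = inner ℝ U (conv P (gam P q) V) := by
  have hd : 2 * P.d ≠ 0 := by have := P.one_le_d; positivity
  apply mul_left_cancel₀ hd
  rw [conv_gam hq, conv_gam hq, inner_gam, real_inner_comm (gam P _) U, inner_gam,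
    inner_mulOp (memLp_top_of_trigPoly hq), real_inner_comm,
    inner_mulOp (memLp_top_of_trigPoly hq)]

theorem norm_sq_gam_le (f : L2e) : 2 * P.d * ‖gam P f‖ ^ 2 ≤ ‖f‖ ^ 2 := by
  rw [norm_sq_gam]
  exact pow_le_pow_left₀ (norm_nonneg _) (norm_gamVol_le P f) 2

/-- A continuous function that is bounded above almost everywhere on an open interval is bounded
above on its closure. -/
theorem le_of_ae_le_Ioo {g : ℝ → ℝ} (hg : Continuous g) {a b L : ℝ} (hab : a < b)
    (h : ∀ᵐ x, x ∈ Set.Ioo a b → g x ≤ L) {x : ℝ} (hx : x ∈ Set.Icc a b) : g x ≤ L := by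
  by_contra hc
  push Not at hc
  have ho : IsOpen (g ⁻¹' Set.Ioi L ∩ Set.Ioo a b) := (isOpen_Ioi.preimage hg).inter isOpen_Ioo
  have hcl : x ∈ closure (Set.Ioo a b) := by rwa [closure_Ioo hab.ne]
  have hne : (g ⁻¹' Set.Ioi L ∩ Set.Ioo a b).Nonempty :=
    mem_closure_iff.1 hcl _ (isOpen_Ioi.preimage hg) hc
  have hp := ho.measure_pos volume hne
  refine hp.ne' (measure_mono_null (fun y hy => ?_) h)
  intro hy2
  exact absurd (hy2 hy.2) (not_le.2 hy.1)

/-- The continuous representative of an `H²` function supported in `Ω₀` vanishes at `d`. -/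
theorem exists_rep_of_gamDag (u : H2e) (U : Ell 1) (h : (u : L2e) = gamDag P U) :
    ∃ g : ℝ → ℝ, Continuous g ∧ ((u : L2e) : L2) =ᵐ[volume] g ∧ g P.d = 0 := by
  obtain ⟨g, hg, hu, -⟩ := exists_continuous_rep u
  refine ⟨g, hg, hu, ?_⟩
  have hz : mulOut P (u : L2e) = 0 := by rw [h]; exact mulOut_gamDagVol P _
  -- The representative vanishes almost everywhere on an interval with left endpoint `d`, hence at
  -- `d` by continuity.
  have hae : ∀ᵐ x, x ∈ Set.Ioo P.d (P.d + 1) → |g x| ≤ 0 := by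
    have h1 := mulOut_ae P (u : L2e)
    rw [hz] at h1
    filter_upwards [h1, hu, Lp.coeFn_zero ℝ 2 (volume : Measure ℝ)] with x h1 h2 h3 hx
    have hx' : x ∈ (Omega0 P)ᶜ := fun h => absurd h.2 (not_lt.2 hx.1.le)
    rw [Set.indicator_of_mem hx'] at h1
    have : g x = 0 := by rw [← h2, ← h1]; exact h3
    rw [this, abs_zero]
  exact abs_nonpos_iff.1 (le_of_ae_le_Ioo hg.abs (by linarith) hae ⟨le_refl _, by linarith⟩)

end

section

/-! ### The operator `M₂` as a product -/

section Rows

variable {E F : Type*} [NormedAddCommGroup E] [NormedSpace ℝ E]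
  [NormedAddCommGroup F] [NormedSpace ℝ F]

/-- The block row `(a, b) ↦ A a + B b`. -/
def row (A B : E →L[ℝ] F) : Pair E →L[ℝ] F :=
  (A ∘L ContinuousLinearMap.fst ℝ E E + B ∘L ContinuousLinearMap.snd ℝ E E) ∘L
    (WithLp.prodContinuousLinearEquiv 2 ℝ E E).toContinuousLinearMap

theorem row_apply (A B : E →L[ℝ] F) (x : Pair E) : row A B x = A x.fst + B x.snd := rfl

/-- The block column `a ↦ (A a, B a)`. -/
def col (A B : E →L[ℝ] F) : E →L[ℝ] Pair F :=
  (WithLp.prodContinuousLinearEquiv 2 ℝ F F).symm.toContinuousLinearMap ∘L A.prod B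

theorem col_apply (A B : E →L[ℝ] F) (x : E) : col A B x = pair (A x) (B x) := rfl

/-- The block operator `[[C₁, C₂, 0, 0], [C₃, C₄, C₁, C₂]]`. -/
def factor (C₁ C₂ C₃ C₄ : E →L[ℝ] E) : Pair (Pair E) →L[ℝ] Pair E :=
  blk (row C₁ C₂) 0 (row C₃ C₄) (row C₁ C₂)

theorem factor_apply (C₁ C₂ C₃ C₄ : E →L[ℝ] E) (x : Pair (Pair E)) :
    factor C₁ C₂ C₃ C₄ x = pair (C₁ x.fst.fst + C₂ x.fst.snd)
      (C₃ x.fst.fst + C₄ x.fst.snd + (C₁ x.snd.fst + C₂ x.snd.snd)) := by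
  rw [factor, blk_apply, row_apply, row_apply, row_apply, zero_apply, add_zero]

/-- The transpose of `factor` for symmetric blocks. -/
def factorT (C₁ C₂ C₃ C₄ : E →L[ℝ] E) : Pair E →L[ℝ] Pair (Pair E) :=
  blk (col C₁ C₂) (col C₃ C₄) 0 (col C₁ C₂)

theorem factorT_apply (C₁ C₂ C₃ C₄ : E →L[ℝ] E) (y : Pair E) :
    factorT C₁ C₂ C₃ C₄ y = pair (pair (C₁ y.fst + C₃ y.snd) (C₂ y.fst + C₄ y.snd))
      (pair (C₁ y.snd) (C₂ y.snd)) := by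
  rw [factorT, blk_apply, col_apply, col_apply, col_apply, zero_apply, zero_add]
  rfl

end Rows

theorem adjoint_factor {E : Type*} [NormedAddCommGroup E] [InnerProductSpace ℝ E] [CompleteSpace E]
    {C₁ C₂ C₃ C₄ : E →L[ℝ] E} (h1 : ∀ x y, inner ℝ (C₁ x) y = inner ℝ x (C₁ y))
    (h2 : ∀ x y, inner ℝ (C₂ x) y = inner ℝ x (C₂ y))
    (h3 : ∀ x y, inner ℝ (C₃ x) y = inner ℝ x (C₃ y))
    (h4 : ∀ x y, inner ℝ (C₄ x) y = inner ℝ x (C₄ y)) :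
    (factor C₁ C₂ C₃ C₄).adjoint = factorT C₁ C₂ C₃ C₄ := by
  symm
  rw [ContinuousLinearMap.eq_adjoint_iff]
  intro x y
  rw [factor_apply, factorT_apply]
  simp only [inner_pair, fst_toLp, snd_toLp, inner_add_left, inner_add_right, h1, h2, h3, h4]
  ring

theorem norm_sq_L2e (u : L2e) : ‖u‖ ^ 2 = ∫ x, (u : L2) x ^ 2 := by
  rw [← real_inner_self_eq_norm_sq, inner_L2e]
  simp only [pow_two]

theorem integrable_sq_L2e (u : L2e) : Integrable (fun x => (u : L2) x ^ 2) volume :=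
  (Lp.memLp (u : L2)).integrable_sq

theorem sum_norm_sq_le_of_ae_le {u v w z f g : L2e} {C : ℝ}
    (h : ∀ᵐ x, (u : L2) x ^ 2 + (v : L2) x ^ 2 + ((w : L2) x ^ 2 + (z : L2) x ^ 2)
      ≤ C * ((f : L2) x ^ 2 + (g : L2) x ^ 2)) :
    ‖u‖ ^ 2 + ‖v‖ ^ 2 + (‖w‖ ^ 2 + ‖z‖ ^ 2) ≤ C * (‖f‖ ^ 2 + ‖g‖ ^ 2) := by
  have e : ∀ a b : L2e, ‖a‖ ^ 2 + ‖b‖ ^ 2 = ∫ x, ((a : L2) x ^ 2 + (b : L2) x ^ 2) := fun a b => by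
    rw [integral_add (integrable_sq_L2e a) (integrable_sq_L2e b), norm_sq_L2e, norm_sq_L2e]
  have i : ∀ a b : L2e, Integrable (fun x => (a : L2) x ^ 2 + (b : L2) x ^ 2) volume :=
    fun a b => (integrable_sq_L2e a).add (integrable_sq_L2e b)
  rw [e, e, e, ← integral_add (i u v) (i w z), ← integral_const_mul]
  exact integral_mono_ae ((i u v).add (i w z)) ((i f g).const_mul C) h

variable {P : Params} {q₁ q₂ q₃ q₄ : L2e} (h₁ : q₁ ∈ trigPoly P) (h₂ : q₂ ∈ trigPoly P)
  (h₃ : q₃ ∈ trigPoly P) (h₄ : q₄ ∈ trigPoly P)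

include h₁ h₂ h₃ h₄

/-- Convolutions with the `Q_i` are symmetric, so the adjoint of the factor is its transpose and the
block product reproduces the entries of `M₂`. Hence `M₂` is positive, and `M₁ M₂ M₁^*` controls `M₁`
times the factor. -/
theorem Mtwo_eq_factor : Mtwo P (gam P q₁) (gam P q₂) (gam P q₃) (gam P q₄) =
    factor (conv P (gam P q₁)) (conv P (gam P q₂)) (conv P (gam P q₃)) (conv P (gam P q₄)) ∘L
    (factor (conv P (gam P q₁)) (conv P (gam P q₂)) (conv P (gam P q₃))
      (conv P (gam P q₄))).adjoint := by
  rw [adjoint_factor (inner_conv h₁) (inner_conv h₂) (inner_conv h₃) (inner_conv h₄)]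
  ext1 y
  rw [ContinuousLinearMap.comp_apply, factorT_apply, factor_apply, Mtwo, blk_apply]
  refine congrArg (WithLp.toLp 2) (Prod.ext ?_ ?_)
  · simp only [add_apply, ContinuousLinearMap.comp_apply, fst_toLp, snd_toLp, map_add]
    abel
  · simp only [add_apply, ContinuousLinearMap.comp_apply, fst_toLp, snd_toLp, map_add]
    abel

-- Products of trigonometric polynomials are again such, with convolutions as coefficients, so the
-- `ℓ¹` bound for the sup norm applies to the whole sum.
omit h₃ h₄ in
theorem ae_add_mulOp_le (h₃ : q₃ ∈ trigPoly P) (h₄ : q₄ ∈ trigPoly P) : ∀ᵐ x,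
    |(q₁ : L2) x * (q₂ : L2) x + (q₃ : L2) x * (q₄ : L2) x|
      ≤ l1norm (conv P (gam P q₁) (gam P q₂) + conv P (gam P q₃) (gam P q₄)) := by
  have hm : mulOp q₁ q₂ + mulOp q₃ q₄ ∈ trigPoly P :=
    add_mem (mulOp_mem_trigPoly h₁ h₂) (mulOp_mem_trigPoly h₃ h₄)
  have h := ae_abs_le_l1norm hm
  rw [map_add, gam_mulOp h₁, gam_mulOp h₃] at h
  filter_upwards [h, Lp.coeFn_add (mulOp q₁ q₂ : L2) (mulOp q₃ q₄ : L2),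
    mulOp_ae q₁ q₂ (memLp_top_of_trigPoly h₁), mulOp_ae q₃ q₄ (memLp_top_of_trigPoly h₃)]
    with x k1 k2 k3 k4
  rw [Submodule.coe_add, k2, Pi.add_apply, k3, k4] at k1
  exact k1

theorem ae_add_four_mulOp_le : ∀ᵐ x,
    (q₃ : L2) x ^ 2 + (q₄ : L2) x ^ 2 + (q₁ : L2) x ^ 2 + (q₂ : L2) x ^ 2
      ≤ l1norm (conv P (gam P q₃) (gam P q₃) + conv P (gam P q₄) (gam P q₄)
        + conv P (gam P q₁) (gam P q₁) + conv P (gam P q₂) (gam P q₂)) := by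
  have hm : mulOp q₃ q₃ + mulOp q₄ q₄ + mulOp q₁ q₁ + mulOp q₂ q₂ ∈ trigPoly P :=
    add_mem (add_mem (add_mem (mulOp_mem_trigPoly h₃ h₃) (mulOp_mem_trigPoly h₄ h₄))
      (mulOp_mem_trigPoly h₁ h₁)) (mulOp_mem_trigPoly h₂ h₂)
  have h := ae_abs_le_l1norm hm
  rw [map_add, map_add, map_add, gam_mulOp h₁, gam_mulOp h₂, gam_mulOp h₃, gam_mulOp h₄] at h
  filter_upwards [h,
    Lp.coeFn_add ((mulOp q₃ q₃ : L2) + (mulOp q₄ q₄ : L2) + (mulOp q₁ q₁ : L2))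
      (mulOp q₂ q₂ : L2),
    Lp.coeFn_add ((mulOp q₃ q₃ : L2) + (mulOp q₄ q₄ : L2)) (mulOp q₁ q₁ : L2),
    Lp.coeFn_add (mulOp q₃ q₃ : L2) (mulOp q₄ q₄ : L2),
    mulOp_ae q₁ q₁ (memLp_top_of_trigPoly h₁), mulOp_ae q₂ q₂ (memLp_top_of_trigPoly h₂),
    mulOp_ae q₃ q₃ (memLp_top_of_trigPoly h₃), mulOp_ae q₄ q₄ (memLp_top_of_trigPoly h₄)]
    with x k0 k1 k2 k3 e1 e2 e3 e4
  rw [Submodule.coe_add, Submodule.coe_add, Submodule.coe_add, k1, Pi.add_apply, k2, Pi.add_apply,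
    k3, Pi.add_apply, e1, e2, e3, e4] at k0
  refine le_trans (le_of_eq ?_) ((le_abs_self _).trans k0)
  ring

/-- The operator `M₂` is bounded by the function `φ` of the `ℓ¹` norms of its symbol. -/
theorem inner_Mtwo_le (y : Ell2e) :
    inner ℝ (Mtwo P (gam P q₁) (gam P q₂) (gam P q₃) (gam P q₄) y) y ≤
      phi (l1norm (conv P (gam P q₁) (gam P q₁) + conv P (gam P q₂) (gam P q₂)))
        (l1norm (conv P (gam P q₁) (gam P q₃) + conv P (gam P q₂) (gam P q₄)))
        (l1norm (conv P (gam P q₃) (gam P q₁) + conv P (gam P q₄) (gam P q₂)))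
        (l1norm (conv P (gam P q₃) (gam P q₃) + conv P (gam P q₄) (gam P q₄)
          + conv P (gam P q₁) (gam P q₁) + conv P (gam P q₂) (gam P q₂))) * ‖y‖ ^ 2 := by
  have hd : 0 < 2 * P.d := by have := P.one_le_d; linarith
  have a1 := ae_add_mulOp_le h₁ h₁ h₂ h₂
  have a2 := ae_add_mulOp_le h₁ h₃ h₂ h₄
  have a3 := ae_add_mulOp_le h₃ h₁ h₄ h₂
  have a4 := ae_add_four_mulOp_le h₁ h₂ h₃ h₄
  have p2 := l1norm_nonneg (conv P (gam P q₁) (gam P q₃) + conv P (gam P q₂) (gam P q₄))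
  have p3 := l1norm_nonneg (conv P (gam P q₃) (gam P q₁) + conv P (gam P q₄) (gam P q₂))
  set n1 := l1norm (conv P (gam P q₁) (gam P q₁) + conv P (gam P q₂) (gam P q₂))
  set n2 := l1norm (conv P (gam P q₁) (gam P q₃) + conv P (gam P q₂) (gam P q₄))
  set n3 := l1norm (conv P (gam P q₃) (gam P q₁) + conv P (gam P q₄) (gam P q₂))
  set n4 := l1norm (conv P (gam P q₃) (gam P q₃) + conv P (gam P q₄) (gam P q₄)
    + conv P (gam P q₁) (gam P q₁) + conv P (gam P q₂) (gam P q₂))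
  -- The quadratic form of `K K^*` at `y` is `‖K^* y‖²`, a sum of four squared norms of
  -- convolutions.
  rw [Mtwo_eq_factor h₁ h₂ h₃ h₄, ContinuousLinearMap.comp_apply,
    ← ContinuousLinearMap.adjoint_inner_right, real_inner_self_eq_norm_sq,
    adjoint_factor (inner_conv h₁) (inner_conv h₂) (inner_conv h₃) (inner_conv h₄),
    factorT_apply, norm_sq_pair, norm_sq_pair, norm_sq_pair, norm_sq_pair y]
  simp only [fst_toLp, snd_toLp, conv_gam h₁, conv_gam h₂, conv_gam h₃, conv_gam h₄, ← map_add]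
  set Y := gamDag P y.fst with hY
  set Z := gamDag P y.snd with hZ
  have hYn : ‖Y‖ ^ 2 = 2 * P.d * ‖y.fst‖ ^ 2 := norm_sq_gamDag _
  have hZn : ‖Z‖ ^ 2 = 2 * P.d * ‖y.snd‖ ^ 2 := norm_sq_gamDag _
  -- Pointwise the left side is a quadratic form in the values of `Y` and `Z`, whose coefficients
  -- are the functions behind the four `ℓ¹` norms; `φ` bounds it.
  have key : ‖mulOp q₁ Y + mulOp q₃ Z‖ ^ 2 + ‖mulOp q₂ Y + mulOp q₄ Z‖ ^ 2
      + (‖mulOp q₁ Z‖ ^ 2 + ‖mulOp q₂ Z‖ ^ 2) ≤ phi n1 n2 n3 n4 * (‖Y‖ ^ 2 + ‖Z‖ ^ 2) := by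
    apply sum_norm_sq_le_of_ae_le
    filter_upwards [a1, a2, a3, a4, Lp.coeFn_add (mulOp q₁ Y : L2) (mulOp q₃ Z : L2),
      Lp.coeFn_add (mulOp q₂ Y : L2) (mulOp q₄ Z : L2),
      mulOp_ae q₁ Y (memLp_top_of_trigPoly h₁), mulOp_ae q₃ Z (memLp_top_of_trigPoly h₃),
      mulOp_ae q₂ Y (memLp_top_of_trigPoly h₂), mulOp_ae q₄ Z (memLp_top_of_trigPoly h₄),
      mulOp_ae q₁ Z (memLp_top_of_trigPoly h₁), mulOp_ae q₂ Z (memLp_top_of_trigPoly h₂)]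
      with x b1 b2 b3 b4 c1 c2 e1 e2 e3 e4 e5 e6
    rw [Submodule.coe_add, Submodule.coe_add, c1, c2, Pi.add_apply, Pi.add_apply, e1, e2, e3, e4,
      e5, e6]
    set s := (Y : L2) x
    set t := (Z : L2) x
    set u₁ := (q₁ : L2) x
    set u₂ := (q₂ : L2) x
    set u₃ := (q₃ : L2) x
    set u₄ := (q₄ : L2) x
    have m1 := mul_le_mul_of_nonneg_right ((le_abs_self _).trans b1) (sq_nonneg s)
    have m4 := mul_le_mul_of_nonneg_right b4 (sq_nonneg t)
    have m2 : (u₁ * u₃ + u₂ * u₄) * (s * t) ≤ n2 * (|s| * |t|) := by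
      refine (le_abs_self _).trans ?_
      rw [abs_mul, abs_mul s]
      exact mul_le_mul_of_nonneg_right b2 (by positivity)
    have m3 : (u₃ * u₁ + u₄ * u₂) * (s * t) ≤ n3 * (|s| * |t|) := by
      refine (le_abs_self _).trans ?_
      rw [abs_mul, abs_mul s]
      exact mul_le_mul_of_nonneg_right b3 (by positivity)
    have h := quadratic_form_le_phi (a := n1) (e := n4) p2 p3 |s| |t|
    rw [sq_abs, sq_abs] at h
    linarith
  -- Bessel's inequality returns to sequences; its factor `2d` cancels that in the norms of `Y` and
  -- `Z`.
  have g1 := norm_sq_gam_le (P := P) (mulOp q₁ Y + mulOp q₃ Z)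
  have g2 := norm_sq_gam_le (P := P) (mulOp q₂ Y + mulOp q₄ Z)
  have g3 := norm_sq_gam_le (P := P) (mulOp q₁ Z)
  have g4 := norm_sq_gam_le (P := P) (mulOp q₂ Z)
  rw [hYn, hZn] at key
  refine le_of_mul_le_mul_left ?_ hd
  linarith

end

section

/-! ### The part of the derivative that is linear in the increment -/

variable {P : Params}

theorem indOmega_ae : (indOmega P : L2) =ᵐ[volume] (Omega0 P).indicator fun _ => 1 :=
  mkL2e_ae _ _ _

/-- The germ of the indicator function of `Ω₀`. -/
theorem germ_indOmega_mul_add (s : L2e) : germ (indOmega P) * germ s + germ (mulOut P s) = germ s := by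
  have h : ((mulOp (indOmega P) s + mulOut P s : L2e) : L2) =ᵐ[volume] (s : L2) := by
    rw [Submodule.coe_add]
    filter_upwards [Lp.coeFn_add (mulOp (indOmega P) s : L2) (mulOut P s : L2),
      mulOp_ae (indOmega P) s (memLp_top_of_trigPoly indOmega_mem_trigPoly), mulOut_ae P s,
      indOmega_ae (P := P)] with x h1 h2 h3 h4
    rw [h1, Pi.add_apply, h2, h3, h4]
    by_cases hx : x ∈ Omega0 P
    · rw [Set.indicator_of_mem hx, Set.indicator_of_notMem (Set.notMem_compl_iff.2 hx)]; ring
    · rw [Set.indicator_of_notMem hx, Set.indicator_of_mem (show x ∈ (Omega0 P)ᶜ from hx)]; ring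
  have h2 : germ (mulOp (indOmega P) s + mulOut P s) = germ s := Filter.Germ.coe_eq.2 h
  rwa [germ_add, germ_mulOp (memLp_top_of_trigPoly indOmega_mem_trigPoly)] at h2

theorem mulOut_mulOp {q : L2e} (hq : q ∈ trigPoly P) (s : L2e) : mulOut P (mulOp q s) = 0 := by
  have h0 : mulOut P q = 0 := by
    rw [← gamDagVol_gamVol_of_trigPoly hq, mulOut_gamDagVol]
  apply germ_injective
  have h1 := congrArg germ h0
  rw [mulOut, germ_mulBdd, germ_zero] at h1
  rw [mulOut, germ_mulBdd, germ_mulOp (memLp_top_of_trigPoly hq), ← mul_assoc, h1, zero_mul,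
    germ_zero]

theorem gam_mulOut (s : L2e) : gam P (mulOut P s) = 0 := by
  change reweight (vol P) 1 (gamVol P (mulOut P s)) = 0
  rw [gamVol_mulOut, map_zero]

/-- The bilinear map `(h, v) ↦ (h₁ v₁, h₁ v₂ + h₂ v₁)`. -/
def bil (h v : He P) : Pair L2e :=
  pair (mul1 P h (comp1 P v)) (mul1 P h (comp2 P v) + mul2 P h (comp1 P v))

/-- The operator `(s, t) ↦ q₁ s + q₂ t + 1_{ℝ ∖ Ω₀} (2 ν₄ s + ν₅ t)`. -/
def hessOp (x : H1 P) (p : Pair L2e) : L2e :=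
  mulOp (q1 P x) p.fst + mulOp (q2 P x) p.snd
    + mulOut P ((2 * P.nu4) • p.fst + P.nu5 • p.snd)

/-- The operator `(s, t) ↦ q₃ s + q₄ t`. -/
def thirdOp (x : H1 P) (p : Pair L2e) : L2e := mulOp (q3 P x) p.fst + mulOp (q4 P x) p.snd

theorem hessOp_add (x : H1 P) (p p' : Pair L2e) :
    hessOp x (p + p') = hessOp x p + hessOp x p' := by
  change mulOp (q1 P x) (p.fst + p'.fst) + mulOp (q2 P x) (p.snd + p'.snd)
    + mulOut P ((2 * P.nu4) • (p.fst + p'.fst) + P.nu5 • (p.snd + p'.snd)) = _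
  simp only [hessOp, map_add, map_smul, smul_add]
  abel

/-! ### The second and third derivatives as multiplication by the `q_i` -/

section Linear

variable (x : H1 P) (h1 : q1 P x ∈ trigPoly P) (h2 : q2 P x ∈ trigPoly P)

-- In `q₁` and `q₂` the constants `2 ν₄` and `ν₅` are cut off to `Ω₀`, so the same constants outside
-- `Ω₀` have to be added back; the two indicator functions sum to 1.
include h1 h2 in
theorem polyHess_eq (h v : He P) : polyHess P x.snd.fst h v = hessOp x (bil h v) := by
  apply germ_injective
  have e1 : germ (q1 P x) = 2 * germ (comp2 P x.snd.fst) + 2 * (P.nu4 : ℝ) * germ (indOmega P) := by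
    rw [q1, germ_add, germ_smul, germ_smul, germ_two_const, germ_two]; rfl
  have e2 : germ (q2 P x) = 2 * germ (comp1 P x.snd.fst) + (P.nu5 : ℝ) * germ (indOmega P) := by
    rw [q2, germ_add, germ_smul, germ_smul, germ_two]; rfl
  have k1 := germ_indOmega_mul_add (P := P) (mul1 P h (comp1 P v))
  have k2 := germ_indOmega_mul_add (P := P) (mul1 P h (comp2 P v) + mul2 P h (comp1 P v))
  rw [hessOp, map_add (mulOut P), map_smul (mulOut P), map_smul (mulOut P)]
  simp only [bil, fst_toLp, snd_toLp, polyHess, germ_add, germ_smul, germ_mul1, germ_mul2,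
    germ_two_const, germ_two,
    germ_mulOp (memLp_top_of_trigPoly h1), germ_mulOp (memLp_top_of_trigPoly h2), e1, e2] at k1 k2 ⊢
  linear_combination (-2 * ((P.nu4 : ℝ) : Filter.Germ (ae (volume : Measure ℝ)) ℝ)) * k1
    - ((P.nu5 : ℝ) : Filter.Germ (ae (volume : Measure ℝ)) ℝ) * k2

/-- No constant accompanies `w̄` in `q₃` and `q₄`, so nothing remains outside `Ω₀`. -/
theorem polyThird_eq (h3 : q3 P x ∈ trigPoly P) (h4 : q4 P x ∈ trigPoly P) (h v : He P) :
    polyThird P h v x.snd.snd = thirdOp x (bil h v) := by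
  apply germ_injective
  have e1 : germ (q3 P x) = 2 * germ (comp2 P x.snd.snd) := by
    rw [q3, germ_smul, germ_two]; rfl
  have e2 : germ (q4 P x) = 2 * germ (comp1 P x.snd.snd) := by
    rw [q4, germ_smul, germ_two]; rfl
  simp only [thirdOp, bil, fst_toLp, snd_toLp, polyThird, germ_add, germ_smul, germ_mul1,
    germ_mul2, germ_two,
    germ_mulOp (memLp_top_of_trigPoly h3), germ_mulOp (memLp_top_of_trigPoly h4), e1, e2]
  ring

include h1 h2

theorem gam_hessOp (p : Pair L2e) : gam P (hessOp x p) =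
    conv P (gam P (q1 P x)) (gam P p.fst) + conv P (gam P (q2 P x)) (gam P p.snd) := by
  rw [hessOp, map_add (gam P), map_add (gam P), gam_mulOut, add_zero, gam_mulOp h1, gam_mulOp h2]

theorem mulOut_hessOp (p : Pair L2e) : mulOut P (hessOp x p) =
    (2 * P.nu4) • mulOut P p.fst + P.nu5 • mulOut P p.snd := by
  rw [hessOp, map_add (mulOut P), map_add (mulOut P), mulOut_mulOp h1, mulOut_mulOp h2,
    mulOut_mulOut, zero_add, zero_add, map_add (mulOut P), map_smul (mulOut P),
    map_smul (mulOut P)]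

omit h1 h2

theorem gam_thirdOp (h3 : q3 P x ∈ trigPoly P) (h4 : q4 P x ∈ trigPoly P) (p : Pair L2e) :
    gam P (thirdOp x p) =
      conv P (gam P (q3 P x)) (gam P p.fst) + conv P (gam P (q4 P x)) (gam P p.snd) := by
  rw [thirdOp, map_add (gam P), gam_mulOp h3, gam_mulOp h4]

theorem mulOut_thirdOp (h3 : q3 P x ∈ trigPoly P) (h4 : q4 P x ∈ trigPoly P) (p : Pair L2e) :
    mulOut P (thirdOp x p) = 0 := by
  rw [thirdOp, map_add (mulOut P), mulOut_mulOp h3, mulOut_mulOp h4, add_zero]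

end Linear

/-- At the boundary of `Ω₀` the functions `q₁` and `q₂` take the values `2 ν₄` and `ν₅`. -/
theorem nu_sq_le (x : H1 P) {U : Ell2e} (hu1 : He.fun1 P x.snd.fst = gamDag P U.fst)
    (hu2 : He.fun2 P x.snd.fst = gamDag P U.snd) {L : ℝ}
    (hL : ∀ᵐ t, (q1 P x : L2) t ^ 2 + (q2 P x : L2) t ^ 2 ≤ L) :
    (2 * P.nu4) ^ 2 + P.nu5 ^ 2 ≤ L := by
  obtain ⟨g1, hg1, e1, z1⟩ := exists_rep_of_gamDag (He.c1 P x.snd.fst) U.fst hu1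
  obtain ⟨g2, hg2, e2, z2⟩ := exists_rep_of_gamDag (He.c2 P x.snd.fst) U.snd hu2
  have hd := P.one_le_d
  -- On `Ω₀` this continuous function is `q₁² + q₂²`; at the endpoint `d`, where the representatives
  -- of `ū` vanish, it is the left side of the claim.
  have h := le_of_ae_le_Ioo (g := fun t => (2 * g2 t + 2 * P.nu4) ^ 2 + (2 * g1 t + P.nu5) ^ 2)
    (by fun_prop) (a := -P.d) (b := P.d) (L := L) (by linarith) ?_
    (x := P.d) ⟨by linarith, le_refl _⟩
  · simpa [z1, z2] using h
  · have c1 : (q1 P x : L2) = (2 : ℝ) • (He.fun2 P x.snd.fst : L2)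
        + (2 * P.nu4) • (indOmega P : L2) := rfl
    have c2 : (q2 P x : L2) = (2 : ℝ) • (He.fun1 P x.snd.fst : L2)
        + P.nu5 • (indOmega P : L2) := rfl
    rw [c1, c2] at hL
    filter_upwards [hL, e1, e2,
      Lp.coeFn_add ((2 : ℝ) • (He.fun2 P x.snd.fst : L2)) ((2 * P.nu4) • (indOmega P : L2)),
      Lp.coeFn_add ((2 : ℝ) • (He.fun1 P x.snd.fst : L2)) (P.nu5 • (indOmega P : L2)),
      Lp.coeFn_smul (2 : ℝ) (He.fun2 P x.snd.fst : L2),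
      Lp.coeFn_smul (2 : ℝ) (He.fun1 P x.snd.fst : L2),
      Lp.coeFn_smul (2 * P.nu4) (indOmega P : L2), Lp.coeFn_smul P.nu5 (indOmega P : L2),
      indOmega_ae (P := P)] with t k1 k2 k3 k4 k5 k6 k7 k8 k9 k0 ht
    rw [k4, k5, Pi.add_apply, Pi.add_apply, k6, k7, k8, k9, Pi.smul_apply, Pi.smul_apply,
      Pi.smul_apply, Pi.smul_apply, k0, Set.indicator_of_mem (show t ∈ Omega0 P from ht)] at k1
    change ((He.fun1 P x.snd.fst : L2e) : L2) t = g1 t at k2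
    change ((He.fun2 P x.snd.fst : L2e) : L2) t = g2 t at k3
    rw [k2, k3] at k1
    simpa using k1

/-! ### Norms of products -/

section Norms

/-- Each product takes the sup norm of `h` and the `L²` norm of `v`; with `p`, `q` the `L²` norms of
`v₁`, `v₂`, the 3 comes from `p² + (p + q)² ≤ 3 (p² + q²)`. -/
theorem norm_sq_bilinear_le (h v : He P) :
    ‖bil h v‖ ^ 2 ≤ 3 * (kappa P * ‖h‖ * ‖v‖) ^ 2 := by
  rw [bil, norm_sq_pair]
  simp only [fst_toLp, snd_toLp]
  have hn := normM2_nonneg (symbInv P)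
  have a1 := norm_mul1_le P h (comp1 P v)
  have a2 := norm_mul1_le P h (comp2 P v)
  have a3 := norm_mul2_le P h (comp1 P v)
  have a4 := (norm_add_le (mul1 P h (comp2 P v)) (mul2 P h (comp1 P v))).trans (add_le_add a2 a3)
  have b : ‖comp1 P v‖ ^ 2 + ‖comp2 P v‖ ^ 2 ≤ normM1 (symbInv P) ^ 2 * ‖v‖ ^ 2 :=
    norm_sq_fun_le P v
  set c := normM2 (symbInv P) * ‖h‖ with hc
  have c1 := pow_le_pow_left₀ (norm_nonneg _) a1 2
  have c2 := pow_le_pow_left₀ (norm_nonneg _) a4 2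
  have b' := mul_le_mul_of_nonneg_left b (sq_nonneg c)
  have e : (kappa P * ‖h‖ * ‖v‖) ^ 2 = c ^ 2 * (normM1 (symbInv P) ^ 2 * ‖v‖ ^ 2) := by
    rw [kappa, hc]; ring
  rw [e]
  set p := ‖comp1 P v‖
  set q := ‖comp2 P v‖
  nlinarith [sq_nonneg (c * p - c * q), sq_nonneg (c * q)]

theorem add_two_mul_sq_le (p q : ℝ) : (q + 2 * p) ^ 2 ≤ 5 * (p ^ 2 + q ^ 2) := by
  nlinarith [sq_nonneg (p - 2 * q)]

/-- Cauchy–Schwarz with the vector `(1, 2)`, whose length is `√5`: these are the multiplicities of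
the two components in the cubic terms. -/
theorem norm_comp_le (v : He P) :
    ‖comp2 P v‖ + 2 * ‖comp1 P v‖ ≤ Real.sqrt 5 * (normM1 (symbInv P) * ‖v‖) := by
  have hm := normM1_nonneg (symbInv P)
  refine le_of_sq_le_sq ((add_two_mul_sq_le _ _).trans ?_) (by positivity)
  rw [mul_pow, Real.sq_sqrt (by norm_num), mul_pow]
  have b : ‖comp1 P v‖ ^ 2 + ‖comp2 P v‖ ^ 2 ≤ normM1 (symbInv P) ^ 2 * ‖v‖ ^ 2 :=
    norm_sq_fun_le P v
  linarith

theorem norm_polyCub_le (h v : He P) : ‖polyCub P h v‖ ≤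
    Real.sqrt 5 * (kappa P * normM2 (symbInv P)) * (‖h‖ ^ 2 * ‖v‖) := by
  set n := normM2 (symbInv P) with hn'
  have hn : 0 ≤ n := normM2_nonneg _
  have a1 : ‖mul1 P h (mul1 P h (comp2 P v))‖ ≤ n * ‖h‖ * (n * ‖h‖ * ‖comp2 P v‖) :=
    (norm_mul1_le P _ _).trans (by gcongr; exact norm_mul1_le P _ _)
  have a2 : ‖mul1 P h (mul2 P h (comp1 P v))‖ ≤ n * ‖h‖ * (n * ‖h‖ * ‖comp1 P v‖) :=
    (norm_mul1_le P _ _).trans (by gcongr; exact norm_mul2_le P _ _)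
  have a3 : ‖(2 : ℝ) • mul1 P h (mul2 P h (comp1 P v))‖
      ≤ 2 * (n * ‖h‖ * (n * ‖h‖ * ‖comp1 P v‖)) := by
    rw [norm_smul, Real.norm_ofNat]; gcongr
  refine (norm_add_le _ _).trans ((add_le_add a1 a3).trans ?_)
  have b := mul_le_mul_of_nonneg_left (norm_comp_le (P := P) v)
    (by positivity : 0 ≤ (n * ‖h‖) ^ 2)
  rw [kappa, ← hn']
  linarith

/-- The first two arguments are taken in sup norm and the third in `L²`. -/
theorem norm_polyThird_le (h v k : He P) : ‖polyThird P h v k‖ ≤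
    Real.sqrt 5 * (kappa P * normM2 (symbInv P)) * (2 * (‖h‖ * ‖v‖ * ‖k‖)) := by
  set n := normM2 (symbInv P) with hn'
  have hn : 0 ≤ n := normM2_nonneg _
  have a1 : ‖mul1 P h (mul1 P v (comp2 P k))‖ ≤ n * ‖h‖ * (n * ‖v‖ * ‖comp2 P k‖) :=
    (norm_mul1_le P _ _).trans (by gcongr; exact norm_mul1_le P _ _)
  have a2 : ‖mul1 P h (mul2 P v (comp1 P k))‖ ≤ n * ‖h‖ * (n * ‖v‖ * ‖comp1 P k‖) :=
    (norm_mul1_le P _ _).trans (by gcongr; exact norm_mul2_le P _ _)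
  have a3 : ‖mul2 P h (mul1 P v (comp1 P k))‖ ≤ n * ‖h‖ * (n * ‖v‖ * ‖comp1 P k‖) :=
    (norm_mul2_le P _ _).trans (by gcongr; exact norm_mul1_le P _ _)
  have e : polyThird P h v k = (2 : ℝ) • (mul1 P h (mul1 P v (comp2 P k))
      + mul1 P h (mul2 P v (comp1 P k)) + mul2 P h (mul1 P v (comp1 P k))) := by
    rw [polyThird]; module
  rw [e, norm_smul, Real.norm_ofNat]
  have c := (norm_add₃_le (a := mul1 P h (mul1 P v (comp2 P k)))
    (b := mul1 P h (mul2 P v (comp1 P k))) (c := mul2 P h (mul1 P v (comp1 P k))))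
  have b := mul_le_mul_of_nonneg_left (norm_comp_le (P := P) k)
    (by positivity : 0 ≤ n * ‖h‖ * (n * ‖v‖))
  rw [kappa, ← hn']
  linarith

end Norms

/-! ### Bounds for the three parts of the derivative -/

section Parts

variable {N : ℕ} {BN : X2 P →L[ℝ] X2 P}
  (hBN : BN = projBarLe P N ∘L BN ∘L projBarLe P N)

theorem kappa_nonneg : 0 ≤ kappa P := mul_nonneg (normM1_nonneg _) (normM2_nonneg _)

theorem norm_sq_H1 (y : H1 P) : ‖y‖ ^ 2 = y.fst ^ 2 + ‖y.snd.fst‖ ^ 2 + ‖y.snd.snd‖ ^ 2 :=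
  norm_sq_trip y

include hBN

theorem norm_lapPart_le (h y : H1 P) :
    ‖BBop P N BN (trip 0 (pair (h.fst • lap1 P y.snd.fst + y.fst • lap1 P h.snd.fst) 0)
      (pair (h.fst • lap1 P y.snd.snd + y.fst • lap1 P h.snd.snd) 0))‖
      ≤ Z21 P BN * (‖h‖ * ‖y‖) := by
  have hm : 0 ≤ normM1 (lapSymb P) := normM1_nonneg _
  have hC : 0 ≤ max 1 ‖BN24 P BN‖ := zero_le_one.trans (le_max_left _ _)
  have hZ : Z21 P BN = max 1 ‖BN24 P BN‖ * normM1 (lapSymb P) := rfl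
  rw [hZ]
  refine le_of_sq_le_sq ((norm_sq_BBop_first_le hBN _ _).trans ?_) (by positivity)
  have key : ∀ u v : He P, ‖h.fst • lap1 P u + y.fst • lap1 P v‖
      ≤ normM1 (lapSymb P) * (|h.fst| * ‖u‖ + |y.fst| * ‖v‖) := by
    intro u v
    refine (norm_add_le _ _).trans ?_
    rw [norm_smul, norm_smul, Real.norm_eq_abs, Real.norm_eq_abs, mul_add]
    have := mul_le_mul_of_nonneg_left (norm_lap1_le P u) (abs_nonneg h.fst)
    have := mul_le_mul_of_nonneg_left (norm_lap1_le P v) (abs_nonneg y.fst)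
    linarith
  have k1 := pow_le_pow_left₀ (norm_nonneg _) (key y.snd.fst h.snd.fst) 2
  have k2 := pow_le_pow_left₀ (norm_nonneg _) (key y.snd.snd h.snd.snd) 2
  rw [mul_assoc, mul_pow]
  gcongr
  rw [mul_pow, mul_pow, norm_sq_H1, norm_sq_H1, ← sq_abs h.fst, ← sq_abs y.fst]
  rw [mul_pow] at k1 k2
  refine (add_le_add k1 k2).trans ?_
  rw [← mul_add]
  gcongr
  set μ := |h.fst|
  set a := |y.fst|
  set x := ‖h.snd.fst‖
  set x' := ‖h.snd.snd‖
  set X := ‖y.snd.fst‖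
  set X' := ‖y.snd.snd‖
  -- The difference of the two sides is the sum of these two squares, so the constant here is 1.
  nlinarith [sq_nonneg (μ * a - (x * X + x' * X')), sq_nonneg (x * X' - x' * X)]

theorem norm_cubPart_le (h y : H1 P) :
    ‖BBop P N BN (trip 0 (anti (polyCub P h.snd.fst y.snd.fst))
      (anti (polyCub P h.snd.fst y.snd.snd + polyThird P h.snd.fst y.snd.fst h.snd.snd)))‖
      ≤ ‖Mone P N BN‖ * Real.sqrt 10 * kappa P * normM2 (symbInv P) * (‖h‖ ^ 2 * ‖y‖) := by
  have hk : 0 ≤ kappa P := kappa_nonneg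
  have hn : 0 ≤ normM2 (symbInv P) := normM2_nonneg _
  refine le_of_sq_le_sq ((norm_sq_BBop_anti_le hBN _ _).trans ?_) (by positivity)
  have k1 := norm_polyCub_le (P := P) h.snd.fst y.snd.fst
  have k2 := (norm_add_le (polyCub P h.snd.fst y.snd.snd)
    (polyThird P h.snd.fst y.snd.fst h.snd.snd)).trans
    (add_le_add (norm_polyCub_le _ _) (norm_polyThird_le _ _ _))
  rw [← mul_add] at k2
  replace k1 := pow_le_pow_left₀ (norm_nonneg _) k1 2
  replace k2 := pow_le_pow_left₀ (norm_nonneg _) k2 2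
  have e : (‖Mone P N BN‖ * Real.sqrt 10 * kappa P * normM2 (symbInv P) * (‖h‖ ^ 2 * ‖y‖)) ^ 2
      = ‖Mone P N BN‖ ^ 2 * (10 * (kappa P * normM2 (symbInv P)) ^ 2
        * ((‖h‖ ^ 2) ^ 2 * ‖y‖ ^ 2)) := by
    have : Real.sqrt 10 ^ 2 = 10 := Real.sq_sqrt (by norm_num)
    linear_combination ‖Mone P N BN‖ ^ 2 * (kappa P * normM2 (symbInv P)) ^ 2
        * ((‖h‖ ^ 2) ^ 2 * ‖y‖ ^ 2) * this
  rw [e]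
  gcongr
  refine (add_le_add k1 k2).trans ?_
  rw [mul_pow, mul_pow _ (_ + _), ← mul_add, mul_pow, Real.sq_sqrt (by norm_num)]
  have hh := norm_sq_H1 h
  have hy := norm_sq_H1 y
  have h1 : ‖h.snd.fst‖ ^ 2 + ‖h.snd.snd‖ ^ 2 ≤ ‖h‖ ^ 2 := by nlinarith [sq_nonneg h.fst]
  have h2 : ‖y.snd.fst‖ ^ 2 + ‖y.snd.snd‖ ^ 2 ≤ ‖y‖ ^ 2 := by nlinarith [sq_nonneg y.fst]
  set x := ‖h.snd.fst‖
  set x' := ‖h.snd.snd‖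
  set X := ‖y.snd.fst‖
  set X' := ‖y.snd.snd‖
  have h3 : (x ^ 2 * X) ^ 2 + (x ^ 2 * X' + 2 * (x * X * x')) ^ 2
      ≤ 2 * ((x ^ 2 + x' ^ 2) ^ 2 * (X ^ 2 + X' ^ 2)) := by
    -- The 2 obtained here times the 5 from the two preceding norm bounds gives the 10 under the
    -- root.
    nlinarith [sq_nonneg (x ^ 2 * X - 2 * (x * x') * X'), sq_nonneg (x ^ 2 * X'),
      sq_nonneg (x' ^ 2 * X), sq_nonneg (x' ^ 2 * X')]
  have h4 : (x ^ 2 + x' ^ 2) ^ 2 * (X ^ 2 + X' ^ 2) ≤ (‖h‖ ^ 2) ^ 2 * ‖y‖ ^ 2 := by gcongr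
  have h5 : 0 ≤ (kappa P * normM2 (symbInv P)) ^ 2 := sq_nonneg _
  nlinarith

theorem inner_MtwoAt_conj_le (x : H1 P) (h1 : q1 P x ∈ trigPoly P) (h2 : q2 P x ∈ trigPoly P)
    (h3 : q3 P x ∈ trigPoly P) (h4 : q4 P x ∈ trigPoly P) (w : X2 P) :
    inner ℝ (MtwoAt P x ((Mone P N BN).adjoint w)) ((Mone P N BN).adjoint w) ≤
      4 * P.d * phi (Z23 P N BN x) (Z24 P N BN x) (Z24 P N BN x) (Z25 P x) * ‖w‖ ^ 2 := by
  have hTa : (MtwoAt P x).adjoint = MtwoAt P x := by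
    have hT : MtwoAt P x = _ := Mtwo_eq_factor h1 h2 h3 h4
    rw [hT, ContinuousLinearMap.adjoint_comp, ContinuousLinearMap.adjoint_adjoint]
  have hZ25 : 0 ≤ Z25 P x := phi_nonneg (l1norm_nonneg _) (l1norm_nonneg _)
  have hle : ∀ y, inner ℝ (MtwoAt P x y) y ≤ Z25 P x * ‖y‖ ^ 2 := inner_Mtwo_le h1 h2 h3 h4
  exact inner_Mone_conj_le P hBN (MtwoAt P x) hTa hZ25 hle w

/-- Bound for the operator `M₁` on the range of the factor of `M₂`. -/
theorem norm_sq_Mone_factor_le (x : H1 P) (h1 : q1 P x ∈ trigPoly P) (h2 : q2 P x ∈ trigPoly P)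
    (h3 : q3 P x ∈ trigPoly P) (h4 : q4 P x ∈ trigPoly P) (z : Pair (Pair (Ell 1))) :
    ‖Mone P N BN (factor (conv P (gam P (q1 P x))) (conv P (gam P (q2 P x)))
      (conv P (gam P (q3 P x))) (conv P (gam P (q4 P x))) z)‖ ^ 2 ≤
      4 * P.d * phi (Z23 P N BN x) (Z24 P N BN x) (Z24 P N BN x) (Z25 P x) * ‖z‖ ^ 2 := by
  have hd := P.one_le_d
  have hZ25 : 0 ≤ Z25 P x := phi_nonneg (l1norm_nonneg _) (l1norm_nonneg _)
  have hΦ0 : 0 ≤ phi (Z23 P N BN x) (Z24 P N BN x) (Z24 P N BN x) (Z25 P x) :=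
    phi_nonneg (Real.sqrt_nonneg _) hZ25
  have hT : MtwoAt P x = _ := Mtwo_eq_factor h1 h2 h3 h4
  have hin := inner_MtwoAt_conj_le hBN x h1 h2 h3 h4
  generalize phi (Z23 P N BN x) (Z24 P N BN x) (Z24 P N BN x) (Z25 P x) = Φ at *
  generalize MtwoAt P x = T at *
  subst hT
  have h := norm_sq_comp_le_of_adjoint _ (Mone P N BN) (C := 4 * P.d * Φ) (by positivity) hin z
  refine le_trans (le_of_eq ?_) (h.trans (le_of_eq ?_))
  · congr 2
  · congr 2

/-- Bound for the terms with the multipliers `q_i`. -/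
theorem norm_sq_BBop_mul_le (x : H1 P) (h1 : q1 P x ∈ trigPoly P) (h2 : q2 P x ∈ trigPoly P)
    (h3 : q3 P x ∈ trigPoly P) (h4 : q4 P x ∈ trigPoly P)
    (hν : (2 * P.nu4) ^ 2 + P.nu5 ^ 2 ≤ Z25 P x) (p p' : Pair L2e) :
    ‖BBop P N BN (trip 0 (anti (hessOp x p)) (anti (hessOp x p' + thirdOp x p)))‖ ^ 2 ≤
      2 * phi (Z23 P N BN x) (Z24 P N BN x) (Z24 P N BN x) (Z25 P x)
        * (‖p‖ ^ 2 + ‖p'‖ ^ 2) := by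
  have hd := P.one_le_d
  have hZ24 : 0 ≤ Z24 P N BN x := Real.sqrt_nonneg _
  have hZ25 : 0 ≤ Z25 P x := phi_nonneg (l1norm_nonneg _) (l1norm_nonneg _)
  have hin := norm_sq_Mone_factor_le hBN x h1 h2 h3 h4
    (pair (pair (gam P p.fst) (gam P p.snd)) (pair (gam P p'.fst) (gam P p'.snd)))
  have hΦ0 : 0 ≤ phi (Z23 P N BN x) (Z24 P N BN x) (Z24 P N BN x) (Z25 P x) :=
    phi_nonneg hZ24 hZ25
  have hν' : (2 * P.nu4) ^ 2 + P.nu5 ^ 2 ≤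
      phi (Z23 P N BN x) (Z24 P N BN x) (Z24 P N BN x) (Z25 P x) := hν.trans (le_phi hZ24)
  generalize phi (Z23 P N BN x) (Z24 P N BN x) (Z24 P N BN x) (Z25 P x) = Φ at *
  rw [factor_apply, norm_sq_pair, norm_sq_pair, norm_sq_pair] at hin
  simp only [fst_toLp, snd_toLp] at hin
  rw [norm_sq_BBop_anti, map_add (gam P), map_add (mulOut P), gam_hessOp x h1 h2,
    gam_hessOp x h1 h2, gam_thirdOp x h3 h4, mulOut_hessOp x h1 h2, mulOut_hessOp x h1 h2,
    mulOut_thirdOp x h3 h4, add_zero, add_comm (_ + _) (conv P (gam P (q3 P x)) _ + _)]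
  -- Cauchy–Schwarz for the constant multipliers outside `Ω₀`, whose squares sum to at most `Φ`.
  have key : ∀ a b : L2e, ‖(2 * P.nu4) • a + P.nu5 • b‖ ^ 2 ≤ Φ * (‖a‖ ^ 2 + ‖b‖ ^ 2) := by
    intro a b
    have e := pow_le_pow_left₀ (norm_nonneg _) (norm_add_le ((2 * P.nu4) • a) (P.nu5 • b)) 2
    rw [norm_smul, norm_smul, Real.norm_eq_abs, Real.norm_eq_abs] at e
    have e2 : (|2 * P.nu4| * ‖a‖ + |P.nu5| * ‖b‖) ^ 2
        ≤ (|2 * P.nu4| ^ 2 + |P.nu5| ^ 2) * (‖a‖ ^ 2 + ‖b‖ ^ 2) := by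
      nlinarith [sq_nonneg (|2 * P.nu4| * ‖b‖ - |P.nu5| * ‖a‖)]
    rw [sq_abs, sq_abs] at e2
    exact e.trans (e2.trans (by gcongr))
  have k1 := key (mulOut P p.fst) (mulOut P p.snd)
  have k2 := key (mulOut P p'.fst) (mulOut P p'.snd)
  have b1 := norm_sq_out_add_in_le P p.fst
  have b2 := norm_sq_out_add_in_le P p.snd
  have b3 := norm_sq_out_add_in_le P p'.fst
  have b4 := norm_sq_out_add_in_le P p'.snd
  rw [← norm_sq_gam] at b1 b2 b3 b4
  rw [norm_sq_pair, norm_sq_pair]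
  -- The inner part has the factor `4d = 2 · 2d`, where `2d` turns the coefficient norms into
  -- weighted ones, and the outer part has the factor 2; they recombine to `2Φ` times full norms.
  have c := mul_le_mul_of_nonneg_left (add_le_add (add_le_add b1 b2) (add_le_add b3 b4)) hΦ0
  linarith

omit hBN

theorem norm_bil_le (h v : He P) : ‖bil h v‖ ≤ Real.sqrt 3 * (kappa P * ‖h‖ * ‖v‖) := by
  have hk : 0 ≤ kappa P := kappa_nonneg
  refine le_of_sq_le_sq ((norm_sq_bilinear_le h v).trans_eq ?_) (by positivity)
  rw [mul_pow (Real.sqrt 3), Real.sq_sqrt (by norm_num)]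

/-- The 6 is the 3 for a single bilinear term times a 2 from Cauchy–Schwarz over the components `u`,
`w` of `h` and `y`. -/
theorem norm_sq_bil_add_le (h y : H1 P) :
    ‖bil h.snd.fst y.snd.fst‖ ^ 2 + ‖bil h.snd.fst y.snd.snd + bil h.snd.snd y.snd.fst‖ ^ 2
      ≤ 6 * kappa P ^ 2 * (‖h‖ * ‖y‖) ^ 2 := by
  have n1 := norm_sq_bilinear_le (P := P) h.snd.fst y.snd.fst
  have n2 := (norm_add_le _ _).trans (add_le_add (norm_bil_le (P := P) h.snd.fst y.snd.snd)
    (norm_bil_le h.snd.snd y.snd.fst))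
  rw [← mul_add] at n2
  have n3 := pow_le_pow_left₀ (norm_nonneg _) n2 2
  rw [mul_pow, Real.sq_sqrt (by norm_num)] at n3
  refine (add_le_add n1 n3).trans ?_
  have m1 : ‖h.snd.fst‖ ^ 2 + ‖h.snd.snd‖ ^ 2 ≤ ‖h‖ ^ 2 := by
    rw [norm_sq_H1 h]; nlinarith [sq_nonneg h.fst]
  have m2 : ‖y.snd.fst‖ ^ 2 + ‖y.snd.snd‖ ^ 2 ≤ ‖y‖ ^ 2 := by
    rw [norm_sq_H1 y]; nlinarith [sq_nonneg y.fst]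
  generalize ‖h.snd.fst‖ = u at *
  generalize ‖h.snd.snd‖ = u' at *
  generalize ‖y.snd.fst‖ = X at *
  generalize ‖y.snd.snd‖ = X' at *
  have m3 : (u ^ 2 + u' ^ 2) * (X ^ 2 + X' ^ 2) ≤ (‖h‖ * ‖y‖) ^ 2 := by
    rw [mul_pow]; gcongr
  have m4 : (u * X) ^ 2 + (u * X' + u' * X) ^ 2 ≤ 2 * ((u ^ 2 + u' ^ 2) * (X ^ 2 + X' ^ 2)) := by
    nlinarith [sq_nonneg (u * X' - u' * X), sq_nonneg (u * X), sq_nonneg (u' * X')]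
  have m5 := mul_le_mul_of_nonneg_left (m4.trans (mul_le_mul_of_nonneg_left m3 zero_le_two))
    (sq_nonneg (kappa P))
  linarith

include hBN

/-- The squared constant obtained is `2 · 6 = 12` times `κ² φ`, below the required 25. -/
theorem norm_linPart_le (x : H1 P) (h1 : q1 P x ∈ trigPoly P) (h2 : q2 P x ∈ trigPoly P)
    (h3 : q3 P x ∈ trigPoly P) (h4 : q4 P x ∈ trigPoly P)
    (hν : (2 * P.nu4) ^ 2 + P.nu5 ^ 2 ≤ Z25 P x) (h y : H1 P) :
    ‖BBop P N BN (trip 0 (anti (polyHess P x.snd.fst h.snd.fst y.snd.fst))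
        (anti (polyHess P x.snd.fst h.snd.fst y.snd.snd
          + polyHess P x.snd.fst h.snd.snd y.snd.fst
          + polyThird P h.snd.fst y.snd.fst x.snd.snd)))‖ ≤
      5 * kappa P * Real.sqrt (phi (Z23 P N BN x) (Z24 P N BN x) (Z24 P N BN x) (Z25 P x))
        * (‖h‖ * ‖y‖) := by
  have hk : 0 ≤ kappa P := kappa_nonneg
  rw [polyHess_eq x h1 h2, polyHess_eq x h1 h2, polyHess_eq x h1 h2, polyThird_eq x h3 h4,
    ← hessOp_add]
  have hΦ0 : 0 ≤ phi (Z23 P N BN x) (Z24 P N BN x) (Z24 P N BN x) (Z25 P x) :=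
    phi_nonneg (Real.sqrt_nonneg _) (phi_nonneg (l1norm_nonneg _) (l1norm_nonneg _))
  have m := norm_sq_BBop_mul_le hBN x h1 h2 h3 h4 hν (bil h.snd.fst y.snd.fst)
    (bil h.snd.fst y.snd.snd + bil h.snd.snd y.snd.fst)
  generalize phi (Z23 P N BN x) (Z24 P N BN x) (Z24 P N BN x) (Z25 P x) = Φ at *
  refine le_of_sq_le_sq (m.trans ?_) (by positivity)
  rw [mul_pow, mul_pow (5 * kappa P), Real.sq_sqrt hΦ0]
  have m6 := mul_le_mul_of_nonneg_left (norm_sq_bil_add_le h y) hΦ0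
  have m7 : 0 ≤ Φ * (kappa P ^ 2 * (‖h‖ * ‖y‖) ^ 2) := by positivity
  linarith

end Parts

end

/-! ### Assembling the estimate -/

section Bound

variable {P : Params} {N : ℕ} {BN : X2 P →L[ℝ] X2 P}

theorem BBop_add (x y : Trip (Pair L2e)) : BBop P N BN (x + y) = BBop P N BN x + BBop P N BN y :=
  ContinuousLinearMap.map_add _ _ _

theorem norm_BBop_add₃_le {x y z : Trip (Pair L2e)} {a b c : ℝ} (hx : ‖BBop P N BN x‖ ≤ a)
    (hy : ‖BBop P N BN y‖ ≤ b) (hz : ‖BBop P N BN z‖ ≤ c) :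
    ‖BBop P N BN (x + y + z)‖ ≤ a + b + c := by
  rw [BBop_add, BBop_add]
  exact norm_add₃_le.trans (add_le_add (add_le_add hx hy) hz)

theorem norm_AAop_fderiv_sub_apply_le (hBN : BN = projBarLe P N ∘L BN ∘L projBarLe P N)
    (ξ : He P) (α : ℝ) (x : H1 P) (hx : x.fst = P.nubar)
    (h1 : q1 P x ∈ trigPoly P) (h2 : q2 P x ∈ trigPoly P)
    (h3 : q3 P x ∈ trigPoly P) (h4 : q4 P x ∈ trigPoly P)
    (hν : (2 * P.nu4) ^ 2 + P.nu5 ^ 2 ≤ Z25 P x) (h y : H1 P) :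
    ‖AAop P N BN ((fderiv ℝ (Fmap P ξ α) (x + h) - fderiv ℝ (Fmap P ξ α) x) y)‖ ≤
      Z21 P BN * (‖h‖ * ‖y‖) + 5 * kappa P
        * Real.sqrt (phi (Z23 P N BN x) (Z24 P N BN x) (Z24 P N BN x) (Z25 P x)) * (‖h‖ * ‖y‖)
      + ‖Mone P N BN‖ * Real.sqrt 10 * kappa P * normM2 (symbInv P) * (‖h‖ ^ 2 * ‖y‖) := by
  rw [norm_AAop, fderiv_Fmap_sub P ξ α x h y hx]
  exact norm_BBop_add₃_le (norm_lapPart_le hBN h y) (norm_linPart_le hBN x h1 h2 h3 h4 hν h y)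
    (norm_cubPart_le hBN h y)

/-- There is slack in two places: 1 was obtained in place of `1 + √3`, and `√10` in place of `2
√10`. -/
theorem add_mul_le_Z2_mul (x : H1 P) {r a b : ℝ} (ha : 0 ≤ a) (hb : 0 ≤ b) (har : a ≤ r) :
    Z21 P BN * (a * b) + 5 * kappa P
        * Real.sqrt (phi (Z23 P N BN x) (Z24 P N BN x) (Z24 P N BN x) (Z25 P x)) * (a * b)
      + ‖Mone P N BN‖ * Real.sqrt 10 * kappa P * normM2 (symbInv P) * (a ^ 2 * b)
      ≤ Z2 P N BN x r * r * b := by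
  have hk : 0 ≤ kappa P := kappa_nonneg
  have hn : 0 ≤ normM2 (symbInv P) := normM2_nonneg _
  have hr : 0 ≤ r := ha.trans har
  have hz : 0 ≤ Z21 P BN := mul_nonneg (zero_le_one.trans (le_max_left _ _)) (normM1_nonneg _)
  have hc : 0 ≤ ‖Mone P N BN‖ * Real.sqrt 10 * kappa P * normM2 (symbInv P) := by positivity
  have hl : 0 ≤ 5 * kappa P
      * Real.sqrt (phi (Z23 P N BN x) (Z24 P N BN x) (Z24 P N BN x) (Z25 P x)) := by positivity
  rw [Z2, Z22, show ‖Mone P N BN‖ * (2 * Real.sqrt 10) * kappa P * normM2 (symbInv P) * r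
    = 2 * (‖Mone P N BN‖ * Real.sqrt 10 * kappa P * normM2 (symbInv P)) * r by ring]
  generalize ‖Mone P N BN‖ * Real.sqrt 10 * kappa P * normM2 (symbInv P) = c at *
  generalize 5 * kappa P
    * Real.sqrt (phi (Z23 P N BN x) (Z24 P N BN x) (Z24 P N BN x) (Z25 P x)) = l at *
  generalize Z21 P BN = z at *
  have e1 : z * (a * b) ≤ z * (r * b) := by gcongr
  have e2 : l * (a * b) ≤ l * (r * b) := by gcongr
  have e3 : c * (a ^ 2 * b) ≤ c * (r ^ 2 * b) := by gcongr
  have e4 : 0 ≤ c * (r ^ 2 * b) := by positivity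
  have e5 : 0 ≤ Real.sqrt 3 * (z * (r * b)) := by positivity
  linarith

theorem Z2_nonneg (x : H1 P) {r : ℝ} (hr : 0 ≤ r) : 0 ≤ Z2 P N BN x r := by
  have hk : 0 ≤ kappa P := kappa_nonneg
  have hn : 0 ≤ normM2 (symbInv P) := normM2_nonneg _
  have hz : 0 ≤ Z21 P BN := mul_nonneg (zero_le_one.trans (le_max_left _ _)) (normM1_nonneg _)
  rw [Z2, Z22]
  positivity

theorem opNorm_le_of_forall_H1 (L : H1 P →L[ℝ] H1 P) {C : ℝ} (hC : 0 ≤ C)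
    (h : ∀ y, ‖L y‖ ≤ C * ‖y‖) : ‖L‖ ≤ C := by
  refine ContinuousLinearMap.opNorm_le_bound _ hC ?_
  exact h

theorem norm_AAop_comp_apply_le (L : H1 P →L[ℝ] H2) {C : ℝ}
    (h : ∀ y, ‖AAop P N BN (L y)‖ ≤ C * ‖y‖) (y : H1 P) : ‖(AAop P N BN ∘L L) y‖ ≤ C * ‖y‖ := by
  rw [ContinuousLinearMap.comp_apply]
  exact h y

theorem opNorm_AAop_comp_le (L : H1 P →L[ℝ] H2) {C : ℝ} (hC : 0 ≤ C)
    (h : ∀ y, ‖AAop P N BN (L y)‖ ≤ C * ‖y‖) : ‖AAop P N BN ∘L L‖ ≤ C :=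
  opNorm_le_of_forall_H1 _ hC (norm_AAop_comp_apply_le L h)

end Bound

end SaddleNode

end

/-! ### The main theorem -/

theorem mainTheorem11 (P : SaddleNode.Params)
    (ξ : SaddleNode.He P) (α : ℝ)
    (N₀ N : ℕ)
    (Ubar Wbar : SaddleNode.Ell2e)
    (hUbar : SaddleNode.diag2 (SaddleNode.projLe 1 N₀) Ubar = Ubar)
    (hWbar : SaddleNode.diag2 (SaddleNode.projLe 1 N₀) Wbar = Wbar)
    (ubar wbar : SaddleNode.He P)
    (hubar₁ : SaddleNode.He.fun1 P ubar = SaddleNode.gamDag P Ubar.fst)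
    (hubar₂ : SaddleNode.He.fun2 P ubar = SaddleNode.gamDag P Ubar.snd)
    (hwbar₁ : SaddleNode.He.fun1 P wbar = SaddleNode.gamDag P Wbar.fst)
    (hwbar₂ : SaddleNode.He.fun2 P wbar = SaddleNode.gamDag P Wbar.snd)
    (xbar : SaddleNode.H1 P) (hxbar : xbar = SaddleNode.trip P.nubar ubar wbar)
    (BN : SaddleNode.X2 P →L[ℝ] SaddleNode.X2 P)
    (hBN : BN = SaddleNode.projBarLe P N ∘L BN ∘L SaddleNode.projBarLe P N) :
    (∀ ν : ℝ, Differentiable ℝ (SaddleNode.fmap P ν)) ∧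
    Differentiable ℝ (SaddleNode.Fmap P ξ α) ∧
    ∀ (r : ℝ) (h : SaddleNode.H1 P), ‖h‖ ≤ r →
      ‖SaddleNode.AAop P N BN ∘L
          (fderiv ℝ (SaddleNode.Fmap P ξ α) (xbar + h) - fderiv ℝ (SaddleNode.Fmap P ξ α) xbar)‖
        ≤ SaddleNode.Z2 P N BN xbar r * r := by
  open SaddleNode in
  refine ⟨fun ν u => (hasFDerivAt_fmap P ν u).differentiableAt, fun x => ?_, fun r h hr => ?_⟩
  · obtain ⟨L, hL, -⟩ := hasFDerivAt_Fmap P ξ α x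
    exact hL.differentiableAt
  · have u1 : projLe 1 N₀ Ubar.fst = Ubar.fst := by
      rw [diag2_apply] at hUbar; exact congrArg (fun p : Ell2e => p.fst) hUbar
    have u2 : projLe 1 N₀ Ubar.snd = Ubar.snd := by
      rw [diag2_apply] at hUbar; exact congrArg (fun p : Ell2e => p.snd) hUbar
    have w1 : projLe 1 N₀ Wbar.fst = Wbar.fst := by
      rw [diag2_apply] at hWbar; exact congrArg (fun p : Ell2e => p.fst) hWbar
    have w2 : projLe 1 N₀ Wbar.snd = Wbar.snd := by
      rw [diag2_apply] at hWbar; exact congrArg (fun p : Ell2e => p.snd) hWbar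
    have e1 : He.fun1 P xbar.snd.fst = gamDag P Ubar.fst := by rw [hxbar]; exact hubar₁
    have e2 : He.fun2 P xbar.snd.fst = gamDag P Ubar.snd := by rw [hxbar]; exact hubar₂
    have e3 : He.fun1 P xbar.snd.snd = gamDag P Wbar.fst := by rw [hxbar]; exact hwbar₁
    have e4 : He.fun2 P xbar.snd.snd = gamDag P Wbar.snd := by rw [hxbar]; exact hwbar₂
    have h1 : q1 P xbar ∈ trigPoly P := by
      rw [q1, e2]
      exact add_mem (Submodule.smul_mem _ _ (gamDag_mem_trigPoly u2))
        (Submodule.smul_mem _ _ indOmega_mem_trigPoly)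
    have h2 : q2 P xbar ∈ trigPoly P := by
      rw [q2, e1]
      exact add_mem (Submodule.smul_mem _ _ (gamDag_mem_trigPoly u1))
        (Submodule.smul_mem _ _ indOmega_mem_trigPoly)
    have h3 : q3 P xbar ∈ trigPoly P := by
      rw [q3, e4]; exact Submodule.smul_mem _ _ (gamDag_mem_trigPoly w2)
    have h4 : q4 P xbar ∈ trigPoly P := by
      rw [q4, e3]; exact Submodule.smul_mem _ _ (gamDag_mem_trigPoly w1)
    -- The last argument of `φ` in `𝓩_{2,5}` bounds the sum of all four squares `q_i²`, hence `q₁² +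
    -- q₂²`.
    have hν : (2 * P.nu4) ^ 2 + P.nu5 ^ 2 ≤ Z25 P xbar := by
      refine nu_sq_le xbar e1 e2 ?_
      filter_upwards [ae_add_four_mulOp_le h1 h2 h3 h4] with t ht
      refine le_trans ?_ (ht.trans (le_phi (l1norm_nonneg _)))
      nlinarith [sq_nonneg ((q3 P xbar : L2) t), sq_nonneg ((q4 P xbar : L2) t)]
    have hx : xbar.fst = P.nubar := by rw [hxbar]; rfl
    have hr0 : 0 ≤ r := (norm_nonneg h).trans hr
    have hb : ∀ y, ‖AAop P N BN ((fderiv ℝ (Fmap P ξ α) (xbar + h)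
        - fderiv ℝ (Fmap P ξ α) xbar) y)‖ ≤ Z2 P N BN xbar r * r * ‖y‖ := fun y =>
      (norm_AAop_fderiv_sub_apply_le hBN ξ α xbar hx h1 h2 h3 h4 hν h y).trans
        (add_mul_le_Z2_mul xbar (norm_nonneg h) (norm_nonneg y) hr)
    refine opNorm_AAop_comp_le (C := Z2 P N BN xbar r * r) _ (mul_nonneg (Z2_nonneg xbar hr0) hr0) ?_
    intro y
    refine le_trans (le_of_eq ?_) (hb y)
    congr 1
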